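/- Let $a,b,\gamma,k_i,k_e$ be positive constants and $I=(1,2)$. Put $H(r)=2(1-\tfrac1r)$, $H'=\tfrac{2}{r^2}$, $h(\ell)=a\ell e^{-b/\ell}$ (with $h(0)=0$) and $g(\ell)=h(\ell)-\tfrac{\ell^2}{4}$. Let $L^2(I)$, $H^k(I)$ be the real Lebesgue and Sobolev spaces with the weight $r^2$, and let $$X=\{(\rho,R,V)\in H^1(I)\times H^2(I)\times H^3(I):\ \rho(1)=R(1)=V(1)=V(2)=0\},\qquad Y=L^2(I)\times L^2(I)\times H^1(I)\times\mathbb R .$$ For $\lambda>0$ and $u=(\rho,R,V)\in X$ let $\mathscr F(\lambda,u)=(\mathscr F_1,\mathscr F_2,\mathscr F_3,\mathscr F_4)\in Y$ be given by $$\mathscr F_1=\tfrac{k_i}{r^2}\{r^2\rho(V'+\lambda H')\}'-k_e h(|V'+\lambda H'|)e^{-\frac\lambda2H}R,$$ $$\mathscr F_2=-\tfrac1{r^2}(r^2R')'-V'R'+\Big\{\tfrac\lambda2V'H'-\tfrac1{r^2}(r^2V')'+\tfrac{\lambda^2}4|H'|^2-h(|V'+\lambda H'|)\Big\}R,$$ $$\mathscr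 F_3=\tfrac1{r^2}(r^2V')'-\rho+e^{-\frac\lambda2H}R,$$ $$\mathscr F_4=\Big[R'+\big(\tfrac\lambda2H'+V'\big)R-\gamma\tfrac{k_i}{k_e}e^{\frac\lambda2H}(V'+\lambda H')\rho\Big]_{r=2}.$$ The electron system for $(\lambda,\varphi)$, $\lambda>0$, $\varphi\in H^2(I)$, is $$-\tfrac1{r^2}(r^2\varphi')'-g(\lambda H')\varphi=0\ \text{ in } I,\qquad \varphi(1)=0,\quad \varphi>0\text{ in }I,$$ $$\varphi'(2)+\tfrac\lambda4\varphi(2)-a\gamma\tfrac\lambda2e^{-\frac\lambda2}\int_1^2e^{-\frac{br^2}{2\lambda}}e^{\frac\lambda r}\varphi\,dr=0 .$$ The sparking set $\mathscr S$ is the set of $(a,b,\gamma)$ for which the electron system has a solution $(\lambda,\varphi)$, and then $\lambda^\dagger$ denotes the infimum of all $\lambda>0$ for which there is such a $\varphi$. The adjoint problem for $\psi\in H^2(I)$ is $$-\tfrac1{r^2}(r^2\psi')'-g(\lambda H')\psi-h(\lambda H')e^{-\frac\lambda2H}\gamma e^{\frac\lambda2}\psi(2)=0\ \text{ in } I,\qquad\psi(1)=0,\quad\psi'(2)+\tfrac\lambda4\psi(2)=0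 .$$ For $\varphi,\psi\in H^2(I)$ put $$F[\lambda,\varphi,\psi]=-\gamma e^{\frac\lambda2}\int_1^2r^2\psi(2)\Big\{h'(\lambda H')H'-h(\lambda H')\tfrac H2\Big\}e^{-\frac\lambda2H}\varphi\,dr-\int_1^2r^2\psi\,g'(\lambda H')H'\varphi\,dr+\psi(2)\Big\{\varphi(2)-2\varphi'(2)-\tfrac\lambda2\varphi(2)\Big\}.$$ **Proposition.** Let $(a,b,\gamma)\in\mathscr S$ and $\lambda=\lambda^\dagger$. Then $\lambda^\dagger>0$; the map $\mathscr F(\lambda,\cdot):X\to Y$ is Fréchet differentiable at $0$ for every $\lambda>0$; and $\lambda\mapsto\partial_u\mathscr F(\lambda,0)$ is differentiable in operator norm at $\lambda^\dagger$. With $\mathscr L=\partial_u\mathscr F(\lambda^\dagger,0)$, the null space $N(\mathscr L)$ contains a nonzero element whose second component solves the electron system with $\lambda=\lambda^\dagger$, and the adjoint problem with $\lambda=\lambda^\dagger$ has a nonzero solution. For every nonzero $\varphi^\dagger=(\varphi_i^\dagger,\varphi_e^\dagger,\varphi_v^\dagger)\in N(\mathscr L)$ and every nonzero solution $\psi_e$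 of the adjoint problem with $\lambda=\lambda^\dagger$, $$\partial_\lambda\partial_u\mathscr F(\lambda^\dagger,0)[1,\varphi^\dagger]\notin R(\mathscr L)\iff F[\lambda^\dagger,\varphi_e^\dagger,\psi_e]\neq0,$$ and the same equivalence holds with $\varphi_e^\dagger$ on the right replaced by any $\varphi_e$ such that $(\lambda^\dagger,\varphi_e)$ solves the electron system. -/

import Mathlib

open MeasureTheory Set
open scoped ContDiff

namespace GasDischarge

noncomputable section

/-- `v` is the weak derivative of `u` on the open interval `(1,2)`. -/
def HasWeakDeriv (u v : ℝ → ℝ) : Prop :=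
  LocallyIntegrableOn u (Ioo 1 2) ∧ LocallyIntegrableOn v (Ioo 1 2) ∧
    ∀ η : ℝ → ℝ, ContDiff ℝ ∞ η → HasCompactSupport η → tsupport η ⊆ Ioo 1 2 →
      ∫ r in Ioo (1 : ℝ) 2, u r * deriv η r = -∫ r in Ioo (1 : ℝ) 2, v r * η r

theorem LocallyIntegrableOn.integrableOn_mul_test {u η : ℝ → ℝ}
    (hu : LocallyIntegrableOn u (Ioo 1 2)) (hη : Continuous η) (hc : HasCompactSupport η)
    (hs : tsupport η ⊆ Ioo 1 2) : IntegrableOn (fun r => u r * η r) (Ioo 1 2) := by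
  have h1 : IntegrableOn u (tsupport η) := hu.integrableOn_compact_subset hs hc.isCompact
  have h2 : IntegrableOn (fun r => u r * η r) (tsupport η) :=
    h1.mul_continuousOn hη.continuousOn hc.isCompact
  have h3 : Integrable (fun r => u r * η r) := by
    rw [← integrableOn_iff_integrable_of_support_subset (s := tsupport η)]
    · exact h2
    · intro x hx
      apply subset_tsupport
      intro h
      apply hx
      simp [h]
  exact h3.integrableOn

theorem tsupport_deriv_subset {η : ℝ → ℝ} (hs : tsupport η ⊆ Ioo (1 : ℝ) 2) :
    tsupport (deriv η) ⊆ Ioo (1 : ℝ) 2 :=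
  (closure_minimal support_deriv_subset (isClosed_tsupport η)).trans hs

theorem HasWeakDeriv.unique {u v w : ℝ → ℝ} (hv : HasWeakDeriv u v) (hw : HasWeakDeriv u w) :
    v =ᵐ[volume.restrict (Ioo 1 2)] w := by
  have h := IsOpen.ae_eq_zero_of_integral_contDiff_smul_eq_zero (μ := volume)
    (f := fun x => v x - w x) (isOpen_Ioo (a := (1 : ℝ)) (b := 2)) (hv.2.1.sub hw.2.1) ?_
  · rw [Filter.EventuallyEq, ae_restrict_iff' measurableSet_Ioo]
    filter_upwards [h] with x hx hxI
    exact sub_eq_zero.1 (hx hxI)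
  · intro η h1 h2 h3
    have e1 := hv.2.2 η h1 h2 h3
    have e2 := hw.2.2 η h1 h2 h3
    rw [← setIntegral_eq_integral_of_forall_compl_eq_zero (s := Ioo (1 : ℝ) 2)]
    · have : ∀ x, η x • (v x - w x) = v x * η x - w x * η x := fun x => by
        simp only [smul_eq_mul]; ring
      simp_rw [this]
      rw [integral_sub (LocallyIntegrableOn.integrableOn_mul_test hv.2.1 h1.continuous h2 h3)
        (LocallyIntegrableOn.integrableOn_mul_test hw.2.1 h1.continuous h2 h3)]
      linarith
    · intro x hx
      have : η x = 0 := image_eq_zero_of_notMem_tsupport fun h => hx (h3 h)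
      simp [this]

theorem HasWeakDeriv.congr {u u' v v' : ℝ → ℝ} (h : HasWeakDeriv u v)
    (hu : u =ᵐ[volume.restrict (Ioo 1 2)] u') (hv : v =ᵐ[volume.restrict (Ioo 1 2)] v') :
    HasWeakDeriv u' v' := by
  refine ⟨?_, ?_, ?_⟩
  · intro x hx
    obtain ⟨s, hs, hi⟩ := h.1 x hx
    refine ⟨s ∩ Ioo 1 2, Filter.inter_mem hs self_mem_nhdsWithin, ?_⟩
    exact (hi.mono_set inter_subset_left).congr_fun_ae
      (ae_restrict_of_ae_restrict_of_subset inter_subset_right hu)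
  · intro x hx
    obtain ⟨s, hs, hi⟩ := h.2.1 x hx
    refine ⟨s ∩ Ioo 1 2, Filter.inter_mem hs self_mem_nhdsWithin, ?_⟩
    exact (hi.mono_set inter_subset_left).congr_fun_ae
      (ae_restrict_of_ae_restrict_of_subset inter_subset_right hv)
  · intro η h1 h2 h3
    have e1 := integral_congr_ae (hu.mul (Filter.EventuallyEq.refl _ (deriv η)))
    have e2 := integral_congr_ae (hv.mul (Filter.EventuallyEq.refl _ η))
    simp only [Pi.mul_apply] at e1 e2
    rw [← e1, ← e2]
    exact h.2.2 η h1 h2 h3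

theorem hasWeakDeriv_of_ac {f : ℝ → ℝ} (hf : AbsolutelyContinuousOnInterval f 1 2) :
    HasWeakDeriv f (deriv f) := by
  have hsub : Ioo (1 : ℝ) 2 ⊆ uIcc 1 2 := by
    rw [uIcc_of_le (by norm_num)]; exact Ioo_subset_Icc_self
  refine ⟨?_, ?_, ?_⟩
  · exact (hf.continuousOn.mono hsub).locallyIntegrableOn measurableSet_Ioo
  · have := hf.intervalIntegrable_deriv
    rw [intervalIntegrable_iff_integrableOn_Ioo_of_le (by norm_num)] at this
    exact this.locallyIntegrableOn
  · intro η h1 h2 h3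
    have hη : AbsolutelyContinuousOnInterval η 1 2 :=
      ContDiffOn.absolutelyContinuousOnInterval (h1.of_le (by exact_mod_cast le_top)).contDiffOn
    have z1 : η 1 = 0 := image_eq_zero_of_notMem_tsupport fun h => by
      have := h3 h; simp at this
    have z2 : η 2 = 0 := image_eq_zero_of_notMem_tsupport fun h => by
      have := h3 h; simp at this
    have := hf.integral_mul_deriv_eq_deriv_mul hη
    rw [z1, z2, intervalIntegral.integral_of_le (by norm_num),
      intervalIntegral.integral_of_le (by norm_num), integral_Ioc_eq_integral_Ioo,
      integral_Ioc_eq_integral_Ioo] at this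
    simpa using this

theorem hasWeakDeriv_add {u v u' v' : ℝ → ℝ} (h : HasWeakDeriv u v) (h' : HasWeakDeriv u' v') :
    HasWeakDeriv (u + u') (v + v') := by
  refine ⟨h.1.add h'.1, h.2.1.add h'.2.1, fun η h1 h2 h3 => ?_⟩
  have hd : Continuous (deriv η) := h1.continuous_deriv (by exact_mod_cast le_top)
  simp only [Pi.add_apply, add_mul]
  rw [integral_add, integral_add, h.2.2 η h1 h2 h3, h'.2.2 η h1 h2 h3, neg_add]
  · exact LocallyIntegrableOn.integrableOn_mul_test h.2.1 h1.continuous h2 h3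
  · exact LocallyIntegrableOn.integrableOn_mul_test h'.2.1 h1.continuous h2 h3
  · exact LocallyIntegrableOn.integrableOn_mul_test h.1 hd h2.deriv (tsupport_deriv_subset h3)
  · exact LocallyIntegrableOn.integrableOn_mul_test h'.1 hd h2.deriv (tsupport_deriv_subset h3)

theorem hasWeakDeriv_smul {u v : ℝ → ℝ} (c : ℝ) (h : HasWeakDeriv u v) :
    HasWeakDeriv (c • u) (c • v) := by
  refine ⟨h.1.smul c, h.2.1.smul c, fun η h1 h2 h3 => ?_⟩
  simp only [Pi.smul_apply, smul_eq_mul, mul_assoc, integral_const_mul]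
  rw [h.2.2 η h1 h2 h3, mul_neg]

theorem exists_test_primitive {ζ : ℝ → ℝ} (h1 : ContDiff ℝ ∞ ζ) (h2 : HasCompactSupport ζ)
    (h3 : tsupport ζ ⊆ Ioo 1 2) (h0 : ∫ x in Ioo (1 : ℝ) 2, ζ x = 0) :
    ∃ η : ℝ → ℝ, ContDiff ℝ ∞ η ∧ HasCompactSupport η ∧ tsupport η ⊆ Ioo 1 2 ∧ deriv η = ζ := by
  rcases (tsupport ζ).eq_empty_or_nonempty with he | hne
  · refine ⟨0, contDiff_const, HasCompactSupport.zero, by simp [tsupport], ?_⟩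
    have : ζ = 0 := tsupport_eq_empty_iff.1 he
    rw [this]; ext x; simp
  set α := sInf (tsupport ζ)
  set β := sSup (tsupport ζ)
  have hα : α ∈ Ioo (1 : ℝ) 2 := h3 (h2.isCompact.sInf_mem hne)
  have hβ : β ∈ Ioo (1 : ℝ) 2 := h3 (h2.isCompact.sSup_mem hne)
  have zl : ∀ x, x < α → ζ x = 0 := fun x hx => image_eq_zero_of_notMem_tsupport fun h =>
    absurd (csInf_le h2.isCompact.bddBelow h) (not_le.2 hx)
  have zr : ∀ x, β < x → ζ x = 0 := fun x hx => image_eq_zero_of_notMem_tsupport fun h =>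
    absurd (le_csSup h2.isCompact.bddAbove h) (not_le.2 hx)
  have hI : ∀ a b : ℝ, IntervalIntegrable ζ volume a b := fun a b =>
    h1.continuous.intervalIntegrable a b
  have hderiv : ∀ x, HasDerivAt (fun x => ∫ t in (1 : ℝ)..x, ζ t) (ζ x) x := fun x =>
    intervalIntegral.integral_hasDerivAt_right (hI _ _)
      (h1.continuous.stronglyMeasurableAtFilter _ _) h1.continuous.continuousAt
  have hd : deriv (fun x => ∫ t in (1 : ℝ)..x, ζ t) = ζ := funext fun x => (hderiv x).deriv
  have hl : ∀ x, x < α → ∫ t in (1 : ℝ)..x, ζ t = 0 := fun x hx => by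
    apply intervalIntegral.integral_zero_ae
    refine Filter.Eventually.of_forall fun t ht => zl t ?_
    have := ht.2
    rcases max_cases (1 : ℝ) x with h | h <;> [linarith [hα.1]; linarith]
  have htot : ∫ t in (1 : ℝ)..2, ζ t = 0 := by
    rw [intervalIntegral.integral_of_le (by norm_num), integral_Ioc_eq_integral_Ioo, h0]
  have hr : ∀ x, β < x → ∫ t in (1 : ℝ)..x, ζ t = 0 := fun x hx => by
    rw [← intervalIntegral.integral_add_adjacent_intervals (hI 1 2) (hI 2 x), htot, zero_add]
    apply intervalIntegral.integral_zero_ae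
    refine Filter.Eventually.of_forall fun t ht => zr t ?_
    have := ht.1
    rcases min_cases (2 : ℝ) x with h | h <;> linarith [hβ.2]
  have hsupp : tsupport (fun x => ∫ t in (1 : ℝ)..x, ζ t) ⊆ Icc α β := by
    apply closure_minimal _ isClosed_Icc
    intro x hx
    by_contra hcon
    apply hx
    rw [mem_Icc, not_and_or, not_le, not_le] at hcon
    rcases hcon with h | h
    · exact hl x h
    · exact hr x h
  refine ⟨fun x => ∫ t in (1 : ℝ)..x, ζ t, ?_, ?_, ?_, hd⟩
  · rw [contDiff_infty_iff_deriv, hd]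
    exact ⟨fun x => (hderiv x).differentiableAt, h1⟩
  · exact HasCompactSupport.of_support_subset_isCompact isCompact_Icc
      ((subset_tsupport _).trans hsupp)
  · exact hsupp.trans fun x hx => ⟨hα.1.trans_le hx.1, hx.2.trans_lt hβ.2⟩

theorem exists_const_of_hasWeakDeriv_zero {w : ℝ → ℝ} (hw : HasWeakDeriv w 0) :
    ∃ c : ℝ, w =ᵐ[volume.restrict (Ioo 1 2)] fun _ => c := by
  let b : ContDiffBump (3 / 2 : ℝ) := ⟨1 / 8, 1 / 4, by norm_num, by norm_num⟩
  let κ : ℝ → ℝ := b.normed volume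
  have k1 : ContDiff ℝ ∞ κ := b.contDiff_normed
  have k2 : HasCompactSupport κ := b.hasCompactSupport_normed
  have k3 : tsupport κ ⊆ Ioo 1 2 := by
    have : tsupport κ = Metric.closedBall (3 / 2 : ℝ) (1 / 4) := b.tsupport_normed_eq
    rw [this, Real.closedBall_eq_Icc]
    intro x hx
    exact ⟨by linarith [hx.1], by linarith [hx.2]⟩
  have k4 : ∫ x in Ioo (1 : ℝ) 2, κ x = 1 := by
    rw [setIntegral_eq_integral_of_forall_compl_eq_zero]
    · exact b.integral_normed
    · exact fun x hx => image_eq_zero_of_notMem_tsupport fun h => hx (k3 h)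
  set c : ℝ := ∫ x in Ioo (1 : ℝ) 2, w x * κ x with hc
  refine ⟨c, ?_⟩
  have hcl : LocallyIntegrableOn (fun _ : ℝ => c) (Ioo 1 2) :=
    continuousOn_const.locallyIntegrableOn measurableSet_Ioo
  have h := IsOpen.ae_eq_zero_of_integral_contDiff_smul_eq_zero (μ := volume)
    (f := fun x => w x - c) (isOpen_Ioo (a := (1 : ℝ)) (b := 2)) (hw.1.sub hcl) ?_
  · rw [Filter.EventuallyEq, ae_restrict_iff' measurableSet_Ioo]
    filter_upwards [h] with x hx hxI
    exact sub_eq_zero.1 (hx hxI)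
  · intro η h1 h2 h3
    set m : ℝ := ∫ x in Ioo (1 : ℝ) 2, η x with hm
    have iη : IntegrableOn η (Ioo 1 2) := (h1.continuous.integrable_of_hasCompactSupport h2).integrableOn
    have iκ : IntegrableOn κ (Ioo 1 2) := (k1.continuous.integrable_of_hasCompactSupport k2).integrableOn
    have iwη := LocallyIntegrableOn.integrableOn_mul_test hw.1 h1.continuous h2 h3
    have iwκ := LocallyIntegrableOn.integrableOn_mul_test hw.1 k1.continuous k2 k3
    have hsub : tsupport (η - m • κ) ⊆ tsupport η ∪ tsupport κ := by
      refine (tsupport_sub _ _).trans (union_subset_union_right _ ?_)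
      exact closure_mono (Function.support_const_smul_subset m κ)
    obtain ⟨θ, t1, t2, t3, t4⟩ := exists_test_primitive (ζ := η - m • κ)
      (h1.sub (k1.const_smul m))
      (HasCompactSupport.of_support_subset_isCompact (h2.isCompact.union k2.isCompact)
        ((subset_tsupport _).trans hsub))
      (hsub.trans (union_subset h3 k3)) (by
        simp only [Pi.sub_apply, Pi.smul_apply, smul_eq_mul]
        rw [integral_sub iη (iκ.const_mul m), integral_const_mul, k4]
        simp [hm])
    have key := hw.2.2 θ t1 t2 t3
    rw [t4] at key
    simp only [Pi.zero_apply, zero_mul, integral_zero, neg_zero, Pi.sub_apply, Pi.smul_apply,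
      smul_eq_mul, mul_sub] at key
    have e : ∀ x, w x * (m * κ x) = m * (w x * κ x) := fun x => by ring
    simp_rw [e] at key
    rw [integral_sub iwη (iwκ.const_mul m), integral_const_mul, ← hc] at key
    rw [← setIntegral_eq_integral_of_forall_compl_eq_zero (s := Ioo (1 : ℝ) 2)]
    · have : ∀ x, η x • (w x - c) = w x * η x - c * η x := fun x => by
        simp only [smul_eq_mul]; ring
      simp_rw [this]
      rw [integral_sub iwη (iη.const_mul c), integral_const_mul, ← hm]
      linarith
    · intro x hx
      have : η x = 0 := image_eq_zero_of_notMem_tsupport fun h => hx (h3 h)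
      simp [this]

/-- A function on `(1,2)` with an integrable weak derivative has an absolutely continuous
representative. -/
theorem HasWeakDeriv.exists_ac {u v : ℝ → ℝ} (h : HasWeakDeriv u v) (hv : IntegrableOn v (Ioo 1 2)) :
    ∃ g : ℝ → ℝ, AbsolutelyContinuousOnInterval g 1 2 ∧ g =ᵐ[volume.restrict (Ioo 1 2)] u := by
  have hvi : IntervalIntegrable v volume 1 2 :=
    (intervalIntegrable_iff_integrableOn_Ioo_of_le (by norm_num)).2 hv
  set G : ℝ → ℝ := fun x => ∫ t in (1 : ℝ)..x, v t with hG
  have acG : AbsolutelyContinuousOnInterval G 1 2 :=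
    hvi.absolutelyContinuousOnInterval_intervalIntegral (by simp)
  have hd : deriv G =ᵐ[volume.restrict (Ioo 1 2)] v := by
    rw [Filter.EventuallyEq, ae_restrict_iff' measurableSet_Ioo]
    filter_upwards [hvi.ae_hasDerivAt_integral] with x hx hxI
    have hx' : x ∈ uIcc (1 : ℝ) 2 := by
      rw [uIcc_of_le (by norm_num)]; exact Ioo_subset_Icc_self hxI
    exact (hx hx' 1 (by simp)).deriv
  have hGw : HasWeakDeriv G v := (hasWeakDeriv_of_ac acG).congr (Filter.EventuallyEq.refl _ _) hd
  have hz : HasWeakDeriv (u + (-1 : ℝ) • G) (v + (-1 : ℝ) • v) :=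
    hasWeakDeriv_add h (hasWeakDeriv_smul (-1) hGw)
  obtain ⟨c, hc⟩ := exists_const_of_hasWeakDeriv_zero (w := u + (-1 : ℝ) • G) (by
    refine hz.congr (Filter.EventuallyEq.refl _ _) (Filter.Eventually.of_forall fun x => ?_)
    simp)
  refine ⟨fun x => c + G x, ?_, ?_⟩
  · exact (ContDiffOn.absolutelyContinuousOnInterval (f := fun _ : ℝ => c) contDiffOn_const).fun_add acG
  · filter_upwards [hc] with x hx
    simp at hx
    linarith


/-- A weak derivative of `f` on `(1,2)` (unique up to null sets), and `0` if there is none. -/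
def weakDeriv (f : ℝ → ℝ) : ℝ → ℝ :=
  open Classical in if h : ∃ v, HasWeakDeriv f v then h.choose else 0

theorem weakDeriv_ae_eq {f v : ℝ → ℝ} (h : HasWeakDeriv f v) :
    weakDeriv f =ᵐ[volume.restrict (Ioo 1 2)] v := by
  have hex : ∃ v, HasWeakDeriv f v := ⟨v, h⟩
  rw [weakDeriv, dif_pos hex]
  exact hex.choose_spec.unique h

/-- The measure `r² dr` on the interval `I = (1,2)`. -/
def shellMeasure : Measure ℝ :=
  (volume.restrict (Ioo 1 2)).withDensity fun r => ENNReal.ofReal (r ^ 2)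

theorem restrict_le_shellMeasure : volume.restrict (Ioo 1 2) ≤ shellMeasure := by
  rw [shellMeasure]
  conv_lhs => rw [← withDensity_one (μ := volume.restrict (Ioo (1 : ℝ) 2))]
  apply withDensity_mono
  rw [Filter.EventuallyLE, ae_restrict_iff' measurableSet_Ioo]
  refine Filter.Eventually.of_forall fun r hr => ?_
  rw [Pi.one_apply, ← ENNReal.ofReal_one]
  exact ENNReal.ofReal_le_ofReal (by nlinarith [hr.1])

theorem shellMeasure_le : shellMeasure ≤ ENNReal.ofReal 4 • volume.restrict (Ioo 1 2) := by
  rw [shellMeasure, ← withDensity_const]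
  apply withDensity_mono
  rw [Filter.EventuallyLE, ae_restrict_iff' measurableSet_Ioo]
  refine Filter.Eventually.of_forall fun r hr => ?_
  exact ENNReal.ofReal_le_ofReal (by nlinarith [hr.1, hr.2])

theorem ae_shellMeasure : ae shellMeasure = ae (volume.restrict (Ioo (1 : ℝ) 2)) := by
  apply le_antisymm
  · exact (withDensity_absolutelyContinuous _ _).ae_le
  · exact (Measure.absolutelyContinuous_of_le restrict_le_shellMeasure).ae_le

theorem memLp_shell_iff {f : ℝ → ℝ} :
    MemLp f 2 shellMeasure ↔ MemLp f 2 (volume.restrict (Ioo 1 2)) :=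
  ⟨fun h => h.mono_measure restrict_le_shellMeasure,
    fun h => (h.smul_measure ENNReal.ofReal_ne_top).mono_measure shellMeasure_le⟩

/-- `L²(I)` with the inner product `∫₁² r² u v dr`. -/
abbrev L2 : Type := Lp ℝ 2 shellMeasure

theorem integrableOn_of_memLp {f : ℝ → ℝ} (hf : MemLp f 2 shellMeasure) :
    IntegrableOn f (Ioo 1 2) := by
  have : IsFiniteMeasure (volume.restrict (Ioo (1 : ℝ) 2)) := ⟨by simp⟩
  exact (memLp_shell_iff.1 hf).integrable (by norm_num)

/-- The Sobolev space `H^k(I)`: an element is the tuple `(u, u', …, u^(k))` of functions in `L²(I)`,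
each the weak derivative of the one before. The norm is inherited from the Euclidean product of
`k + 1` copies of `L²(I)`, so the inner product is `∑_{j ≤ k} ∫₁² r² u^(j) v^(j) dr`. -/
def sobolevSubmodule (k : ℕ) : Submodule ℝ (PiLp 2 fun _ : Fin (k + 1) => L2) where
  carrier := {u | ∀ j : Fin k, HasWeakDeriv (u j.castSucc) (u j.succ)}
  add_mem' {u v} hu hv j := by
    refine (hasWeakDeriv_add (hu j) (hv j)).congr ?_ ?_ <;> rw [← ae_shellMeasure]
    · exact (Lp.coeFn_add _ _).symm
    · exact (Lp.coeFn_add _ _).symm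
  zero_mem' j := by
    have h0 : HasWeakDeriv 0 0 := by
      refine ⟨locallyIntegrableOn_zero, locallyIntegrableOn_zero, by simp⟩
    refine h0.congr ?_ ?_ <;> rw [← ae_shellMeasure]
    · exact (Lp.coeFn_zero _ _ _).symm
    · exact (Lp.coeFn_zero _ _ _).symm
  smul_mem' c u hu j := by
    refine (hasWeakDeriv_smul c (hu j)).congr ?_ ?_ <;> rw [← ae_shellMeasure]
    · exact (Lp.coeFn_smul _ _).symm
    · exact (Lp.coeFn_smul _ _).symm

/-- The Sobolev space `H^k(I)` as a type, with the norm of `sobolevSubmodule k`. -/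
abbrev Sobolev (k : ℕ) : Type := sobolevSubmodule k

theorem Sobolev.exists_rep {k : ℕ} (u : Sobolev k) (j : Fin k) :
    ∃ g : ℝ → ℝ, AbsolutelyContinuousOnInterval g 1 2 ∧
      g =ᵐ[volume.restrict (Ioo 1 2)] (u.1 j.castSucc) :=
  (u.2 j).exists_ac (integrableOn_of_memLp (Lp.memLp _))

/-- The absolutely continuous representative on `[1,2]` of the `j`-th derivative of `u ∈ H^k(I)`,
where `j < k`; its values outside `[1,2]` are irrelevant. -/
def Sobolev.rep {k : ℕ} (u : Sobolev k) (j : Fin k) : ℝ → ℝ := (u.exists_rep j).choose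

theorem Sobolev.rep_ac {k : ℕ} (u : Sobolev k) (j : Fin k) :
    AbsolutelyContinuousOnInterval (u.rep j) 1 2 := (u.exists_rep j).choose_spec.1

theorem Sobolev.rep_ae_eq {k : ℕ} (u : Sobolev k) (j : Fin k) :
    u.rep j =ᵐ[volume.restrict (Ioo 1 2)] (u.1 j.castSucc) := (u.exists_rep j).choose_spec.2

theorem eqOn_of_ac {f g : ℝ → ℝ} (hf : AbsolutelyContinuousOnInterval f 1 2)
    (hg : AbsolutelyContinuousOnInterval g 1 2) (h : f =ᵐ[volume.restrict (Ioo 1 2)] g) :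
    EqOn f g (Icc 1 2) := by
  have hf' := hf.continuousOn
  have hg' := hg.continuousOn
  rw [uIcc_of_le (by norm_num)] at hf' hg'
  refine Measure.eqOn_Icc_of_ae_eq volume (by norm_num) ?_ hf' hg'
  rwa [restrict_Ioo_eq_restrict_Icc] at h

theorem Sobolev.rep_add {k : ℕ} (u v : Sobolev k) (j : Fin k) :
    EqOn ((u + v).rep j) (u.rep j + v.rep j) (Icc 1 2) := by
  refine eqOn_of_ac (Sobolev.rep_ac _ _) ((Sobolev.rep_ac _ _).add (Sobolev.rep_ac _ _)) ?_
  have h := Lp.coeFn_add (u.1 j.castSucc) (v.1 j.castSucc)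
  rw [ae_shellMeasure] at h
  exact (Sobolev.rep_ae_eq (u + v) j).trans (h.trans ((Sobolev.rep_ae_eq u j).add (Sobolev.rep_ae_eq v j)).symm)

theorem Sobolev.rep_smul {k : ℕ} (c : ℝ) (u : Sobolev k) (j : Fin k) :
    EqOn ((c • u).rep j) (fun x => c * u.rep j x) (Icc 1 2) := by
  refine eqOn_of_ac (Sobolev.rep_ac _ _) ((Sobolev.rep_ac _ _).const_mul c) ?_
  have h := Lp.coeFn_smul c (u.1 j.castSucc)
  rw [ae_shellMeasure] at h
  exact (Sobolev.rep_ae_eq (c • u) j).trans (h.trans ((Sobolev.rep_ae_eq u j).const_smul c).symm)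

theorem Sobolev.rep_zero {k : ℕ} (j : Fin k) : EqOn ((0 : Sobolev k).rep j) 0 (Icc 1 2) := by
  have h := Sobolev.rep_smul 0 (0 : Sobolev k) j
  intro x hx
  have := h hx
  simpa using this

/-- The functions with a representative in `H¹(I)`, in terms of classical derivatives. -/
structure IsH1 (f : ℝ → ℝ) : Prop where
  ac : AbsolutelyContinuousOnInterval f 1 2
  memLp : MemLp (deriv f) 2 shellMeasure

theorem ae_differentiableAt_of_ac {f : ℝ → ℝ} (hf : AbsolutelyContinuousOnInterval f 1 2) :
    ∀ᵐ x ∂shellMeasure, DifferentiableAt ℝ f x := by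
  rw [ae_shellMeasure, ae_restrict_iff' measurableSet_Ioo]
  filter_upwards [hf.ae_differentiableAt] with x hx hxI
  exact hx (by rw [uIcc_of_le (by norm_num)]; exact Ioo_subset_Icc_self hxI)

theorem ae_mem_shell : ∀ᵐ x ∂shellMeasure, x ∈ Ioo (1 : ℝ) 2 := by
  rw [ae_shellMeasure]; exact ae_restrict_mem measurableSet_Ioo

theorem memLp_bdd_mul {f g : ℝ → ℝ} (hf : AEStronglyMeasurable f shellMeasure)
    (hb : ∃ C, ∀ x ∈ Icc (1 : ℝ) 2, |f x| ≤ C) (hg : MemLp g 2 shellMeasure) :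
    MemLp (fun x => f x * g x) 2 shellMeasure := by
  obtain ⟨C, hC⟩ := hb
  refine (hg.const_mul C).mono (hf.mul hg.1) ?_
  filter_upwards [ae_mem_shell] with x hx
  rw [norm_mul, norm_mul]
  have := hC x (Ioo_subset_Icc_self hx)
  gcongr
  exact this.trans (le_abs_self C)

theorem aesm_of_continuousOn {f : ℝ → ℝ} (hf : ContinuousOn f (Icc 1 2)) :
    AEStronglyMeasurable f shellMeasure := by
  have h1 : AEStronglyMeasurable f (volume.restrict (Ioo 1 2)) :=
    (hf.mono Ioo_subset_Icc_self).aestronglyMeasurable measurableSet_Ioo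
  exact (h1.smul_measure (ENNReal.ofReal 4)).mono_measure shellMeasure_le

theorem memLp_cont_mul {f g : ℝ → ℝ} (hf : ContinuousOn f (Icc 1 2))
    (hg : MemLp g 2 shellMeasure) : MemLp (fun x => f x * g x) 2 shellMeasure :=
  memLp_bdd_mul (aesm_of_continuousOn hf)
    (isCompact_Icc.exists_bound_of_continuousOn hf) hg

theorem memLp_of_continuousOn {f : ℝ → ℝ} (hf : ContinuousOn f (Icc 1 2)) :
    MemLp f 2 shellMeasure := by
  have : IsFiniteMeasure (volume.restrict (Ioo (1 : ℝ) 2)) := ⟨by simp⟩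
  have h1 : MemLp (fun _ : ℝ => (1 : ℝ)) 2 shellMeasure := memLp_shell_iff.2 (memLp_const 1)
  simpa using memLp_cont_mul hf h1

theorem IsH1.continuousOn {f : ℝ → ℝ} (hf : IsH1 f) : ContinuousOn f (Icc 1 2) := by
  have := hf.ac.continuousOn
  rwa [uIcc_of_le (by norm_num)] at this

theorem IsH1.add {f g : ℝ → ℝ} (hf : IsH1 f) (hg : IsH1 g) : IsH1 fun x => f x + g x := by
  refine ⟨hf.ac.fun_add hg.ac, (memLp_congr_ae ?_).2 (hf.memLp.add hg.memLp)⟩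
  filter_upwards [ae_differentiableAt_of_ac hf.ac, ae_differentiableAt_of_ac hg.ac] with x h1 h2
  exact deriv_fun_add h1 h2

theorem IsH1.mul {f g : ℝ → ℝ} (hf : IsH1 f) (hg : IsH1 g) : IsH1 fun x => f x * g x := by
  refine ⟨hf.ac.fun_mul hg.ac, (memLp_congr_ae ?_).2
    ((memLp_cont_mul hg.continuousOn hf.memLp).add (memLp_cont_mul hf.continuousOn hg.memLp))⟩
  filter_upwards [ae_differentiableAt_of_ac hf.ac, ae_differentiableAt_of_ac hg.ac] with x h1 h2
  simp only [deriv_fun_mul h1 h2, Pi.add_apply]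
  ring

theorem isH1_of_contDiffOn {f : ℝ → ℝ} (hf : ContDiffOn ℝ 1 f (Ioi 0)) : IsH1 f := by
  refine ⟨ContDiffOn.absolutelyContinuousOnInterval (hf.mono ?_), memLp_of_continuousOn
    ((hf.continuousOn_deriv_of_isOpen isOpen_Ioi le_rfl).mono ?_)⟩
  · rw [uIcc_of_le (by norm_num)]; exact fun x hx => lt_of_lt_of_le one_pos hx.1
  · exact fun x hx => lt_of_lt_of_le one_pos hx.1

theorem IsH1.weakDeriv_ae {f : ℝ → ℝ} (hf : IsH1 f) : weakDeriv f =ᵐ[shellMeasure] deriv f := by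
  rw [ae_shellMeasure]
  exact weakDeriv_ae_eq (hasWeakDeriv_of_ac hf.ac)

theorem IsH1.memLp_weakDeriv {f : ℝ → ℝ} (hf : IsH1 f) : MemLp (weakDeriv f) 2 shellMeasure :=
  (memLp_congr_ae hf.weakDeriv_ae).2 hf.memLp

theorem Sobolev.deriv_rep {k : ℕ} (u : Sobolev k) (j : Fin k) :
    deriv (u.rep j) =ᵐ[shellMeasure] (u.1 j.succ) := by
  rw [ae_shellMeasure]
  exact (hasWeakDeriv_of_ac (u.rep_ac j)).unique
    ((u.2 j).congr (u.rep_ae_eq j).symm (Filter.EventuallyEq.refl _ _))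

theorem Sobolev.isH1_rep {k : ℕ} (u : Sobolev k) (j : Fin k) : IsH1 (u.rep j) :=
  ⟨u.rep_ac j, (memLp_congr_ae (u.deriv_rep j)).2 (Lp.memLp _)⟩

theorem IsH1.exists_sobolev {f : ℝ → ℝ} (hf : IsH1 f) :
    ∃ w : Sobolev 1, (w.1 0 : ℝ → ℝ) =ᵐ[shellMeasure] f := by
  have h0 : MemLp f 2 shellMeasure := memLp_of_continuousOn hf.continuousOn
  refine ⟨⟨WithLp.toLp 2 ![h0.toLp f, hf.memLp.toLp (deriv f)], fun j => ?_⟩, ?_⟩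
  · fin_cases j
    refine (hasWeakDeriv_of_ac hf.ac).congr ?_ ?_ <;> rw [← ae_shellMeasure]
    · exact h0.coeFn_toLp.symm
    · exact hf.memLp.coeFn_toLp.symm
  · exact h0.coeFn_toLp

/-! ### Coefficients -/

/-- The harmonic function `H(r) = 2 (1 - 1/r)`. -/
def H (r : ℝ) : ℝ := 2 * (1 - 1 / r)

/-- `∂_r H = 2 / r²`. -/
def dH (r : ℝ) : ℝ := 2 / r ^ 2

theorem hasDerivAt_H {r : ℝ} (hr : r ≠ 0) : HasDerivAt H (dH r) r := by
  have := (((hasDerivAt_inv hr).const_sub 1).const_mul 2)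
  unfold H dH
  convert! this using 1
  · ext x; simp
  · field_simp

/-- `h(ℓ) = a ℓ e^{-b/ℓ}`. -/
def h (a b ℓ : ℝ) : ℝ := a * ℓ * Real.exp (-b / ℓ)

/-- `g(ℓ) = h(ℓ) - ℓ²/4`. -/
def g (a b ℓ : ℝ) : ℝ := h a b ℓ - ℓ ^ 2 / 4

theorem contDiffOn_dH : ContDiffOn ℝ 1 dH (Ioi 0) := by
  unfold dH
  exact contDiffOn_const.div (contDiffOn_id.pow 2) fun x hx => pow_ne_zero 2 (ne_of_gt hx)

theorem contDiffOn_H : ContDiffOn ℝ 1 H (Ioi 0) := by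
  unfold H
  exact contDiffOn_const.mul (contDiffOn_const.sub
    (contDiffOn_const.div contDiffOn_id fun _ hx => ne_of_gt hx))

theorem isH1_const (c : ℝ) : IsH1 fun _ => c := isH1_of_contDiffOn contDiffOn_const

theorem isH1_sq : IsH1 fun s => s ^ 2 := isH1_of_contDiffOn (contDiffOn_id.pow 2)

theorem isH1_inv_sq : IsH1 fun s => 1 / s ^ 2 :=
  isH1_of_contDiffOn (contDiffOn_const.div (contDiffOn_id.pow 2) fun _ hx =>
    pow_ne_zero 2 (ne_of_gt hx))

theorem isH1_exp (lam : ℝ) : IsH1 fun s => Real.exp (-(lam / 2) * H s) :=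
  isH1_of_contDiffOn (contDiffOn_const.mul contDiffOn_H).exp

theorem measurable_h (a b : ℝ) : Measurable (h a b) := by unfold h; fun_prop

theorem abs_h_le {a b ℓ : ℝ} (hb : 0 < b) (hℓ : 0 ≤ ℓ) : |h a b ℓ| ≤ |a| * ℓ := by
  unfold h
  rw [abs_mul, abs_mul, abs_of_nonneg hℓ, Real.abs_exp]
  have : Real.exp (-b / ℓ) ≤ 1 :=
    Real.exp_le_one_iff.2 (div_nonpos_of_nonpos_of_nonneg (by linarith) hℓ)
  exact mul_le_of_le_one_right (by positivity) this

theorem memLp_h_mul {a b : ℝ} (hb : 0 < b) {E f : ℝ → ℝ} (hE : ContinuousOn E (Icc 1 2))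
    (hf : MemLp f 2 shellMeasure) : MemLp (fun r => h a b |E r| * f r) 2 shellMeasure := by
  refine memLp_bdd_mul ?_ ?_ hf
  · have h1 : AEMeasurable (fun r => |E r|) shellMeasure :=
      (aesm_of_continuousOn hE.abs).aemeasurable
    exact ((measurable_h a b).comp_aemeasurable h1).aestronglyMeasurable
  · obtain ⟨C, hC⟩ := isCompact_Icc.exists_bound_of_continuousOn hE
    exact ⟨|a| * C, fun x hx => (abs_h_le hb (abs_nonneg _)).trans
      (mul_le_mul_of_nonneg_left (hC x hx) (abs_nonneg a))⟩

/-! ### The spaces `X` and `Y` and the nonlinear operator -/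

/-- `X`: triples `(ρ_i, R_e, V) ∈ H¹ × H² × H³` with `ρ_i(1) = R_e(1) = V(1) = V(2) = 0`
(with the maximum of the three norms, which is equivalent to the Hilbert norm). -/
def XSubmodule : Submodule ℝ (Sobolev 1 × Sobolev 2 × Sobolev 3) where
  carrier := {u | u.1.rep 0 1 = 0 ∧ u.2.1.rep 0 1 = 0 ∧ u.2.2.rep 0 1 = 0 ∧ u.2.2.rep 0 2 = 0}
  add_mem' {u v} hu hv := by
    have m1 : (1 : ℝ) ∈ Icc (1 : ℝ) 2 := by norm_num
    have m2 : (2 : ℝ) ∈ Icc (1 : ℝ) 2 := by norm_num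
    obtain ⟨u1, u2, u3, u4⟩ := hu
    obtain ⟨v1, v2, v3, v4⟩ := hv
    refine ⟨?_, ?_, ?_, ?_⟩
    · rw [Prod.fst_add, Sobolev.rep_add _ _ _ m1, Pi.add_apply, u1, v1, add_zero]
    · rw [Prod.snd_add, Prod.fst_add, Sobolev.rep_add _ _ _ m1, Pi.add_apply, u2, v2, add_zero]
    · rw [Prod.snd_add, Prod.snd_add, Sobolev.rep_add _ _ _ m1, Pi.add_apply, u3, v3, add_zero]
    · rw [Prod.snd_add, Prod.snd_add, Sobolev.rep_add _ _ _ m2, Pi.add_apply, u4, v4, add_zero]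
  zero_mem' := by
    have m1 : (1 : ℝ) ∈ Icc (1 : ℝ) 2 := by norm_num
    have m2 : (2 : ℝ) ∈ Icc (1 : ℝ) 2 := by norm_num
    exact ⟨Sobolev.rep_zero 0 m1, Sobolev.rep_zero 0 m1, Sobolev.rep_zero 0 m1,
      Sobolev.rep_zero 0 m2⟩
  smul_mem' c u hu := by
    have m1 : (1 : ℝ) ∈ Icc (1 : ℝ) 2 := by norm_num
    have m2 : (2 : ℝ) ∈ Icc (1 : ℝ) 2 := by norm_num
    obtain ⟨u1, u2, u3, u4⟩ := hu
    refine ⟨?_, ?_, ?_, ?_⟩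
    · rw [Prod.smul_fst, Sobolev.rep_smul _ _ _ m1]; simp only [u1, mul_zero]
    · rw [Prod.smul_snd, Prod.smul_fst, Sobolev.rep_smul _ _ _ m1]; simp only [u2, mul_zero]
    · rw [Prod.smul_snd, Prod.smul_snd, Sobolev.rep_smul _ _ _ m1]; simp only [u3, mul_zero]
    · rw [Prod.smul_snd, Prod.smul_snd, Sobolev.rep_smul _ _ _ m2]; simp only [u4, mul_zero]

/-- The space `X` as a normed space. -/
abbrev X : Type := XSubmodule

/-- `Y = L² × L² × H¹ × ℝ`. -/
abbrev Y : Type := L2 × L2 × Sobolev 1 × ℝ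

/-- The radial operator `r ↦ (1/r²) ∂_r (r² f)`. -/
def radialDiv (f : ℝ → ℝ) (r : ℝ) : ℝ := 1 / r ^ 2 * weakDeriv (fun s => s ^ 2 * f s) r

section

variable (a b γ ki ke : ℝ)

/-- First component
`(k_i/r²) ∂_r {r² ρ_i (∂_r V + λ ∂_r H)} - k_e h(|∂_r V + λ ∂_r H|) e^{-λH/2} R_e`,
as a function of `r`. -/
def F₁fun (lam : ℝ) (u : X) (r : ℝ) : ℝ :=
  let ρ := u.1.1.rep 0
  let R := u.1.2.1.rep 0
  let V' := u.1.2.2.rep 1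
  ki * radialDiv (fun s => ρ s * (V' s + lam * dH s)) r
    - ke * h a b (|V' r + lam * dH r|) * Real.exp (-(lam / 2) * H r) * R r

/-- Second component, as a function of `r`. -/
def F₂fun (lam : ℝ) (u : X) (r : ℝ) : ℝ :=
  let R := u.1.2.1.rep 0
  let R' := u.1.2.1.rep 1
  let V' := u.1.2.2.rep 1;
  -radialDiv R' r - V' r * R' r
    + (lam / 2 * V' r * dH r - radialDiv V' r + lam ^ 2 / 4 * (|dH r|) ^ 2
        - h a b (|V' r + lam * dH r|)) * R r

/-- Third component, as a function of `r`. -/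
def F₃fun (lam : ℝ) (u : X) (r : ℝ) : ℝ :=
  let ρ := u.1.1.rep 0
  let R := u.1.2.1.rep 0
  let V' := u.1.2.2.rep 1
  radialDiv V' r - ρ r + Real.exp (-(lam / 2) * H r) * R r

/-- Fourth component: the boundary expression at the cathode `r = 2`. -/
def F₄ (lam : ℝ) (u : X) : ℝ :=
  let ρ := u.1.1.rep 0
  let R := u.1.2.1.rep 0
  let R' := u.1.2.1.rep 1
  let V' := u.1.2.2.rep 1
  R' 2 + (lam / 2 * dH 2 + V' 2) * R 2
    - γ * (ki / ke) * Real.exp (lam / 2 * H 2) * (V' 2 + lam * dH 2) * ρ 2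

end

theorem memLp_radialDiv {f : ℝ → ℝ} (hf : IsH1 f) : MemLp (radialDiv f) 2 shellMeasure :=
  memLp_cont_mul isH1_inv_sq.continuousOn (isH1_sq.mul hf).memLp_weakDeriv

theorem isH1_field (lam : ℝ) (u : X) : IsH1 fun s => u.1.2.2.rep 1 s + lam * dH s :=
  (u.1.2.2.isH1_rep 1).add ((isH1_const lam).mul (isH1_of_contDiffOn contDiffOn_dH))

theorem memLp_F₁fun {a b : ℝ} (ki ke : ℝ) (hb : 0 < b) (lam : ℝ) (u : X) :
    MemLp (F₁fun a b ki ke lam u) 2 shellMeasure := by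
  have h1 := (memLp_radialDiv ((u.1.1.isH1_rep 0).mul (isH1_field lam u))).const_mul ki
  have h2 := (memLp_h_mul (a := a) hb (isH1_field lam u).continuousOn
    (memLp_of_continuousOn ((isH1_exp lam).mul (u.1.2.1.isH1_rep 0)).continuousOn)).const_mul ke
  refine (memLp_congr_ae (Filter.Eventually.of_forall fun r => ?_)).2 (h1.sub h2)
  simp only [F₁fun, Pi.sub_apply]
  ring

theorem memLp_F₂fun {a b : ℝ} (hb : 0 < b) (lam : ℝ) (u : X) :
    MemLp (F₂fun a b lam u) 2 shellMeasure := by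
  have hR := u.1.2.1.isH1_rep 0
  have hR' := u.1.2.1.isH1_rep 1
  have hV' := u.1.2.2.isH1_rep 1
  have hd := isH1_of_contDiffOn contDiffOn_dH
  have h1 := (memLp_radialDiv hR').neg
  have h2 := memLp_of_continuousOn (hV'.mul hR').continuousOn
  have h3 := memLp_of_continuousOn
    ((((isH1_const (lam / 2)).mul hV').mul hd).mul hR).continuousOn
  have h4 := memLp_cont_mul hR.continuousOn (memLp_radialDiv hV')
  have h5 := memLp_of_continuousOn
    (((isH1_const (lam ^ 2 / 4)).mul (hd.mul hd)).mul hR).continuousOn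
  have h6 := memLp_h_mul (a := a) hb (isH1_field lam u).continuousOn
    (memLp_of_continuousOn hR.continuousOn)
  refine (memLp_congr_ae (Filter.Eventually.of_forall fun r => ?_)).2
    ((h1.sub h2).add (((h3.sub h4).add h5).sub h6))
  simp only [F₂fun, Pi.sub_apply, Pi.add_apply, Pi.neg_apply, sq_abs]
  ring

theorem exists_F₃ (lam : ℝ) (u : X) :
    ∃ w : Sobolev 1, (w.1 0 : ℝ → ℝ) =ᵐ[shellMeasure] F₃fun lam u := by
  have hρ := u.1.1.isH1_rep 0
  have hR := u.1.2.1.isH1_rep 0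
  have hV' := u.1.2.2.isH1_rep 1
  have hV'' := u.1.2.2.isH1_rep 2
  have hinv : IsH1 fun s => 2 / s := isH1_of_contDiffOn
    (contDiffOn_const.div contDiffOn_id fun x hx => ne_of_gt hx)
  obtain ⟨w, hw⟩ := (((hV''.add (hinv.mul hV')).add ((isH1_const (-1)).mul hρ)).add
    ((isH1_exp lam).mul hR)).exists_sobolev
  refine ⟨w, hw.trans ?_⟩
  have e : deriv (u.1.2.2.rep 1) =ᵐ[shellMeasure] u.1.2.2.rep 2 := by
    refine (u.1.2.2.deriv_rep 1).trans ?_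
    rw [ae_shellMeasure]
    exact (u.1.2.2.rep_ae_eq 2).symm
  filter_upwards [(isH1_sq.mul hV').weakDeriv_ae, e, ae_differentiableAt_of_ac hV'.ac,
    ae_mem_shell] with r h1 h2 h3 h4
  have hr : r ≠ 0 := by have := h4.1; positivity
  have h5 : deriv (fun s => s ^ 2 * u.1.2.2.rep 1 s) r
      = 2 * r * u.1.2.2.rep 1 r + r ^ 2 * u.1.2.2.rep 2 r := by
    rw [deriv_fun_mul (by fun_prop) h3, h2]; simp
  simp only [F₃fun, radialDiv]
  rw [h1, h5]
  field_simp
  ring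

/-- The nonlinear operator `F(λ, ρ_i, R_e, V) ∈ Y`. The third component is the element of `H¹(I)`
that is almost everywhere equal to `F₃fun`; it is unique, since weak derivatives are. -/
def F (a : ℝ) {b : ℝ} (hb : 0 < b) (γ ki ke lam : ℝ) (u : X) : Y :=
  ((memLp_F₁fun (a := a) ki ke hb lam u).toLp, (memLp_F₂fun (a := a) hb lam u).toLp,
    (exists_F₃ lam u).choose, F₄ γ ki ke lam u)

/-- `∂_u F(λ, 0) : X → Y`, the Fréchet derivative at the trivial solution. -/
def linearization (a : ℝ) {b : ℝ} (hb : 0 < b) (γ ki ke lam : ℝ) : X →L[ℝ] Y :=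
  fderiv ℝ (F a hb γ ki ke lam) 0

/-- `∂_λ ∂_u F(λ, 0) : X → Y`. -/
def mixedDerivative (a : ℝ) {b : ℝ} (hb : 0 < b) (γ ki ke lam : ℝ) : X →L[ℝ] Y :=
  deriv (fun l => linearization a hb γ ki ke l) lam

/-- The abstract transversality condition `∂_λ ∂_u F(λ, 0)[1, u] ∉ R(∂_u F(λ, 0))`. -/
def Transversal (a : ℝ) {b : ℝ} (hb : 0 < b) (γ ki ke lam : ℝ) (u : X) : Prop :=
  mixedDerivative a hb γ ki ke lam u ∉ Set.range (linearization a hb γ ki ke lam)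

/-! ### The electron system, the sparking voltage and the adjoint problem -/

/-- `B(λ, φ)`, the nonlocal boundary expression. -/
def boundaryB (a b γ lam : ℝ) (φ : Sobolev 2) : ℝ :=
  φ.rep 1 2 + lam / 4 * φ.rep 0 2
    - a * γ * (lam / 2) * Real.exp (-(lam / 2)) *
      ∫ r in (1 : ℝ)..2, Real.exp (-(b * r ^ 2) / (2 * lam)) * Real.exp (lam / r) * φ.rep 0 r

/-- `(λ, φ)` solves the electron system. -/
def SolvesElectronSystem (a b γ lam : ℝ) (φ : Sobolev 2) : Prop :=
  (∀ᵐ r ∂volume.restrict (Ioo (1 : ℝ) 2),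
    -radialDiv (φ.rep 1) r - g a b (lam * dH r) * φ.rep 0 r = 0) ∧
  φ.rep 0 1 = 0 ∧ (∀ r ∈ Ioo (1 : ℝ) 2, 0 < φ.rep 0 r) ∧ boundaryB a b γ lam φ = 0

/-- The sparking parameter set. -/
def sparkingSet : Set (ℝ × ℝ × ℝ) :=
  {p | ∃ lam > 0, ∃ φ : Sobolev 2, SolvesElectronSystem p.1 p.2.1 p.2.2 lam φ}

/-- The sparking voltage `λ†`. -/
def sparkingVoltage (a b γ : ℝ) : ℝ :=
  sInf {lam | 0 < lam ∧ ∃ φ : Sobolev 2, SolvesElectronSystem a b γ lam φ}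

/-- `ψ` solves the adjoint boundary value problem. -/
def SolvesAdjoint (a b γ lam : ℝ) (ψ : Sobolev 2) : Prop :=
  (∀ᵐ r ∂volume.restrict (Ioo (1 : ℝ) 2),
    -radialDiv (ψ.rep 1) r - g a b (lam * dH r) * ψ.rep 0 r
      - h a b (lam * dH r) * Real.exp (-(lam / 2) * H r) * γ * Real.exp (lam / 2) * ψ.rep 0 2
      = 0) ∧
  ψ.rep 0 1 = 0 ∧ ψ.rep 1 2 + lam / 4 * ψ.rep 0 2 = 0

/-- The explicit transversality functional `F(a,b,γ)`, evaluated at `λ`, `φ_e`, `ψ_e`. -/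
def explicitF (a b γ lam : ℝ) (φ ψ : Sobolev 2) : ℝ :=
  -γ * Real.exp (lam / 2) *
      (∫ r in (1 : ℝ)..2, r ^ 2 * ψ.rep 0 2 *
        (deriv (h a b) (lam * dH r) * dH r - h a b (lam * dH r) * (H r / 2)) *
        Real.exp (-(lam / 2) * H r) * φ.rep 0 r)
    - (∫ r in (1 : ℝ)..2, r ^ 2 * ψ.rep 0 r * deriv (g a b) (lam * dH r) * dH r * φ.rep 0 r)
    + ψ.rep 0 2 * (φ.rep 0 2 - 2 * φ.rep 1 2 - lam / 2 * φ.rep 0 2)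

end

end GasDischarge

open MeasureTheory Set
open scoped ContDiff

namespace GasDischarge

noncomputable section

/-! The linearization at the trivial solution is triangular. Its second component involves the
electron density `R` alone. Since `r² H' = 2` is constant, the first component is a first-order
equation for `ρ`, with a right-hand side depending on `R`. Given `ρ` and `R`, the third component is
a Dirichlet problem for `V`. These equations are solvable for every right-hand side
(`exists_linX_first_third`), so kernel and range are decided by the electron equation and one scalar
condition at `r = 2`. Integrating the first component against `r²` eliminates `ρ(2)` and turns that
condition into the nonlocal boundary condition of the electron system (`linX_fth_eq`).

Green's formula with an adjoint solution `ψ` yields a functional `solvability` that vanishes on the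
range. Because `ψ(2) ≠ 0`, its kernel is exactly the range (`mem_range_linX_iff`). Transversality
therefore means that this functional does not vanish on the mixed derivative. With the functional
frozen at `λ†`, its value there is the derivative of a scalar function of `λ`, and the fourth kernel
equation brings it to the form `explicitF` (`solvability_mixedDerivative`). Electron components of
kernel elements are nonzero multiples of any solution of the electron system, and `explicitF` is
linear in that argument, so either may be used.

For differentiability, all coefficients are curves in the Banach algebra of continuous functions on
`[1,2]`, which acts boundedly on `L²`. Norm-differentiability of these curves gives
differentiability in operator norm. The nonlinear remainder is a sum of terms `B (f u) (A u)` with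
`f` continuous and `f 0 = 0`, hence is `o(u)` (`hasFDerivAt_bilin_zero`).

That the infimum `λ†` is positive and attained follows by shooting. The solution with `φ(1) = 0`,
`φ'(1) = 1` depends continuously on `λ ≥ 0`, because `1 + volterra q` is invertible for every `q`.
Solvability at `λ > 0` amounts to the closed conditions `shootB = 0` and `shoot ≥ 0`, and `λ = 0` is
excluded by `shootB_zero`. The adjoint solution comes from a `2 × 2` system whose determinant
vanishes by Green's formula (`exists_adjoint`). -/

/-! ### Continuous functions on `[1,2]` acting on `L²` -/

/-- The Banach algebra of continuous functions on `[1,2]`. -/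
abbrev CI : Type := C(Icc (1 : ℝ) 2, ℝ)

/-- The extension of a function on `[1,2]` to the line, constant outside of the interval. -/
def CI.ext (c : CI) : ℝ → ℝ := IccExtend (one_le_two : (1 : ℝ) ≤ 2) c

theorem CI.ext_of_mem (c : CI) {x : ℝ} (hx : x ∈ Icc (1 : ℝ) 2) : c.ext x = c ⟨x, hx⟩ :=
  IccExtend_of_mem _ _ hx

theorem CI.ext_coe (c : CI) (x : Icc (1 : ℝ) 2) : c.ext x = c x := IccExtend_val _ _ x

theorem CI.continuous_ext (c : CI) : Continuous c.ext := c.continuous.Icc_extend'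

theorem CI.ext_add (c d : CI) (x : ℝ) : (c + d).ext x = c.ext x + d.ext x := rfl

theorem CI.ext_sub (c d : CI) (x : ℝ) : (c - d).ext x = c.ext x - d.ext x := rfl

theorem CI.ext_neg (c : CI) (x : ℝ) : (-c).ext x = -c.ext x := rfl

theorem CI.ext_mul (c d : CI) (x : ℝ) : (c * d).ext x = c.ext x * d.ext x := rfl

theorem CI.ext_smul (a : ℝ) (c : CI) (x : ℝ) : (a • c).ext x = a * c.ext x := rfl

theorem CI.ext_one (x : ℝ) : (1 : CI).ext x = 1 := rfl

theorem CI.ext_zero (x : ℝ) : (0 : CI).ext x = 0 := rfl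

theorem CI.abs_ext_le (c : CI) (x : ℝ) : |c.ext x| ≤ ‖c‖ := c.norm_coe_le_norm _

/-- The restriction to `[1,2]` of a function that is continuous there. -/
def toCI (f : ℝ → ℝ) (hf : ContinuousOn f (Icc 1 2)) : CI := ⟨(Icc 1 2).domRestrict f, hf.domRestrict⟩

theorem toCI_apply {f : ℝ → ℝ} (hf : ContinuousOn f (Icc 1 2)) (x : Icc (1 : ℝ) 2) :
    toCI f hf x = f x := rfl

theorem ext_toCI {f : ℝ → ℝ} (hf : ContinuousOn f (Icc 1 2)) {x : ℝ} (hx : x ∈ Icc (1 : ℝ) 2) :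
    (toCI f hf).ext x = f x := by
  rw [CI.ext_of_mem _ hx]; rfl

theorem CI.memLp_mul (c : CI) (v : L2) : MemLp (fun x => c.ext x * v x) 2 shellMeasure :=
  memLp_cont_mul c.continuous_ext.continuousOn (Lp.memLp v)

/-- Multiplication of an `L²` function by a continuous function, as a bounded bilinear map. -/
def mulL : CI →L[ℝ] L2 →L[ℝ] L2 :=
  LinearMap.mkContinuous₂
    (LinearMap.mk₂ ℝ (fun c v => (c.memLp_mul v).toLp)
      (fun c d v => by
        apply Lp.ext
        filter_upwards [(CI.memLp_mul (c + d) v).coeFn_toLp, (CI.memLp_mul c v).coeFn_toLp,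
          (CI.memLp_mul d v).coeFn_toLp, Lp.coeFn_add (CI.memLp_mul c v).toLp
            (CI.memLp_mul d v).toLp] with x h1 h2 h3 h4
        rw [h1, h4, Pi.add_apply, h2, h3, CI.ext_add, add_mul])
      (fun a c v => by
        apply Lp.ext
        filter_upwards [(CI.memLp_mul (a • c) v).coeFn_toLp, (CI.memLp_mul c v).coeFn_toLp,
          Lp.coeFn_smul a (CI.memLp_mul c v).toLp] with x h1 h2 h4
        rw [h1, h4, Pi.smul_apply, h2, CI.ext_smul, smul_eq_mul, mul_assoc])
      (fun c v w => by
        apply Lp.ext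
        filter_upwards [(CI.memLp_mul c (v + w)).coeFn_toLp, (CI.memLp_mul c v).coeFn_toLp,
          (CI.memLp_mul c w).coeFn_toLp, Lp.coeFn_add (CI.memLp_mul c v).toLp
            (CI.memLp_mul c w).toLp, Lp.coeFn_add v w] with x h1 h2 h3 h4 h5
        rw [h1, h4, Pi.add_apply, h2, h3, h5, Pi.add_apply, mul_add])
      (fun a c v => by
        apply Lp.ext
        filter_upwards [(CI.memLp_mul c (a • v)).coeFn_toLp, (CI.memLp_mul c v).coeFn_toLp,
          Lp.coeFn_smul a (CI.memLp_mul c v).toLp, Lp.coeFn_smul a v] with x h1 h2 h4 h5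
        rw [h1, h4, Pi.smul_apply, h2, h5, Pi.smul_apply, smul_eq_mul, smul_eq_mul]
        ring)) 1
    (fun c v => by
      rw [LinearMap.mk₂_apply, one_mul]
      refine Lp.norm_le_mul_norm_of_ae_le_mul ?_
      filter_upwards [(CI.memLp_mul c v).coeFn_toLp] with x h1
      rw [h1, norm_mul]
      exact mul_le_mul_of_nonneg_right (c.abs_ext_le x) (norm_nonneg _))

theorem coeFn_mulL (c : CI) (v : L2) : mulL c v =ᵐ[shellMeasure] fun x => c.ext x * v x :=
  (c.memLp_mul v).coeFn_toLp

theorem memLp_one : MemLp (fun _ : ℝ => (1 : ℝ)) 2 shellMeasure :=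
  memLp_of_continuousOn continuousOn_const

/-- The inclusion of the continuous functions in `L²`. -/
def incl : CI →L[ℝ] L2 := mulL.flip memLp_one.toLp

theorem coeFn_incl (c : CI) : incl c =ᵐ[shellMeasure] c.ext := by
  filter_upwards [coeFn_mulL c memLp_one.toLp, memLp_one.coeFn_toLp] with x h1 h2
  change mulL c memLp_one.toLp x = _
  rw [h1, h2, mul_one]

/-! ### Integrals and primitives of functions in `L²` -/

theorem L2.integrableOn (v : L2) : IntegrableOn v (Ioo 1 2) := integrableOn_of_memLp (Lp.memLp v)

theorem L2.intervalIntegrable (v : L2) {x y : ℝ} (hx : x ∈ Icc (1 : ℝ) 2)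
    (hy : y ∈ Icc (1 : ℝ) 2) : IntervalIntegrable v volume x y := by
  have h : IntervalIntegrable v volume 1 2 :=
    (intervalIntegrable_iff_integrableOn_Ioo_of_le (by norm_num)).2 v.integrableOn
  refine h.mono_set ?_
  rw [uIcc_of_le (by norm_num : (1 : ℝ) ≤ 2)]
  exact ordConnected_Icc.uIcc_subset hx hy

theorem mem_one : (1 : ℝ) ∈ Icc (1 : ℝ) 2 := by norm_num

theorem mem_two : (2 : ℝ) ∈ Icc (1 : ℝ) 2 := by norm_num

theorem intervalIntegral_congr_shell {f g : ℝ → ℝ} (h : f =ᵐ[shellMeasure] g) {x : ℝ}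
    (hx : x ∈ Icc (1 : ℝ) 2) : ∫ t in (1 : ℝ)..x, f t = ∫ t in (1 : ℝ)..x, g t := by
  rw [intervalIntegral.integral_of_le hx.1, intervalIntegral.integral_of_le hx.1,
    integral_Ioc_eq_integral_Ioo, integral_Ioc_eq_integral_Ioo]
  rw [ae_shellMeasure] at h
  exact integral_congr_ae (ae_restrict_of_ae_restrict_of_subset
    (Ioo_subset_Ioo_right hx.2) h)

/-- The constant is 1 because the interval has length one and the weight `r²` is at least 1 on it.
-/
theorem L2.integral_norm_le (v : L2) : ∫ x in Ioo (1 : ℝ) 2, ‖v x‖ ≤ ‖v‖ := by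
  have : IsProbabilityMeasure (volume.restrict (Ioo (1 : ℝ) 2)) := ⟨by simp; norm_num⟩
  have hm : MemLp v 2 (volume.restrict (Ioo 1 2)) := memLp_shell_iff.1 (Lp.memLp v)
  rw [integral_norm_eq_lintegral_enorm hm.1, ← eLpNorm_one_eq_lintegral_enorm, Lp.norm_def]
  refine ENNReal.toReal_mono (Lp.eLpNorm_ne_top v) ?_
  exact (eLpNorm_le_eLpNorm_of_exponent_le (by norm_num) hm.1).trans
    (eLpNorm_mono_measure _ restrict_le_shellMeasure)

theorem L2.abs_integral_le (v : L2) {x y : ℝ} (hx : x ∈ Icc (1 : ℝ) 2) (hy : y ∈ Icc (1 : ℝ) 2) :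
    |∫ t in x..y, v t| ≤ ‖v‖ := by
  refine le_trans ?_ v.integral_norm_le
  refine (intervalIntegral.norm_integral_le_integral_norm_uIoc (f := v)).trans ?_
  rw [← integral_Ioc_eq_integral_Ioo]
  refine setIntegral_mono_set ?_ (Filter.Eventually.of_forall fun _ => norm_nonneg _) ?_
  · rw [integrableOn_Ioc_iff_integrableOn_Ioo]; exact v.integrableOn.norm
  · refine (Ioc_subset_Ioc (le_min hx.1 hy.1) (max_le hx.2 hy.2)).eventuallyLE

theorem L2.primitive_ac (v : L2) :
    AbsolutelyContinuousOnInterval (fun x => ∫ t in (1 : ℝ)..x, v t) 1 2 :=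
  (v.intervalIntegrable mem_one mem_two).absolutelyContinuousOnInterval_intervalIntegral (by simp)

theorem L2.deriv_primitive (v : L2) :
    deriv (fun x => ∫ t in (1 : ℝ)..x, v t) =ᵐ[shellMeasure] v := by
  rw [ae_shellMeasure, Filter.EventuallyEq, ae_restrict_iff' measurableSet_Ioo]
  filter_upwards [(v.intervalIntegrable mem_one mem_two).ae_hasDerivAt_integral] with x hx hxI
  have hx' : x ∈ uIcc (1 : ℝ) 2 := by
    rw [uIcc_of_le (by norm_num)]; exact Ioo_subset_Icc_self hxI
  exact (hx hx' 1 (by simp)).deriv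

theorem L2.isH1_primitive (v : L2) : IsH1 (fun x => ∫ t in (1 : ℝ)..x, v t) :=
  ⟨v.primitive_ac, (memLp_congr_ae v.deriv_primitive).2 (Lp.memLp v)⟩

/-- The primitive `∫₁ˣ v` of an `L²` function. -/
def prim : L2 →L[ℝ] CI :=
  LinearMap.mkContinuous
    { toFun := fun v => toCI (fun x => ∫ t in (1 : ℝ)..x, v t) v.isH1_primitive.continuousOn
      map_add' := fun v w => by
        ext x
        simp only [ContinuousMap.add_apply, toCI_apply]
        rw [intervalIntegral_congr_shell (Lp.coeFn_add v w) x.2]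
        exact intervalIntegral.integral_add (v.intervalIntegrable mem_one x.2)
          (w.intervalIntegrable mem_one x.2)
      map_smul' := fun a v => by
        ext x
        simp only [ContinuousMap.smul_apply, toCI_apply, RingHom.id_apply]
        rw [intervalIntegral_congr_shell (Lp.coeFn_smul a v) x.2]
        exact intervalIntegral.integral_smul a v } 1
    fun v => by
      rw [one_mul]
      exact (ContinuousMap.norm_le _ (norm_nonneg _)).2 fun x => v.abs_integral_le mem_one x.2

theorem prim_apply (v : L2) (x : Icc (1 : ℝ) 2) : prim v x = ∫ t in (1 : ℝ)..x, v t := rfl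

theorem ext_prim (v : L2) {x : ℝ} (hx : x ∈ Icc (1 : ℝ) 2) :
    (prim v).ext x = ∫ t in (1 : ℝ)..x, v t := by
  rw [CI.ext_of_mem _ hx]; rfl

theorem prim_incl_apply (c : CI) (x : Icc (1 : ℝ) 2) :
    prim (incl c) x = ∫ t in (1 : ℝ)..x, c.ext t := by
  rw [prim_apply, intervalIntegral_congr_shell (coeFn_incl c) x.2]

theorem ext_prim_incl (c : CI) {x : ℝ} (hx : x ∈ Icc (1 : ℝ) 2) :
    (prim (incl c)).ext x = ∫ t in (1 : ℝ)..x, c.ext t := by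
  rw [CI.ext_of_mem _ hx, prim_incl_apply]

theorem ext_prim_one (v : L2) : (prim v).ext 1 = 0 := by
  rw [ext_prim v mem_one]; simp

theorem hasDerivAt_primitive_ext (c : CI) (x : ℝ) :
    HasDerivAt (fun x => ∫ t in (1 : ℝ)..x, c.ext t) (c.ext x) x :=
  intervalIntegral.integral_hasDerivAt_right (c.continuous_ext.intervalIntegrable _ _)
    (c.continuous_ext.stronglyMeasurableAtFilter _ _) c.continuous_ext.continuousAt

/-- The value at a point of `[1,2]`. -/
def evalAt (x : ℝ) : CI →L[ℝ] ℝ := ContinuousMap.evalCLM ℝ (projIcc 1 2 one_le_two x)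

theorem evalAt_apply (x : ℝ) (c : CI) : evalAt x c = c.ext x := rfl

/-! ### Sobolev functions -/

/-- The `j`-th derivative of `u ∈ H^k(I)` in `L²`. -/
def comp {k : ℕ} (j : Fin (k + 1)) : Sobolev k →L[ℝ] L2 :=
  (PiLp.proj 2 (fun _ : Fin (k + 1) => L2) j).comp (sobolevSubmodule k).subtypeL

theorem Sobolev.rep_eq {k : ℕ} (u : Sobolev k) (j : Fin k) {x : ℝ} (hx : x ∈ Icc (1 : ℝ) 2) :
    u.rep j x = u.rep j 1 + ∫ t in (1 : ℝ)..x, u.1 j.succ t := by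
  rw [← intervalIntegral_congr_shell (u.deriv_rep j) hx,
    AbsolutelyContinuousOnInterval.integral_deriv_eq_sub]
  · ring
  · refine (u.rep_ac j).mono ?_
    rw [uIcc_of_le hx.1, uIcc_of_le (by norm_num)]
    exact Icc_subset_Icc_right hx.2

theorem Sobolev.rep_sub_eq {k : ℕ} (u : Sobolev k) (j : Fin k) {x y : ℝ}
    (hx : x ∈ Icc (1 : ℝ) 2) (hy : y ∈ Icc (1 : ℝ) 2) :
    u.rep j y - u.rep j x = ∫ t in x..y, u.1 j.succ t := by
  rw [u.rep_eq j hx, u.rep_eq j hy, ← intervalIntegral.integral_add_adjacent_intervals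
    ((u.1 j.succ).intervalIntegrable mem_one hx) ((u.1 j.succ).intervalIntegrable hx hy)]
  ring

theorem Sobolev.rep_ae {k : ℕ} (u : Sobolev k) (j : Fin k) :
    u.rep j =ᵐ[shellMeasure] u.1 j.castSucc := by
  rw [ae_shellMeasure]; exact u.rep_ae_eq j

/-- One-dimensional Sobolev embedding: the values at `x` and `y` differ by an integral of the
derivative, and averaging over `y` in an interval of length one leaves an `L¹` norm. One `‖u‖`
bounds the average and the other bounds the derivative. -/
theorem Sobolev.abs_rep_le {k : ℕ} (u : Sobolev k) (j : Fin k) {x : ℝ} (hx : x ∈ Icc (1 : ℝ) 2) :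
    |u.rep j x| ≤ 2 * ‖u‖ := by
  have : IsProbabilityMeasure (volume.restrict (Ioo (1 : ℝ) 2)) := ⟨by simp; norm_num⟩
  have h1 : ∀ y ∈ Icc (1 : ℝ) 2, |u.rep j x| ≤ ‖u.rep j y‖ + ‖u‖ := fun y hy => by
    have h2 := ((u.1 j.succ).abs_integral_le hy hx).trans (PiLp.norm_apply_le u.1 j.succ)
    rw [← u.rep_sub_eq j hy hx] at h2
    have h3 := abs_sub_abs_le_abs_sub (u.rep j x) (u.rep j y)
    rw [Real.norm_eq_abs]
    change |u.rep j x| ≤ |u.rep j y| + ‖u.1‖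
    linarith
  have hi : IntegrableOn (fun y => ‖u.rep j y‖) (Ioo 1 2) :=
    ((u.isH1_rep j).continuousOn.integrableOn_Icc.mono_set Ioo_subset_Icc_self).norm
  have h4 : ∫ y in Ioo (1 : ℝ) 2, ‖u.rep j y‖ ≤ ‖u‖ := by
    have : ∫ y in Ioo (1 : ℝ) 2, ‖u.rep j y‖ = ∫ y in Ioo (1 : ℝ) 2, ‖u.1 j.castSucc y‖ :=
      integral_congr_ae ((u.rep_ae_eq j).mono fun y hy => by simp only [hy])
    rw [this]
    exact (L2.integral_norm_le _).trans (PiLp.norm_apply_le u.1 _)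
  have h5 : ∫ _ in Ioo (1 : ℝ) 2, |u.rep j x| ≤ ∫ y in Ioo (1 : ℝ) 2, (‖u.rep j y‖ + ‖u‖) :=
    setIntegral_mono_on (integrable_const _) (hi.add (integrable_const _)) measurableSet_Ioo
      fun y hy => h1 y (Ioo_subset_Icc_self hy)
  rw [integral_add hi (integrable_const _)] at h5
  simp only [integral_const, probReal_univ, smul_eq_mul, one_mul] at h5
  linarith

/-- The continuous representative of the `j`-th derivative, as a bounded operator. -/
def trace {k : ℕ} (j : Fin k) : Sobolev k →L[ℝ] CI :=
  LinearMap.mkContinuous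
    { toFun := fun u => toCI (u.rep j) (u.isH1_rep j).continuousOn
      map_add' := fun u v => by ext x; exact Sobolev.rep_add u v j x.2
      map_smul' := fun a u => by ext x; exact Sobolev.rep_smul a u j x.2 } 2
    fun u => (ContinuousMap.norm_le _ (by positivity)).2 fun x => u.abs_rep_le j x.2

theorem trace_apply {k : ℕ} (j : Fin k) (u : Sobolev k) (x : Icc (1 : ℝ) 2) :
    trace j u x = u.rep j x := rfl

theorem ext_trace {k : ℕ} (j : Fin k) (u : Sobolev k) {x : ℝ} (hx : x ∈ Icc (1 : ℝ) 2) :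
    (trace j u).ext x = u.rep j x :=
  ext_toCI (u.isH1_rep j).continuousOn hx

/-- Together with `incl_injective`, this moves identities between `L²` and the continuous functions.
-/
theorem incl_trace {k : ℕ} (j : Fin k) (u : Sobolev k) : incl (trace j u) = u.1 j.castSucc := by
  apply Lp.ext
  filter_upwards [coeFn_incl (trace j u), u.rep_ae j, ae_mem_shell] with x h1 h2 h3
  rw [h1, ext_trace j u (Ioo_subset_Icc_self h3), h2]

theorem trace_eq {k : ℕ} (j : Fin k) (u : Sobolev k) :
    trace j u = u.rep j 1 • 1 + prim (u.1 j.succ) := by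
  ext x
  simpa [trace_apply, prim_apply] using u.rep_eq j x.2

theorem CI.ae_eq_zero_iff {c : CI} : incl c = 0 ↔ c = 0 := by
  refine ⟨fun h => ?_, fun h => by rw [h, map_zero]⟩
  have h1 : c.ext =ᵐ[volume.restrict (Ioo 1 2)] fun _ => 0 := by
    have := coeFn_incl c
    rw [h] at this
    rw [← ae_shellMeasure]
    exact this.symm.trans (Lp.coeFn_zero _ _ _)
  ext x
  rw [restrict_Ioo_eq_restrict_Icc] at h1
  have := Measure.eqOn_Icc_of_ae_eq volume (by norm_num) h1 c.continuous_ext.continuousOn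
    continuousOn_const x.2
  rwa [CI.ext_coe] at this

theorem incl_injective : Function.Injective incl :=
  (injective_iff_map_eq_zero incl).2 fun _ => CI.ae_eq_zero_iff.1

/-- Uniqueness of weak derivatives carries equality from each component to the next. -/
theorem Sobolev.ext_of_ae {k : ℕ} {u v : Sobolev k} (h : (u.1 0 : L2) = v.1 0) : u = v := by
  apply Subtype.ext
  ext1 j
  induction j using Fin.induction with
  | zero => exact h
  | succ j ih =>
    apply Lp.ext
    rw [ae_shellMeasure]
    exact (u.2 j).unique ((v.2 j).congr (by rw [ih]) (Filter.EventuallyEq.refl _ _))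

theorem Sobolev.ext_trace {k : ℕ} {u v : Sobolev (k + 1)} (h : trace 0 u = trace 0 v) : u = v :=
  Sobolev.ext_of_ae (by simpa [incl_trace] using congrArg incl h)

theorem hasWeakDeriv_primitive (c : ℝ) (v : L2) :
    HasWeakDeriv (incl (c • 1 + prim v)) v := by
  have h1 := (isH1_const c).add v.isH1_primitive
  refine (hasWeakDeriv_of_ac h1.ac).congr ?_ ?_ <;> rw [← ae_shellMeasure]
  · filter_upwards [coeFn_incl (c • 1 + prim v), ae_mem_shell] with x h2 h3
    rw [h2, CI.ext_add, CI.ext_smul, CI.ext_one, ext_prim v (Ioo_subset_Icc_self h3), mul_one]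
  · filter_upwards [v.deriv_primitive] with x h2
    rw [← h2]
    exact deriv_const_add c

/-- The isomorphism of `ℝ × L²` with `H¹(I)` that sends `(c, v)` to `c + ∫₁ˣ v`. -/
def ofDeriv : ℝ × L2 →L[ℝ] Sobolev 1 :=
  ContinuousLinearMap.codRestrict
    ((PiLp.continuousLinearEquiv 2 ℝ (fun _ : Fin 2 => L2)).symm.toContinuousLinearMap.comp
      (ContinuousLinearMap.pi (Fin.cons
        (incl.comp ((ContinuousLinearMap.fst ℝ ℝ L2).smulRight 1 +
          prim.comp (ContinuousLinearMap.snd ℝ ℝ L2)))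
        fun _ => ContinuousLinearMap.snd ℝ ℝ L2)))
    _ fun p j => by
      fin_cases j
      exact hasWeakDeriv_primitive p.1 p.2

theorem ofDeriv_zero (p : ℝ × L2) : (ofDeriv p).1 0 = incl (p.1 • 1 + prim p.2) := rfl

theorem trace_ofDeriv (p : ℝ × L2) : trace 0 (ofDeriv p) = p.1 • 1 + prim p.2 :=
  incl_injective (by rw [incl_trace]; rfl)

theorem Sobolev.eq_ofDeriv (u : Sobolev 1) : u = ofDeriv (u.rep 0 1, u.1 1) :=
  Sobolev.ext_trace (by rw [trace_ofDeriv, trace_eq]; rfl)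

/-- A primitive in `H^{k+1}(I)` of a function in `H^k(I)`. -/
theorem Sobolev.exists_primitive {k : ℕ} (c : ℝ) (w : Sobolev k) :
    ∃ u : Sobolev (k + 1), trace 0 u = c • 1 + prim (w.1 0) ∧ ∀ j, u.1 (Fin.succ j) = w.1 j := by
  refine ⟨⟨WithLp.toLp 2 (Fin.cons (incl (c • 1 + prim (w.1 0))) fun j => w.1 j), fun j => ?_⟩,
    incl_injective ?_, fun j => rfl⟩
  · refine Fin.cases ?_ (fun i => ?_) j
    · exact hasWeakDeriv_primitive c (w.1 0)
    · exact w.2 i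
  · rw [incl_trace]; rfl

theorem trace_succ_eq {k : ℕ} {u : Sobolev (k + 1)} {w : Sobolev k}
    (h : ∀ j, u.1 (Fin.succ j) = w.1 j) (j : Fin k) : trace j.succ u = trace j w :=
  incl_injective (by rw [incl_trace, incl_trace, ← h]; rfl)

/-! ### The radial Volterra equation -/

theorem continuousOn_div_pow (c : ℝ) (n : ℕ) : ContinuousOn (fun s : ℝ => c / s ^ n) (Icc 1 2) :=
  continuousOn_const.div (continuousOn_id.pow n) fun x hx =>
    pow_ne_zero n (by have := hx.1; simp; linarith)

/-- The function `2 / r`. -/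
def twoDiv : CI := toCI (fun s => 2 / s ^ 1) (continuousOn_div_pow 2 1)

theorem ext_twoDiv {x : ℝ} (hx : x ∈ Icc (1 : ℝ) 2) : twoDiv.ext x = 2 / x := by
  rw [twoDiv, ext_toCI _ hx, pow_one]

/-- The function `r⁻²`. -/
def invSq : CI := toCI (fun s => 1 / s ^ 2) (continuousOn_div_pow 1 2)

theorem ext_invSq {x : ℝ} (hx : x ∈ Icc (1 : ℝ) 2) : invSq.ext x = 1 / x ^ 2 := ext_toCI _ hx

/-- The function `r²`. -/
def sqCI : CI := toCI (fun s => s ^ 2) (by fun_prop)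

theorem ext_sqCI {x : ℝ} (hx : x ∈ Icc (1 : ℝ) 2) : sqCI.ext x = x ^ 2 :=
  ext_toCI (by fun_prop) hx

/-- The primitive `∫₁ˣ c` of a continuous function. -/
def primC : CI →L[ℝ] CI := prim.comp incl

theorem primC_apply (c : CI) : primC c = prim (incl c) := rfl

theorem ext_primC (c : CI) {x : ℝ} (hx : x ∈ Icc (1 : ℝ) 2) :
    (primC c).ext x = ∫ t in (1 : ℝ)..x, c.ext t := ext_prim_incl c hx

/-- The Volterra operator `y ↦ ∫₁ (2 y / r + q ∫₁ y)`. A solution of `φ'' + 2 φ' / r + q φ = 0` with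
`φ(1) = 0` is given by `y = φ'` with `y + volterra q y` constant. -/
def volterra (q : CI) : CI →L[ℝ] CI :=
  primC.comp (ContinuousLinearMap.mul ℝ CI twoDiv + (ContinuousLinearMap.mul ℝ CI q).comp primC)

theorem volterra_apply (q y : CI) : volterra q y = primC (twoDiv * y + q * primC y) := rfl

theorem continuous_volterra : Continuous volterra := by
  unfold volterra
  fun_prop

/-- Each integration from 1 raises the power of `x - 1` and supplies the next factor of the
factorial. This is the gain in the Volterra iteration. -/
theorem abs_primC_le {y : CI} {M : ℝ} {n : ℕ}
    (hy : ∀ t ∈ Icc (1 : ℝ) 2, |y.ext t| ≤ M * ((t - 1) ^ n / n.factorial)) {x : ℝ}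
    (hx : x ∈ Icc (1 : ℝ) 2) :
    |(primC y).ext x| ≤ M * ((x - 1) ^ (n + 1) / (n + 1).factorial) := by
  rw [ext_primC y hx]
  have hi : ∫ t in (1 : ℝ)..x, M * ((t - 1) ^ n / n.factorial)
      = M * ((x - 1) ^ (n + 1) / (n + 1).factorial) := by
    rw [intervalIntegral.integral_const_mul, intervalIntegral.integral_div,
      intervalIntegral.integral_comp_sub_right (fun t => t ^ n), integral_pow, Nat.factorial_succ]
    push_cast
    have : (n.factorial : ℝ) ≠ 0 := by positivity
    field_simp
    simp
  rw [← hi]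
  refine intervalIntegral.norm_integral_le_of_norm_le (f := y.ext) hx.1
    (Filter.Eventually.of_forall fun t ht => hy t ⟨ht.1.le, ht.2.trans hx.2⟩) ?_
  exact Continuous.intervalIntegrable (by fun_prop) _ _

/-- The term with `q` is integrated twice, but on an interval of length one the bound of order `n +
1` is below the one of order `n`. Both terms thus obey the same estimate, with constants 2 (from `2
/ r`) and `‖q‖`. -/
theorem abs_volterra_le (q : CI) {y : CI} {M : ℝ} {n : ℕ} (hM : 0 ≤ M)
    (hy : ∀ t ∈ Icc (1 : ℝ) 2, |y.ext t| ≤ M * ((t - 1) ^ n / n.factorial)) {x : ℝ}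
    (hx : x ∈ Icc (1 : ℝ) 2) :
    |(volterra q y).ext x| ≤ (2 + ‖q‖) * M * ((x - 1) ^ (n + 1) / (n + 1).factorial) := by
  rw [volterra_apply]
  refine abs_primC_le (fun t ht => ?_) hx
  have h1 := abs_primC_le hy ht
  have h0 : 0 ≤ t - 1 := by linarith [ht.1]
  have h2 : (t - 1) ^ (n + 1) / (n + 1).factorial ≤ (t - 1) ^ n / n.factorial := by
    gcongr ?_ / ?_
    · exact pow_le_pow_of_le_one h0 (by linarith [ht.2]) n.le_succ
    · exact_mod_cast Nat.factorial_le n.le_succ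
  have h3 : |twoDiv.ext t| ≤ 2 := by
    rw [ext_twoDiv ht, abs_of_nonneg (by have := ht.1; positivity)]
    exact (div_le_iff₀ (by linarith [ht.1])).2 (by linarith [ht.1])
  rw [CI.ext_add, CI.ext_mul, CI.ext_mul]
  calc |twoDiv.ext t * y.ext t + q.ext t * (primC y).ext t|
      ≤ |twoDiv.ext t| * |y.ext t| + |q.ext t| * |(primC y).ext t| := by
        rw [← abs_mul, ← abs_mul]; exact abs_add_le _ _
    _ ≤ 2 * (M * ((t - 1) ^ n / n.factorial)) + ‖q‖ * (M * ((t - 1) ^ n / n.factorial)) := by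
        refine add_le_add (mul_le_mul h3 (hy t ht) (abs_nonneg _) (by norm_num))
          (mul_le_mul (q.abs_ext_le t) (h1.trans ?_) (abs_nonneg _) (norm_nonneg _))
        exact mul_le_mul_of_nonneg_left h2 hM
    _ = _ := by ring

theorem norm_volterra_pow_le (q : CI) (n : ℕ) :
    ‖(-volterra q) ^ n‖ ≤ (2 + ‖q‖) ^ n / n.factorial := by
  have key : ∀ (n : ℕ) (y : CI), ∀ x ∈ Icc (1 : ℝ) 2, |(((-volterra q) ^ n) y).ext x|
      ≤ (2 + ‖q‖) ^ n * ‖y‖ * ((x - 1) ^ n / n.factorial) := by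
    intro n y
    induction n with
    | zero => intro x _; simpa using y.abs_ext_le x
    | succ n ih =>
      intro x hx
      rw [pow_succ' (-volterra q), pow_succ' (2 + ‖q‖), mul_assoc (2 + ‖q‖)]
      change |(-(volterra q (((-volterra q) ^ n) y))).ext x| ≤ _
      rw [CI.ext_neg, abs_neg]
      exact abs_volterra_le q (by positivity) ih hx
  refine ContinuousLinearMap.opNorm_le_bound _ (by positivity) fun y => ?_
  refine (ContinuousMap.norm_le _ (by positivity)).2 fun x => ?_
  have h := key n y x x.2
  rw [CI.ext_coe] at h
  refine h.trans ?_
  have h1 : ((x : ℝ) - 1) ^ n ≤ 1 :=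
    pow_le_one₀ (by linarith [x.2.1]) (by linarith [x.2.2])
  calc _ ≤ (2 + ‖q‖) ^ n * ‖y‖ * (1 / n.factorial) := by gcongr
    _ = _ := by ring

/-- No smallness of `q` is needed: some power of `-volterra q` has norm below 1 by the factorial
bound, and the invertible operator `1 - (-volterra q) ^ n` has `1 + volterra q` as a factor. -/
theorem isUnit_one_add_volterra (q : CI) : IsUnit (1 + volterra q) := by
  obtain ⟨n, hn⟩ : ∃ n : ℕ, (2 + ‖q‖) ^ n / n.factorial < 1 :=
    ((FloorSemiring.tendsto_pow_div_factorial_atTop (2 + ‖q‖)).eventually_lt_const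
      zero_lt_one).exists
  have h1 : ‖(-volterra q) ^ n‖ < 1 := (norm_volterra_pow_le q n).trans_lt hn
  have h2 := isUnit_one_sub_of_norm_lt_one (R := CI →L[ℝ] CI) h1
  rw [← mul_neg_geom_sum, sub_neg_eq_add] at h2
  -- A factor of a unit need not be a unit in a noncommutative ring. Here the other factor is a
  -- polynomial in `volterra q`, so the two commute.
  refine ((Commute.isUnit_mul_iff ?_).1 h2).1
  have h3 : Commute (volterra q) (-volterra q) := by
    ext y : 1
    exact map_neg (volterra q) (volterra q y)
  exact (Commute.one_left _).add_left (Commute.sum_right _ _ _ fun i _ => h3.pow_right i)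

theorem exists_volterra_solution (q d : CI) : ∃ y : CI, y + volterra q y = d := by
  refine ⟨Ring.inverse (1 + volterra q) d, ?_⟩
  have := Ring.mul_inverse_cancel _ (isUnit_one_add_volterra q)
  exact congrArg (fun T : CI →L[ℝ] CI => T d) this

theorem volterra_injective {q y z : CI} (h : y + volterra q y = z + volterra q z) : y = z := by
  have h1 := Ring.inverse_mul_cancel _ (isUnit_one_add_volterra q)
  have h2 : ∀ w : CI, Ring.inverse (1 + volterra q) (w + volterra q w) = w := fun w =>
    congrArg (fun T : CI →L[ℝ] CI => T w) h1
  rw [← h2 y, h, h2 z]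

/-- The derivative of the solution of `φ'' + 2 φ' / r + q φ = 0`, `φ(1) = 0`, `φ'(1) = 1`. -/
def fundamental (q : CI) : CI := Ring.inverse (1 + volterra q) 1

theorem fundamental_eq (q : CI) : fundamental q + volterra q (fundamental q) = 1 := by
  have := Ring.mul_inverse_cancel _ (isUnit_one_add_volterra q)
  exact congrArg (fun T : CI →L[ℝ] CI => T 1) this

/-- Inversion is continuous at units of a Banach algebra, so the solution depends continuously on
the coefficient. The shooting argument for the sparking voltage rests on this. -/
theorem continuous_fundamental : Continuous fundamental := by
  refine continuous_iff_continuousAt.2 fun q => ?_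
  have h1 : ContinuousAt (fun q => Ring.inverse (1 + volterra q)) q := by
    obtain ⟨w, hw⟩ := isUnit_one_add_volterra q
    refine ContinuousAt.comp (g := Ring.inverse) ?_
      (continuous_const.add continuous_volterra).continuousAt
    rw [← hw]
    exact NormedRing.inverse_continuousAt (R := CI →L[ℝ] CI) w
  exact h1.clm_apply continuousAt_const

/-- With `φ(1) = 0` built into the integral equation, `c = φ'(1)` is the only free datum, so the
solutions form a line. -/
theorem eq_smul_fundamental {q y : CI} {c : ℝ} (h : y + volterra q y = c • 1) :
    y = c • fundamental q := by
  refine volterra_injective (q := q) ?_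
  rw [h, map_smul, ← smul_add, fundamental_eq]

theorem ext_primC_one (y : CI) : (primC y).ext 1 = 0 := ext_prim_one _

theorem fundamental_one (q : CI) : (fundamental q).ext 1 = 1 := by
  have h := congrArg (fun c : CI => c.ext 1) (fundamental_eq q)
  simpa [CI.ext_add, volterra_apply, ext_primC_one, CI.ext_one] using h

theorem primC_twoDiv_mul_invSq : primC (twoDiv * invSq) = 1 - invSq := by
  ext x
  rw [← CI.ext_coe, ext_primC _ x.2, ← CI.ext_coe, CI.ext_sub, CI.ext_one, ext_invSq x.2]
  have h : ∫ t in (1 : ℝ)..x, (twoDiv * invSq).ext t = -(1 / (x : ℝ) ^ 2) - -(1 / (1 : ℝ) ^ 2) := by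
    refine intervalIntegral.integral_eq_sub_of_hasDerivAt (f := fun t => -(1 / t ^ 2))
      (fun t ht => ?_) ((twoDiv * invSq).continuous_ext.intervalIntegrable _ _)
    rw [uIcc_of_le x.2.1] at ht
    have ht' : t ∈ Icc (1 : ℝ) 2 := ⟨ht.1, ht.2.trans x.2.2⟩
    have h0 : t ≠ 0 := by linarith [ht.1]
    rw [CI.ext_mul, ext_twoDiv ht', ext_invSq ht']
    have := ((hasDerivAt_pow 2 t).inv (pow_ne_zero 2 h0)).neg
    simp only [one_div]
    convert! this using 1
    field_simp
    simp
  rw [h]; ring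

/-- For `q = 0` the solution is the harmonic function `1 - 1 / r`. -/
theorem fundamental_zero : fundamental 0 = invSq := by
  have h : invSq + volterra 0 invSq = (1 : ℝ) • 1 := by
    rw [volterra_apply, zero_mul, add_zero, primC_twoDiv_mul_invSq, one_smul]; ring
  simpa using (eq_smul_fundamental h).symm

theorem primC_invSq_two : (primC invSq).ext 2 = 1 / 2 := by
  rw [ext_primC _ mem_two]
  have h : ∫ t in (1 : ℝ)..2, invSq.ext t = -(2 : ℝ)⁻¹ - -(1 : ℝ)⁻¹ := by
    refine intervalIntegral.integral_eq_sub_of_hasDerivAt (f := fun t => -t⁻¹)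
      (fun t ht => ?_) (invSq.continuous_ext.intervalIntegrable _ _)
    rw [uIcc_of_le (by norm_num)] at ht
    have h0 : t ≠ 0 := by linarith [ht.1]
    rw [ext_invSq ht]
    convert! (hasDerivAt_inv h0).neg using 1
    field_simp
  rw [h]; norm_num

theorem hasDerivAt_primC (y : CI) {x : ℝ} (hx : x ∈ Ioo (1 : ℝ) 2) :
    HasDerivAt (primC y).ext (y.ext x) x := by
  refine (hasDerivAt_primitive_ext y x).congr_of_eventuallyEq ?_
  filter_upwards [Ioo_mem_nhds hx.1 hx.2] with t ht
  exact ext_primC y (Ioo_subset_Icc_self ht)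

/-- The Volterra equation is based at 1 and gives no uniqueness for Cauchy data at another point
`r`. The equation is therefore read as a Lipschitz first-order system for `(φ, φ')` and solved
backwards from `r` to 1. -/
theorem eq_zero_of_initial_zero {q y : CI} {c r : ℝ} (h : y + volterra q y = c • 1)
    (hr : r ∈ Icc (1 : ℝ) 2) (h0 : (primC y).ext r = 0) (h1 : y.ext r = 0) : y = 0 := by
  set z : CI := twoDiv * y + q * primC y with hz
  have hy : ∀ t ∈ Icc (1 : ℝ) 2, y.ext t = c - ∫ s in (1 : ℝ)..t, z.ext s := fun t ht => by
    have := congrArg (fun w : CI => w.ext t) h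
    simp only [volterra_apply, CI.ext_add, CI.ext_smul, CI.ext_one, ← hz, ext_primC z ht] at this
    linarith
  -- The pair `(φ, φ')` on `[1,2]`. Written through integrals of extended functions, it is
  -- differentiable on the whole line, end points included.
  let f : ℝ → ℝ × ℝ := fun t => (∫ s in (1 : ℝ)..t, y.ext s, c - ∫ s in (1 : ℝ)..t, z.ext s)
  have hf : ∀ t, HasDerivAt f (y.ext t, -z.ext t) t := fun t =>
    (hasDerivAt_primitive_ext y t).prodMk ((hasDerivAt_primitive_ext z t).const_sub c)
  let v : ℝ → ℝ × ℝ → ℝ × ℝ := fun t p => (p.2, -(twoDiv.ext t * p.2 + q.ext t * p.1))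
  have hv : ∀ t ∈ Icc (1 : ℝ) 2, v t (f t) = (y.ext t, -z.ext t) := fun t ht => by
    simp only [v, f]
    rw [← hy t ht, ← ext_primC y ht, hz, CI.ext_add, CI.ext_mul, CI.ext_mul]
  have hlip : ∀ t, LipschitzWith (1 + (‖twoDiv‖₊ + ‖q‖₊)) (v t) := fun t => by
    refine LipschitzWith.of_dist_le_mul fun p p' => ?_
    rw [dist_eq_norm, dist_eq_norm]
    have a1 : |p.1 - p'.1| ≤ ‖p - p'‖ := norm_fst_le (p - p')
    have a2 : |p.2 - p'.2| ≤ ‖p - p'‖ := norm_snd_le (p - p')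
    have n0 := norm_nonneg (p - p')
    refine (Prod.norm_def _).trans_le (max_le ?_ ?_)
    · change |p.2 - p'.2| ≤ _
      simp only [NNReal.coe_add, NNReal.coe_one, coe_nnnorm]
      nlinarith [norm_nonneg twoDiv, norm_nonneg q]
    · change |-(twoDiv.ext t * p.2 + q.ext t * p.1) - -(twoDiv.ext t * p'.2 + q.ext t * p'.1)| ≤ _
      simp only [NNReal.coe_add, NNReal.coe_one, coe_nnnorm]
      have e : -(twoDiv.ext t * p.2 + q.ext t * p.1) - -(twoDiv.ext t * p'.2 + q.ext t * p'.1)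
        = -(twoDiv.ext t * (p.2 - p'.2) + q.ext t * (p.1 - p'.1)) := by ring
      rw [e, abs_neg]
      calc _ ≤ |twoDiv.ext t| * |p.2 - p'.2| + |q.ext t| * |p.1 - p'.1| := by
            rw [← abs_mul, ← abs_mul]; exact abs_add_le _ _
        _ ≤ ‖twoDiv‖ * ‖p - p'‖ + ‖q‖ * ‖p - p'‖ := by
            gcongr <;> exact CI.abs_ext_le _ _
        _ ≤ _ := by nlinarith
  have hcont : Continuous f := continuous_iff_continuousAt.2 fun t => (hf t).continuousAt
  have key := ODE_solution_unique_of_mem_Icc_left (v := v) (s := fun _ => univ) (f := f)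
    (g := fun _ => 0) (a := 1) (b := r)
    (fun t _ => (hlip t).lipschitzOnWith) hcont.continuousOn
    (fun t ht => by
      rw [hv t ⟨ht.1.le, ht.2.trans hr.2⟩]; exact (hf t).hasDerivWithinAt)
    (fun _ _ => mem_univ _) continuousOn_const
    (fun t _ => by
      have : v t 0 = 0 := by simp [v]
      rw [this]; exact hasDerivWithinAt_const _ _ _)
    (fun _ _ => mem_univ _)
    (by simp only [f, ← hy r hr, ← ext_primC y hr, h0, h1]; rfl)
  -- At `t = 1` the second component of `f` is `c`, so the constant vanishes.
  have h2 := key (left_mem_Icc.2 hr.1)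
  have hc : c = 0 := by simpa [f] using congrArg Prod.snd h2
  rw [hc] at h
  simpa using eq_smul_fundamental h

/-! ### Radial differential equations in Sobolev spaces -/

theorem radialDiv_ae {f : ℝ → ℝ} (hf : IsH1 f) :
    radialDiv f =ᵐ[shellMeasure] fun r => deriv f r + 2 / r * f r := by
  filter_upwards [(isH1_sq.mul hf).weakDeriv_ae, ae_differentiableAt_of_ac hf.ac,
    ae_mem_shell] with r h1 h3 h4
  have hr : r ≠ 0 := by have := h4.1; positivity
  have h5 : deriv (fun s => s ^ 2 * f s) r = 2 * r * f r + r ^ 2 * deriv f r := by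
    rw [deriv_fun_mul (by fun_prop) h3]; simp
  simp only [radialDiv]
  rw [h1, h5]
  field_simp
  ring

/-- The radial Laplacian `φ'' + 2 φ' / r`. -/
def radialLap {k : ℕ} (u : Sobolev (k + 2)) : L2 := u.1 2 + mulL twoDiv (u.1 1)

theorem coeFn_radialLap {k : ℕ} (u : Sobolev (k + 2)) :
    radialLap u =ᵐ[shellMeasure] radialDiv (u.rep 1) := by
  filter_upwards [radialDiv_ae (u.isH1_rep 1), u.deriv_rep 1, u.rep_ae 1,
    Lp.coeFn_add (u.1 2) (mulL twoDiv (u.1 1)), coeFn_mulL twoDiv (u.1 1), ae_mem_shell]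
    with r h1 h2 h3 h4 h5 h6
  rw [radialLap, h4, Pi.add_apply, h5, h1, h2, h3, ext_twoDiv (Ioo_subset_Icc_self h6)]
  rfl

theorem incl_mul (c d : CI) : incl (c * d) = mulL c (incl d) := by
  apply Lp.ext
  filter_upwards [coeFn_incl (c * d), coeFn_incl d, coeFn_mulL c (incl d)] with x h1 h2 h3
  rw [h1, h3, h2, CI.ext_mul]

theorem mulL_mul (c d : CI) (v : L2) : mulL (c * d) v = mulL c (mulL d v) := by
  apply Lp.ext
  filter_upwards [coeFn_mulL (c * d) v, coeFn_mulL d v, coeFn_mulL c (mulL d v)] with x h1 h2 h3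
  rw [h1, h3, h2, CI.ext_mul, mul_assoc]

theorem trace_zero_eq_primC {k : ℕ} {u : Sobolev (k + 2)} (h : u.rep 0 1 = 0) :
    trace 0 u = primC (trace 1 u) := by
  rw [trace_eq, h, zero_smul, zero_add, primC_apply, incl_trace]; rfl

/-- The equation integrated once from 1, with `φ` replaced by the primitive of `φ'`. The converse is
`exists_radial_solution`. -/
theorem volterra_of_radialLap {u : Sobolev 2} {q : CI} {f : L2} (h0 : u.rep 0 1 = 0)
    (h : radialLap u + mulL q (u.1 0) + f = 0) :
    trace 1 u + volterra q (trace 1 u) = u.rep 1 1 • 1 - prim f := by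
  have e0 : u.1 0 = incl (primC (trace 1 u)) := by
    rw [← trace_zero_eq_primC h0, incl_trace]; rfl
  have e1 : u.1 1 = incl (trace 1 u) := by rw [incl_trace]; rfl
  have e2 : u.1 2 = -incl (twoDiv * trace 1 u + q * primC (trace 1 u)) - f := by
    rw [map_add, incl_mul, incl_mul, ← e0, ← e1]
    rw [radialLap] at h
    rw [← sub_eq_zero, ← h]; abel
  have h2 := trace_eq 1 u
  change trace 1 u = u.rep 1 1 • 1 + prim (u.1 2) at h2
  rw [e2, map_sub, map_neg] at h2
  rw [← primC_apply, ← volterra_apply] at h2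
  nth_rewrite 1 [h2]
  abel

theorem exists_radial_solution {q y : CI} {f : L2} {c : ℝ}
    (h : y + volterra q y = c • 1 - prim f) :
    ∃ u : Sobolev 2, trace 0 u = primC y ∧ trace 1 u = y ∧ radialLap u + mulL q (u.1 0) + f = 0 := by
  set v : L2 := -incl (twoDiv * y + q * primC y) - f with hv
  have hw : trace 0 (ofDeriv (c, v)) = y := by
    rw [trace_ofDeriv, hv, map_sub, map_neg, ← primC_apply, ← volterra_apply]
    refine Eq.trans ?_ (eq_sub_of_add_eq h).symm
    abel
  have hw0 : (ofDeriv (c, v)).1 0 = incl y := by rw [← hw, incl_trace]; rfl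
  obtain ⟨u, h1, h2⟩ := (ofDeriv (c, v)).exists_primitive 0
  have h1' : trace 0 u = primC y := by rw [h1, hw0, zero_smul, zero_add, primC_apply]
  refine ⟨u, h1', (trace_succ_eq h2 0).trans hw, ?_⟩
  have e0 : u.1 0 = incl (primC y) := by rw [← h1', incl_trace]; rfl
  have e1 : u.1 1 = incl y := (h2 0).trans hw0
  have e2 : u.1 2 = v := h2 1
  rw [radialLap, e0, e1, e2, hv, map_add, incl_mul, incl_mul]
  abel

/-! ### The coefficients as curves in the Banach algebra of continuous functions -/

theorem continuousOn_dH : ContinuousOn dH (Icc 1 2) :=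
  contDiffOn_dH.continuousOn.mono fun _ hx => lt_of_lt_of_le one_pos hx.1

theorem continuousOn_H : ContinuousOn H (Icc 1 2) :=
  contDiffOn_H.continuousOn.mono fun _ hx => lt_of_lt_of_le one_pos hx.1

/-- `H` on `[1,2]`. -/
def HC : CI := toCI H continuousOn_H

/-- `∂_r H` on `[1,2]`. -/
def dHC : CI := toCI dH continuousOn_dH

theorem ext_HC {x : ℝ} (hx : x ∈ Icc (1 : ℝ) 2) : HC.ext x = H x := ext_toCI continuousOn_H hx

theorem ext_dHC {x : ℝ} (hx : x ∈ Icc (1 : ℝ) 2) : dHC.ext x = dH x :=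
  ext_toCI continuousOn_dH hx

theorem dH_pos {x : ℝ} (hx : x ∈ Icc (1 : ℝ) 2) : 0 < dH x := by
  have := hx.1
  unfold dH
  positivity

theorem continuous_h_abs (a : ℝ) {b : ℝ} (hb : 0 < b) : Continuous fun x : ℝ => h a b |x| := by
  refine continuous_iff_continuousAt.2 fun x => ?_
  rcases eq_or_ne x 0 with rfl | hx
  · rw [ContinuousAt]
    have h0 : h a b |(0 : ℝ)| = 0 := by simp [h]
    rw [h0]
    refine squeeze_zero_norm (a := fun x => |a| * |x|) (fun x => abs_h_le hb (abs_nonneg x)) ?_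
    have : Continuous fun x : ℝ => |a| * |x| := by fun_prop
    simpa using this.tendsto 0
  · unfold h
    have : |x| ≠ 0 := abs_ne_zero.2 hx
    fun_prop (disch := assumption)

/-- The Nemytskii operator `f ↦ h(|f|)`. -/
def hOp (a : ℝ) {b : ℝ} (hb : 0 < b) (f : CI) : CI :=
  (⟨fun x => h a b |x|, continuous_h_abs a hb⟩ : C(ℝ, ℝ)).comp f

theorem ext_hOp (a : ℝ) {b : ℝ} (hb : 0 < b) (f : CI) (x : ℝ) :
    (hOp a hb f).ext x = h a b |f.ext x| := rfl

theorem continuous_hOp (a : ℝ) {b : ℝ} (hb : 0 < b) : Continuous (hOp a hb) :=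
  ContinuousMap.continuous_postcomp _

/-- The coefficient `h(|λ ∂_r H|)`. -/
def hC (a : ℝ) {b : ℝ} (hb : 0 < b) (l : ℝ) : CI := hOp a hb (l • dHC)

/-- The coefficient `g(λ ∂_r H)`. -/
def gC (a : ℝ) {b : ℝ} (hb : 0 < b) (l : ℝ) : CI := hC a hb l - (l ^ 2 / 4) • (dHC * dHC)

/-- The coefficient `e^{-λ H / 2}`. -/
def eC (l : ℝ) : CI := NormedSpace.exp (l • (-(1 / 2 : ℝ) • HC))

/-- Point evaluation is a continuous algebra homomorphism, so it commutes with the exponential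
series. -/
theorem ext_exp (c : CI) (x : ℝ) : (NormedSpace.exp c).ext x = Real.exp (c.ext x) := by
  let _ : NormedAlgebra ℚ CI := NormedAlgebra.restrictScalars ℚ ℝ CI
  have := NormedSpace.map_exp (ContinuousMap.evalAlgHom ℝ ℝ (projIcc 1 2 one_le_two x))
    (evalAt x).continuous c
  rw [← Real.exp_eq_exp_ℝ] at this
  exact this

theorem ext_eC (l : ℝ) {x : ℝ} (hx : x ∈ Icc (1 : ℝ) 2) :
    (eC l).ext x = Real.exp (-(l / 2) * H x) := by
  rw [eC, ext_exp, CI.ext_smul, CI.ext_smul, ext_HC hx]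
  congr 1; ring

theorem ext_hC (a : ℝ) {b : ℝ} (hb : 0 < b) (l : ℝ) {x : ℝ} (hx : x ∈ Icc (1 : ℝ) 2) :
    (hC a hb l).ext x = h a b |l * dH x| := by
  rw [hC, ext_hOp, CI.ext_smul, ext_dHC hx]

theorem ext_hC_of_nonneg (a : ℝ) {b : ℝ} (hb : 0 < b) {l : ℝ} (hl : 0 ≤ l) {x : ℝ}
    (hx : x ∈ Icc (1 : ℝ) 2) : (hC a hb l).ext x = h a b (l * dH x) := by
  rw [ext_hC a hb l hx, abs_of_nonneg (mul_nonneg hl (dH_pos hx).le)]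

theorem ext_gC_of_nonneg (a : ℝ) {b : ℝ} (hb : 0 < b) {l : ℝ} (hl : 0 ≤ l) {x : ℝ}
    (hx : x ∈ Icc (1 : ℝ) 2) : (gC a hb l).ext x = g a b (l * dH x) := by
  rw [gC, CI.ext_sub, CI.ext_smul, CI.ext_mul, ext_hC_of_nonneg a hb hl hx, ext_dHC hx, g]
  ring

theorem continuous_hC (a : ℝ) {b : ℝ} (hb : 0 < b) : Continuous (hC a hb) :=
  (continuous_hOp a hb).comp (by fun_prop)

theorem continuous_gC (a : ℝ) {b : ℝ} (hb : 0 < b) : Continuous (gC a hb) := by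
  have := continuous_hC a hb
  unfold gC
  fun_prop

theorem hasDerivAt_eC (l : ℝ) : HasDerivAt eC (eC l * (-(1 / 2 : ℝ) • HC)) l :=
  hasDerivAt_exp_smul_const (-(1 / 2 : ℝ) • HC : CI) l

theorem continuous_eC : Continuous eC :=
  continuous_iff_continuousAt.2 fun l => (hasDerivAt_eC l).continuousAt

/-- Since `H' = 2 / r²`, the exponent `-b / (λ H')` equals `λ⁻¹ · (-(b / 2) r²)`. The coefficient is
thus an exponential in the Banach algebra along a fixed direction, from which its
norm-differentiability in `λ > 0` follows. -/
theorem hC_eq (a : ℝ) {b : ℝ} (hb : 0 < b) {l : ℝ} (hl : 0 < l) :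
    hC a hb l = (a * l) • (dHC * NormedSpace.exp (l⁻¹ • (-(b / 2) • sqCI))) := by
  ext x
  have hx : (x : ℝ) ≠ 0 := by linarith [x.2.1]
  rw [← CI.ext_coe, ← CI.ext_coe, ext_hC_of_nonneg a hb hl.le x.2, CI.ext_smul, CI.ext_mul, ext_exp,
    CI.ext_smul, CI.ext_smul, ext_dHC x.2, ext_sqCI x.2, h]
  have : -b / (l * dH x) = l⁻¹ * (-(b / 2) * (x : ℝ) ^ 2) := by
    unfold dH; field_simp
  rw [this]; ring

theorem differentiableAt_hC (a : ℝ) {b : ℝ} (hb : 0 < b) {l : ℝ} (hl : 0 < l) :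
    DifferentiableAt ℝ (hC a hb) l := by
  have h1 : DifferentiableAt ℝ
      (fun l : ℝ => (a * l) • (dHC * NormedSpace.exp (l⁻¹ • (-(b / 2) • sqCI)))) l := by
    have h2 : DifferentiableAt ℝ
        (fun l : ℝ => NormedSpace.exp (l⁻¹ • (-(b / 2) • sqCI) : CI)) l :=
      (hasDerivAt_exp_smul_const (-(b / 2) • sqCI : CI) l⁻¹).differentiableAt.comp
        (f := fun l : ℝ => l⁻¹) l (differentiableAt_inv hl.ne')
    fun_prop
  refine h1.congr_of_eventuallyEq ?_
  filter_upwards [lt_mem_nhds hl] with t ht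
  exact hC_eq a hb ht

theorem hasDerivAt_h (a : ℝ) {b ℓ : ℝ} (hℓ : 0 < ℓ) :
    DifferentiableAt ℝ (h a b) ℓ := by
  unfold h
  have := hℓ.ne'
  fun_prop (disch := assumption)

/-- Evaluation at a point is bounded and linear, hence commutes with the derivative in `λ`. What
remains is the scalar chain rule. -/
theorem ext_deriv_hC (a : ℝ) {b : ℝ} (hb : 0 < b) {l : ℝ} (hl : 0 < l) {x : ℝ}
    (hx : x ∈ Icc (1 : ℝ) 2) :
    (deriv (hC a hb) l).ext x = deriv (h a b) (l * dH x) * dH x := by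
  have h1 : HasDerivAt (fun t => (hC a hb t).ext x) ((deriv (hC a hb) l).ext x) l :=
    (evalAt x).hasFDerivAt.comp_hasDerivAt l (differentiableAt_hC a hb hl).hasDerivAt
  have h2 : HasDerivAt (fun t => h a b (t * dH x)) (deriv (h a b) (l * dH x) * dH x) l := by
    have h3 := (hasDerivAt_h a (b := b) (mul_pos hl (dH_pos hx))).hasDerivAt
    exact h3.comp l (by simpa using (hasDerivAt_id l).mul_const (dH x))
  refine h1.unique (h2.congr_of_eventuallyEq ?_)
  filter_upwards [lt_mem_nhds hl] with t ht
  exact ext_hC_of_nonneg a hb ht.le hx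

theorem hasDerivAt_gC (a : ℝ) {b : ℝ} (hb : 0 < b) {l : ℝ} (hl : 0 < l) :
    HasDerivAt (gC a hb) (deriv (hC a hb) l - (l / 2) • (dHC * dHC)) l := by
  refine (differentiableAt_hC a hb hl).hasDerivAt.sub ?_
  have := ((hasDerivAt_pow 2 l).div_const 4).smul_const (dHC * dHC)
  convert! this using 2
  simp; ring

theorem ext_deriv_gC (a : ℝ) {b : ℝ} (hb : 0 < b) {l : ℝ} (hl : 0 < l) {x : ℝ}
    (hx : x ∈ Icc (1 : ℝ) 2) :
    (deriv (hC a hb) l - (l / 2) • (dHC * dHC)).ext x = deriv (g a b) (l * dH x) * dH x := by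
  rw [CI.ext_sub, CI.ext_smul, CI.ext_mul, ext_deriv_hC a hb hl hx, ext_dHC hx]
  have h1 := (hasDerivAt_h a (b := b) (mul_pos hl (dH_pos hx))).hasDerivAt
  have h2 : HasDerivAt (g a b) (deriv (h a b) (l * dH x) - (2 * (l * dH x)) / 4) (l * dH x) := by
    refine h1.sub ?_
    simpa using (hasDerivAt_pow 2 (l * dH x)).div_const 4
  rw [h2.deriv]
  ring

/-! ### The linearized operator -/

/-- `radialLap` as a bounded operator. -/
def radialLapL (k : ℕ) : Sobolev (k + 2) →L[ℝ] L2 := comp 2 + (mulL twoDiv).comp (comp 1)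

theorem _root_.DifferentiableAt.clm_comp_const {E F G H : Type*} [NormedAddCommGroup E]
    [NormedSpace ℝ E] [NormedAddCommGroup F] [NormedSpace ℝ F] [NormedAddCommGroup G]
    [NormedSpace ℝ G] [NormedAddCommGroup H] [NormedSpace ℝ H]
    (B : H →L[ℝ] F →L[ℝ] G) (A : E →L[ℝ] F) {f : ℝ → H} {x : ℝ} (hf : DifferentiableAt ℝ f x) :
    DifferentiableAt ℝ (fun t => (B (f t)).comp A) x :=
  (B.differentiableAt.comp x hf).clm_comp (differentiableAt_const A)

theorem _root_.DifferentiableAt.clm_prod {E F G : Type*} [NormedAddCommGroup E] [NormedSpace ℝ E]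
    [NormedAddCommGroup F] [NormedSpace ℝ F] [NormedAddCommGroup G] [NormedSpace ℝ G]
    {f : ℝ → E →L[ℝ] F} {f' : ℝ → E →L[ℝ] G} {x : ℝ} (hf : DifferentiableAt ℝ f x)
    (hf' : DifferentiableAt ℝ f' x) : DifferentiableAt ℝ (fun t => (f t).prod (f' t)) x :=
  (ContinuousLinearMap.prodₗᵢ (𝕜 := ℝ) (E := E) (F := F) (G := G)
    ℝ).toContinuousLinearEquiv.differentiableAt.comp x (hf.prodMk hf')

section

variable (a : ℝ) {b : ℝ} (hb : 0 < b) (γ ki ke : ℝ) {E : Type*} [NormedAddCommGroup E]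
  [NormedSpace ℝ E] (Aρ : E →L[ℝ] Sobolev 1) (AR : E →L[ℝ] Sobolev 2) (AV : E →L[ℝ] Sobolev 3)

/-- First component of the linearized operator, for a space `E` that parametrizes
`H¹(I) × H²(I) × H³(I)`. -/
def lin₁ (l : ℝ) : E →L[ℝ] L2 :=
  ki • (mulL (l • dHC)).comp ((comp 1).comp Aρ)
    - ke • (mulL (hC a hb l * eC l)).comp ((comp 0).comp AR)

/-- Second component of the linearized operator. -/
def lin₂ (l : ℝ) : E →L[ℝ] L2 :=
  -(radialLapL 0).comp AR - (mulL (gC a hb l)).comp ((comp 0).comp AR)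

/-- The derivative of the third component of the linearized operator. -/
def lin₃' (l : ℝ) : E →L[ℝ] L2 :=
  (comp 3).comp AV + (mulL twoDiv).comp ((comp 2).comp AV)
    - (mulL dHC).comp ((comp 1).comp AV) - (comp 1).comp Aρ
    + (mulL (eC l)).comp ((comp 1).comp AR)
    - (mulL ((l / 2) • (dHC * eC l))).comp ((comp 0).comp AR)

/-- Third component of the linearized operator. -/
def lin₃ (l : ℝ) : E →L[ℝ] Sobolev 1 :=
  ofDeriv.comp (((evalAt 1).comp ((trace 2).comp AV)
    + (2 : ℝ) • (evalAt 1).comp ((trace 1).comp AV)).prod (lin₃' Aρ AR AV l))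

/-- Fourth component of the linearized operator. -/
def lin₄ (l : ℝ) : E →L[ℝ] ℝ :=
  (evalAt 2).comp ((trace 1).comp AR) + (l / 4) • (evalAt 2).comp ((trace 0).comp AR)
    - (γ * (ki / ke) * Real.exp (l / 2) * (l / 2)) • (evalAt 2).comp ((trace 0).comp Aρ)

/-- The linearized operator. -/
def lin (l : ℝ) : E →L[ℝ] Y :=
  (lin₁ a hb ki ke Aρ AR l).prod ((lin₂ a hb AR l).prod
    ((lin₃ Aρ AR AV l).prod (lin₄ γ ki ke Aρ AR l)))

/-- Each component is a sum of fixed bounded operators and of compositions of such operators with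
multiplication by a norm-differentiable coefficient. -/
theorem differentiableAt_lin {l : ℝ} (hl : 0 < l) :
    DifferentiableAt ℝ (lin a hb γ ki ke Aρ AR AV) l := by
  have h1 := differentiableAt_hC a hb hl
  have h2 := (hasDerivAt_gC a hb hl).differentiableAt
  have h3 := (hasDerivAt_eC l).differentiableAt
  have c1 : DifferentiableAt ℝ (fun l : ℝ => l • dHC) l := by fun_prop
  have c2 : DifferentiableAt ℝ (fun l : ℝ => hC a hb l * eC l) l := h1.mul h3
  have c3 : DifferentiableAt ℝ (fun l : ℝ => (l / 2) • (dHC * eC l)) l := by fun_prop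
  have d1 : DifferentiableAt ℝ (lin₁ a hb ki ke Aρ AR) l :=
    ((c1.clm_comp_const mulL _).const_smul ki).sub ((c2.clm_comp_const mulL _).const_smul ke)
  have d2 : DifferentiableAt ℝ (lin₂ a hb AR) l :=
    (differentiableAt_const _).sub (h2.clm_comp_const mulL _)
  have d3' : DifferentiableAt ℝ (lin₃' Aρ AR AV) l :=
    ((differentiableAt_const _).add (h3.clm_comp_const mulL _)).sub (c3.clm_comp_const mulL _)
  have d3 : DifferentiableAt ℝ (lin₃ Aρ AR AV) l :=
    (differentiableAt_const ofDeriv).clm_comp ((differentiableAt_const _).clm_prod d3')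
  have d4 : DifferentiableAt ℝ (lin₄ γ ki ke Aρ AR) l := by
    have e1 : DifferentiableAt ℝ (fun l : ℝ => l / 4) l := by fun_prop
    have e2 : DifferentiableAt ℝ (fun l : ℝ => γ * (ki / ke) * Real.exp (l / 2) * (l / 2)) l := by
      fun_prop
    exact ((differentiableAt_const _).add (e1.smul_const _)).sub (e2.smul_const _)
  exact d1.clm_prod (d2.clm_prod (d3.clm_prod d4))

end

/-! ### The remainder of the linearization -/

/-- A factor `o(1)` times a factor `O(u)`. Mere continuity of `f` suffices, so no derivative of
`h(|·|)` enters the Fréchet derivative at 0. -/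
theorem hasFDerivAt_bilin_zero {E F G W : Type*} [NormedAddCommGroup E] [NormedSpace ℝ E]
    [NormedAddCommGroup F] [NormedSpace ℝ F] [NormedAddCommGroup G] [NormedSpace ℝ G]
    [NormedAddCommGroup W] [NormedSpace ℝ W] (B : G →L[ℝ] F →L[ℝ] W) {f : E → G}
    (hf : ContinuousAt f 0) (h0 : f 0 = 0) (A : E →L[ℝ] F) :
    HasFDerivAt (fun u => B (f u) (A u)) (0 : E →L[ℝ] W) 0 := by
  rw [hasFDerivAt_iff_isLittleO_nhds_zero]
  have h1 : (fun u => B (f u)) =o[nhds 0] fun _ : E => (1 : ℝ) := by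
    rw [Asymptotics.isLittleO_one_iff]
    have := (B.continuous.continuousAt (x := f 0)).comp hf
    rw [ContinuousAt] at this
    simpa [h0, Function.comp_def] using this
  have h2 : (fun u => A u) =O[nhds 0] fun u : E => u := A.isBigO_id _
  have h3 : (fun u => B (f u) (A u)) =O[nhds 0] fun u => ‖B (f u)‖ * ‖A u‖ :=
    Asymptotics.isBigO_of_le _ fun u =>
      ((B (f u)).le_opNorm (A u)).trans (le_abs_self (‖B (f u)‖ * ‖A u‖))
  have h4 := h3.trans_isLittleO (h1.norm_left.mul_isBigO h2.norm_norm)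
  simp only [one_mul] at h4
  simpa [h0] using h4.of_norm_right

section

variable (a : ℝ) {b : ℝ} (hb : 0 < b) (γ ki ke : ℝ)

/-- Remainder of the first component. -/
def rem₁ (l : ℝ) (ρ : Sobolev 1) (R : Sobolev 2) (V : Sobolev 3) : L2 :=
  ki • (mulL (trace 1 V) (comp 1 ρ) + mulL (trace 0 ρ) (radialLapL 1 V))
    - ke • mulL ((hOp a hb (trace 1 V + l • dHC) - hC a hb l) * eC l) (comp 0 R)

/-- Remainder of the second component. -/
def rem₂ (l : ℝ) (R : Sobolev 2) (V : Sobolev 3) : L2 :=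
  mulL (-trace 1 V) (comp 1 R)
    + mulL ((l / 2) • (dHC * trace 1 V) - (hOp a hb (trace 1 V + l • dHC) - hC a hb l)) (comp 0 R)
    - mulL (trace 0 R) (radialLapL 1 V)

/-- Remainder of the fourth component. -/
def rem₄ (l : ℝ) (ρ : Sobolev 1) (R : Sobolev 2) (V : Sobolev 3) : ℝ :=
  evalAt 2 (trace 1 V) * evalAt 2 (trace 0 R)
    - (γ * (ki / ke) * Real.exp (l / 2)) • (evalAt 2 (trace 1 V) * evalAt 2 (trace 0 ρ))

variable {E : Type*} [NormedAddCommGroup E] [NormedSpace ℝ E]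
  (Aρ : E →L[ℝ] Sobolev 1) (AR : E →L[ℝ] Sobolev 2) (AV : E →L[ℝ] Sobolev 3)

theorem continuousAt_hOp_sub (l : ℝ) :
    ContinuousAt (fun u => hOp a hb (trace 1 (AV u) + l • dHC) - hC a hb l) 0 := by
  refine (((continuous_hOp a hb).comp (Continuous.add ?_ continuous_const)).sub
    continuous_const).continuousAt
  exact (trace 1).continuous.comp AV.continuous

theorem hOp_sub_zero (l : ℝ) :
    hOp a hb (trace 1 (AV 0) + l • dHC) - hC a hb l = 0 := by
  rw [map_zero, map_zero, zero_add, hC, sub_self]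

theorem hasFDerivAt_rem₁ (l : ℝ) :
    HasFDerivAt (fun u => rem₁ a hb ki ke l (Aρ u) (AR u) (AV u)) (0 : E →L[ℝ] L2) 0 := by
  have h1 := hasFDerivAt_bilin_zero mulL (f := fun u => trace 1 (AV u))
    ((trace 1).comp AV).continuous.continuousAt (by simp) ((comp 1).comp Aρ)
  have h2 := hasFDerivAt_bilin_zero mulL (f := fun u => trace 0 (Aρ u))
    ((trace 0).comp Aρ).continuous.continuousAt (by simp) ((radialLapL 1).comp AV)
  have h3 := hasFDerivAt_bilin_zero mulL
    (f := fun u => (hOp a hb (trace 1 (AV u) + l • dHC) - hC a hb l) * eC l)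
    ((continuousAt_hOp_sub a hb AV l).mul continuousAt_const)
    (by rw [hOp_sub_zero, zero_mul]) ((comp 0).comp AR)
  have := ((h1.add h2).const_smul ki).sub (h3.const_smul ke)
  simp only [add_zero, smul_zero, sub_zero] at this
  exact this

theorem hasFDerivAt_rem₂ (l : ℝ) :
    HasFDerivAt (fun u => rem₂ a hb l (AR u) (AV u)) (0 : E →L[ℝ] L2) 0 := by
  have c1 : ContinuousAt (fun u => trace 1 (AV u)) 0 :=
    ((trace 1).comp AV).continuous.continuousAt
  have h1 := hasFDerivAt_bilin_zero mulL (f := fun u => -trace 1 (AV u))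
    c1.neg (by simp) ((comp 1).comp AR)
  have h2 := hasFDerivAt_bilin_zero mulL (f := fun u => (l / 2) • (dHC * trace 1 (AV u))
      - (hOp a hb (trace 1 (AV u) + l • dHC) - hC a hb l))
    (((continuousAt_const.mul c1).const_smul (l / 2)).sub (continuousAt_hOp_sub a hb AV l))
    (by rw [hOp_sub_zero]; simp) ((comp 0).comp AR)
  have h3 := hasFDerivAt_bilin_zero mulL (f := fun u => trace 0 (AR u))
    ((trace 0).comp AR).continuous.continuousAt (by simp) ((radialLapL 1).comp AV)
  have := (h1.add h2).sub h3
  simp only [add_zero, sub_zero] at this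
  exact this

theorem hasFDerivAt_rem₄ (l : ℝ) :
    HasFDerivAt (fun u => rem₄ γ ki ke l (Aρ u) (AR u) (AV u)) (0 : E →L[ℝ] ℝ) 0 := by
  have c1 : ContinuousAt (fun u => evalAt 2 (trace 1 (AV u))) 0 :=
    ((evalAt 2).comp ((trace 1).comp AV)).continuous.continuousAt
  have h1 := hasFDerivAt_bilin_zero (ContinuousLinearMap.mul ℝ ℝ) c1 (by simp)
    ((evalAt 2).comp ((trace 0).comp AR))
  have h2 := hasFDerivAt_bilin_zero (ContinuousLinearMap.mul ℝ ℝ) c1 (by simp)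
    ((evalAt 2).comp ((trace 0).comp Aρ))
  have := h1.sub (h2.const_smul (γ * (ki / ke) * Real.exp (l / 2)))
  simp only [smul_zero, sub_zero] at this
  exact this

/-- The nonlinear operator in terms of its linear part and the remainder. -/
theorem hasFDerivAt_lin_add_rem (l : ℝ) :
    HasFDerivAt (fun u => ((lin₁ a hb ki ke Aρ AR l u + rem₁ a hb ki ke l (Aρ u) (AR u) (AV u),
      lin₂ a hb AR l u + rem₂ a hb l (AR u) (AV u), lin₃ Aρ AR AV l u,
      lin₄ γ ki ke Aρ AR l u + rem₄ γ ki ke l (Aρ u) (AR u) (AV u)) : Y))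
      (lin a hb γ ki ke Aρ AR AV l) 0 := by
  have h1 := (lin₁ a hb ki ke Aρ AR l).hasFDerivAt.add (hasFDerivAt_rem₁ a hb ki ke Aρ AR AV l)
  have h2 := (lin₂ a hb AR l).hasFDerivAt.add (hasFDerivAt_rem₂ a hb AR AV l)
  have h4 := (lin₄ γ ki ke Aρ AR l).hasFDerivAt.add (hasFDerivAt_rem₄ γ ki ke Aρ AR AV l)
  rw [add_zero] at h1 h2 h4
  exact h1.prodMk (h2.prodMk ((lin₃ Aρ AR AV l).hasFDerivAt.prodMk h4))

end

/-! ### Identification of the nonlinear operator -/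

/-- The projection of `X` to the ion component. -/
def projρ : X →L[ℝ] Sobolev 1 := (ContinuousLinearMap.fst ℝ _ _).comp XSubmodule.subtypeL

/-- The projection of `X` to the electron component. -/
def projR : X →L[ℝ] Sobolev 2 :=
  (ContinuousLinearMap.fst ℝ _ _).comp
    ((ContinuousLinearMap.snd ℝ _ _).comp XSubmodule.subtypeL)

/-- The projection of `X` to the potential. -/
def projV : X →L[ℝ] Sobolev 3 :=
  (ContinuousLinearMap.snd ℝ _ _).comp
    ((ContinuousLinearMap.snd ℝ _ _).comp XSubmodule.subtypeL)

theorem ofDeriv_ae {f : ℝ → ℝ} {p : ℝ × L2} (hf : IsH1 f) (h1 : f 1 = p.1)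
    (h2 : deriv f =ᵐ[shellMeasure] p.2) : (ofDeriv p).1 0 =ᵐ[shellMeasure] f := by
  rw [ofDeriv_zero]
  filter_upwards [coeFn_incl (p.1 • 1 + prim p.2), ae_mem_shell] with x h3 h4
  have hx := Ioo_subset_Icc_self h4
  rw [h3, CI.ext_add, CI.ext_smul, CI.ext_one, ext_prim _ hx, ← intervalIntegral_congr_shell h2 hx,
    AbsolutelyContinuousOnInterval.integral_deriv_eq_sub, h1]
  · ring
  · refine hf.ac.mono ?_
    rw [uIcc_of_le hx.1, uIcc_of_le (by norm_num)]
    exact Icc_subset_Icc_right hx.2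

theorem hasDerivAt_exp_H (l : ℝ) {x : ℝ} (hx : x ≠ 0) :
    HasDerivAt (fun s => Real.exp (-(l / 2) * H s)) (-(l / 2) * (dH x * Real.exp (-(l / 2) * H x)))
      x := by
  have := ((hasDerivAt_H hx).const_mul (-(l / 2))).exp
  convert! this using 1; ring

theorem isH1_two_div : IsH1 fun s => 2 / s := isH1_of_contDiffOn
  (contDiffOn_const.div contDiffOn_id fun _ hx => ne_of_gt hx)

theorem coeFn_lin₃' {E : Type*} [NormedAddCommGroup E] [NormedSpace ℝ E]
    (Aρ : E →L[ℝ] Sobolev 1) (AR : E →L[ℝ] Sobolev 2) (AV : E →L[ℝ] Sobolev 3) (l : ℝ) (u : E) :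
    lin₃' Aρ AR AV l u =ᵐ[shellMeasure] fun x => (AV u).1 3 x + 2 / x * (AV u).1 2 x
      - dH x * (AV u).1 1 x - (Aρ u).1 1 x + Real.exp (-(l / 2) * H x) * (AR u).1 1 x
      - l / 2 * (dH x * Real.exp (-(l / 2) * H x)) * (AR u).1 0 x := by
  have e : lin₃' Aρ AR AV l u = (AV u).1 3 + mulL twoDiv ((AV u).1 2) - mulL dHC ((AV u).1 1)
    - (Aρ u).1 1 + mulL (eC l) ((AR u).1 1) - mulL ((l / 2) • (dHC * eC l)) ((AR u).1 0) := rfl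
  rw [e]
  filter_upwards [Lp.coeFn_sub ((AV u).1 3 + mulL twoDiv ((AV u).1 2) - mulL dHC ((AV u).1 1)
      - (Aρ u).1 1 + mulL (eC l) ((AR u).1 1)) (mulL ((l / 2) • (dHC * eC l)) ((AR u).1 0)),
    Lp.coeFn_add ((AV u).1 3 + mulL twoDiv ((AV u).1 2) - mulL dHC ((AV u).1 1)
      - (Aρ u).1 1) (mulL (eC l) ((AR u).1 1)),
    Lp.coeFn_sub ((AV u).1 3 + mulL twoDiv ((AV u).1 2) - mulL dHC ((AV u).1 1)) ((Aρ u).1 1),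
    Lp.coeFn_sub ((AV u).1 3 + mulL twoDiv ((AV u).1 2)) (mulL dHC ((AV u).1 1)),
    Lp.coeFn_add ((AV u).1 3) (mulL twoDiv ((AV u).1 2)), coeFn_mulL twoDiv ((AV u).1 2),
    coeFn_mulL dHC ((AV u).1 1), coeFn_mulL (eC l) ((AR u).1 1),
    coeFn_mulL ((l / 2) • (dHC * eC l)) ((AR u).1 0), ae_mem_shell]
    with x h1 h2 h3 h4 h5 h6 h7 h8 h9 h10
  have hx := Ioo_subset_Icc_self h10
  rw [h1, Pi.sub_apply, h2, Pi.add_apply, h3, Pi.sub_apply, h4, Pi.sub_apply, h5, Pi.add_apply, h6,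
    h7, h8, h9, CI.ext_smul, CI.ext_mul, ext_eC l hx, ext_dHC hx, ext_twoDiv hx]

/-- The value at `r = 1` stored in `lin₃` omits the terms with `ρ` and `R`, which vanish there by
`z1` and `z2`. The stored derivative matches by differentiating `V'' + 2 V' / r - ρ + e^{-λH/2} R`.
-/
theorem coeFn_lin₃ {E : Type*} [NormedAddCommGroup E] [NormedSpace ℝ E]
    (Aρ : E →L[ℝ] Sobolev 1) (AR : E →L[ℝ] Sobolev 2) (AV : E →L[ℝ] Sobolev 3) (l : ℝ) (u : E)
    (z1 : (Aρ u).rep 0 1 = 0) (z2 : (AR u).rep 0 1 = 0) :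
    (lin₃ Aρ AR AV l u).1 0 =ᵐ[shellMeasure] fun r => radialDiv ((AV u).rep 1) r - (Aρ u).rep 0 r
      + Real.exp (-(l / 2) * H r) * (AR u).rep 0 r := by
  have hρ := (Aρ u).isH1_rep 0
  have hR := (AR u).isH1_rep 0
  have hV' := (AV u).isH1_rep 1
  have hV'' := (AV u).isH1_rep 2
  have hf := ((hV''.add (isH1_two_div.mul hV')).add ((isH1_const (-1)).mul hρ)).add
    ((isH1_exp l).mul hR)
  refine (ofDeriv_ae hf ?_ ?_).trans ?_
  · simp only [z1, z2]
    change _ = (trace 2 (AV u)).ext 1 + 2 * (trace 1 (AV u)).ext 1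
    rw [ext_trace 2 _ mem_one, ext_trace 1 _ mem_one]
    ring
  · filter_upwards [coeFn_lin₃' Aρ AR AV l u, ae_mem_shell,
      ae_differentiableAt_of_ac hρ.ac, ae_differentiableAt_of_ac hR.ac,
      ae_differentiableAt_of_ac hV'.ac, ae_differentiableAt_of_ac hV''.ac,
      (Aρ u).deriv_rep 0, (AR u).deriv_rep 0, (AV u).deriv_rep 1, (AV u).deriv_rep 2,
      (AR u).rep_ae 0, (AV u).rep_ae 1] with x h1 h2 d1 d2 d3 d4 e1 e2 e3 e4 e5 e6
    have hx : x ≠ 0 := by have := h2.1; positivity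
    have t2 : HasDerivAt (fun s : ℝ => 2 / s) (-(2 / x ^ 2)) x := by
      have := (hasDerivAt_inv hx).const_mul 2
      convert! this using 1; field_simp
    have key := ((d4.hasDerivAt.add (t2.mul d3.hasDerivAt)).add
      ((hasDerivAt_const x (-1 : ℝ)).mul d1.hasDerivAt)).add
      ((hasDerivAt_exp_H l hx).mul d2.hasDerivAt)
    refine (HasDerivAt.deriv (f := fun s => (AV u).rep 2 s + 2 / s * (AV u).rep 1 s
      + -1 * (Aρ u).rep 0 s + Real.exp (-(l / 2) * H s) * (AR u).rep 0 s) key).trans ?_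
    refine Eq.trans ?_ h1.symm
    rw [e1, e2, e3, e4, e5, e6]
    change _ = (AV u).1 3 x + 2 / x * (AV u).1 2 x - dH x * (AV u).1 1 x - (Aρ u).1 1 x
      + Real.exp (-(l / 2) * H x) * (AR u).1 1 x
      - l / 2 * (dH x * Real.exp (-(l / 2) * H x)) * (AR u).1 0 x
    change (AV u).1 3 x + (-(2 / x ^ 2) * (AV u).1 1 x + 2 / x * (AV u).1 2 x)
      + (0 * (Aρ u).rep 0 x + -1 * (Aρ u).1 1 x)
      + (-(l / 2) * (dH x * Real.exp (-(l / 2) * H x)) * (AR u).1 0 x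
        + Real.exp (-(l / 2) * H x) * (AR u).1 1 x) = _
    unfold dH
    ring
  · filter_upwards [radialDiv_ae hV', (AV u).deriv_rep 1, (AV u).rep_ae 2] with x h1 h2 h3
    rw [h1, h2, h3]
    change (AV u).1 2 x + _ + _ + _ = (AV u).1 2 x + _ - _ + _
    ring

/-- The linearized operator on `X`. -/
def linX (a : ℝ) {b : ℝ} (hb : 0 < b) (γ ki ke l : ℝ) : X →L[ℝ] Y :=
  @lin a b hb γ ki ke X _ XSubmodule.normedSpace projρ projR projV l

theorem toLp_eq_of_ae {f : ℝ → ℝ} (hf : MemLp f 2 shellMeasure) {v : L2}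
    (h : v =ᵐ[shellMeasure] f) : hf.toLp = v := Lp.ext (hf.coeFn_toLp.trans h.symm)

theorem linX_fst (a : ℝ) {b : ℝ} (hb : 0 < b) (γ ki ke l : ℝ) (u : X) :
    (linX a hb γ ki ke l u).1 = ki • mulL (l • dHC) (u.1.1.1 1)
      - ke • mulL (hC a hb l * eC l) (u.1.2.1.1 0) := rfl

theorem linX_snd (a : ℝ) {b : ℝ} (hb : 0 < b) (γ ki ke l : ℝ) (u : X) :
    (linX a hb γ ki ke l u).2.1 = -radialLap u.1.2.1 - mulL (gC a hb l) (u.1.2.1.1 0) := rfl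

theorem linX_trd (a : ℝ) {b : ℝ} (hb : 0 < b) (γ ki ke l : ℝ) (u : X) :
    (linX a hb γ ki ke l u).2.2.1.1 0 =ᵐ[shellMeasure] F₃fun l u :=
  @coeFn_lin₃ X _ XSubmodule.normedSpace projρ projR projV l u u.2.1 u.2.2.1

theorem linX_fth (a : ℝ) {b : ℝ} (hb : 0 < b) (γ ki ke l : ℝ) (u : X) :
    (linX a hb γ ki ke l u).2.2.2 = u.1.2.1.rep 1 2 + l / 4 * u.1.2.1.rep 0 2
      - γ * (ki / ke) * Real.exp (l / 2) * (l / 2) * u.1.1.rep 0 2 := by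
  rw [← ext_trace 1 _ mem_two, ← ext_trace 0 u.1.2.1 mem_two, ← ext_trace 0 u.1.1 mem_two]
  rfl

theorem mulL_add_left (c d : CI) (v : L2) : mulL (c + d) v = mulL c v + mulL d v := by
  rw [map_add]; rfl

theorem mulL_sub_left (c d : CI) (v : L2) : mulL (c - d) v = mulL c v - mulL d v := by
  rw [map_sub]; rfl

theorem mulL_neg_left (c : CI) (v : L2) : mulL (-c) v = -mulL c v := by
  rw [map_neg]; rfl

theorem H_two : H 2 = 1 := by norm_num [H]

theorem dH_two : dH 2 = 1 / 2 := by norm_num [dH]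

/-- As `r² H'` is constant, `(r² ρ λ H')' / r²` reduces to `λ H' ρ'`, which is the linear part. The
terms `ρ' V' + ρ ΔV` and the increment of `h` are the remainder. -/
theorem coeFn_add_rem₁ (a : ℝ) {b : ℝ} (hb : 0 < b) (ki ke l : ℝ) (u : X) :
    (ki • mulL (l • dHC) (u.1.1.1 1) - ke • mulL (hC a hb l * eC l) (u.1.2.1.1 0)
      + rem₁ a hb ki ke l u.1.1 u.1.2.1 u.1.2.2 : L2) =ᵐ[shellMeasure] F₁fun a b ki ke l u := by
  obtain ⟨⟨ρ, R, V⟩, hu⟩ := u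
  have hρ := ρ.isH1_rep 0
  have hV := V.isH1_rep 1
  have hd := isH1_of_contDiffOn contDiffOn_dH
  have hfield : IsH1 fun s => V.rep 1 s + l * dH s := hV.add ((isH1_const l).mul hd)
  set w : CI := (hOp a hb (trace 1 V + l • dHC) - hC a hb l) * eC l with hw
  have e : (ki • mulL (l • dHC) (ρ.1 1) - ke • mulL (hC a hb l * eC l) (R.1 0)
      + rem₁ a hb ki ke l ρ R V : L2) = ki • (mulL (l • dHC + trace 1 V) (ρ.1 1)
        + mulL (trace 0 ρ) (radialLap V))
        - ke • mulL (hOp a hb (trace 1 V + l • dHC) * eC l) (R.1 0) := by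
    have e1 : rem₁ a hb ki ke l ρ R V = ki • (mulL (trace 1 V) (ρ.1 1)
        + mulL (trace 0 ρ) (radialLap V)) - ke • mulL w (R.1 0) := rfl
    have e2 : hOp a hb (trace 1 V + l • dHC) * eC l = hC a hb l * eC l + w := by rw [hw]; ring
    rw [e1, e2, mulL_add_left, mulL_add_left]
    module
  change (ki • mulL (l • dHC) (ρ.1 1) - ke • mulL (hC a hb l * eC l) (R.1 0)
      + rem₁ a hb ki ke l ρ R V : L2) =ᵐ[shellMeasure] _
  rw [e]
  set A : L2 := mulL (l • dHC + trace 1 V) (ρ.1 1) with hA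
  set B : L2 := mulL (trace 0 ρ) (radialLap V) with hB
  set C : L2 := mulL (hOp a hb (trace 1 V + l • dHC) * eC l) (R.1 0) with hC
  filter_upwards [Lp.coeFn_sub (ki • (A + B)) (ke • C), Lp.coeFn_smul ki (A + B),
    Lp.coeFn_smul ke C, Lp.coeFn_add A B, coeFn_mulL (l • dHC + trace 1 V) (ρ.1 1),
    coeFn_mulL (trace 0 ρ) (radialLap V),
    coeFn_mulL (hOp a hb (trace 1 V + l • dHC) * eC l) (R.1 0), ae_mem_shell,
    radialDiv_ae (hρ.mul hfield), radialDiv_ae hV, coeFn_radialLap V,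
    ae_differentiableAt_of_ac hρ.ac, ae_differentiableAt_of_ac hV.ac, ρ.deriv_rep 0,
    R.rep_ae 0] with x h1 h2 h3 h4 h5 h6 h7 h8 h9 h10 h11 d1 d2 e1 e2
  have hx := Ioo_subset_Icc_self h8
  have hx0 : x ≠ 0 := by have := h8.1; positivity
  -- This derivative cancels the contribution `2 H' / r = 4 / r³` of the radial divergence.
  have t2 : HasDerivAt dH (-(4 / x ^ 3)) x := by
    have := ((hasDerivAt_pow 2 x).inv (pow_ne_zero 2 hx0)).const_mul 2
    convert! this using 1; field_simp; norm_num
  have key : deriv (fun s => ρ.rep 0 s * (V.rep 1 s + l * dH s)) x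
      = deriv (ρ.rep 0) x * (V.rep 1 x + l * dH x)
        + ρ.rep 0 x * (deriv (V.rep 1) x + l * -(4 / x ^ 3)) :=
    (d1.hasDerivAt.mul (d2.hasDerivAt.add (t2.const_mul l))).deriv
  rw [h1, Pi.sub_apply, h2, h3, Pi.smul_apply, Pi.smul_apply, h4, Pi.add_apply, h5, h6, h7, h11,
    h10]
  simp only [F₁fun, smul_eq_mul]
  rw [h9, key, e1, CI.ext_mul, ext_hOp, CI.ext_add, CI.ext_add, CI.ext_smul, ext_eC l hx,
    ext_dHC hx, ext_trace 1 V hx, ext_trace 0 ρ hx, e2]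
  change ki * ((l * dH x + V.rep 1 x) * ρ.1 1 x + _) - ke * (_ * R.1 0 x) = ki * (ρ.1 1 x * _ + _
    + _) - _ * R.1 0 x
  unfold dH
  field_simp
  ring

/-- At zero field perturbation, `λ² |H'|² / 4 - h(λ H')` is `-g(λ H')`, the zero-order coefficient
of the linear part. Every other term with `R` or `R'`, apart from the Laplacian of `R`, contains `V`
or an increment of `h`. -/
theorem coeFn_add_rem₂ (a : ℝ) {b : ℝ} (hb : 0 < b) (l : ℝ) (u : X) :
    (-radialLap u.1.2.1 - mulL (gC a hb l) (u.1.2.1.1 0)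
      + rem₂ a hb l u.1.2.1 u.1.2.2 : L2) =ᵐ[shellMeasure] F₂fun a b l u := by
  obtain ⟨⟨ρ, R, V⟩, hu⟩ := u
  have hV := V.isH1_rep 1
  have hR := R.isH1_rep 1
  set w : CI := (l / 2) • (dHC * trace 1 V) - (hOp a hb (trace 1 V + l • dHC) - hC a hb l) with hw
  have e : (-radialLap R - mulL (gC a hb l) (R.1 0) + rem₂ a hb l R V : L2)
      = -radialLap R - mulL (trace 1 V) (R.1 1)
        + mulL ((l / 2) • (dHC * trace 1 V) - hOp a hb (trace 1 V + l • dHC)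
          + (l ^ 2 / 4) • (dHC * dHC)) (R.1 0) - mulL (trace 0 R) (radialLap V) := by
    have e1 : rem₂ a hb l R V = mulL (-trace 1 V) (R.1 1) + mulL w (R.1 0)
      - mulL (trace 0 R) (radialLap V) := rfl
    have e2 : (l / 2) • (dHC * trace 1 V) - hOp a hb (trace 1 V + l • dHC)
          + (l ^ 2 / 4) • (dHC * dHC) = w - gC a hb l := by rw [hw, gC]; abel
    rw [e1, e2, mulL_sub_left w (gC a hb l), mulL_neg_left]
    clear_value w
    abel
  change (-radialLap R - mulL (gC a hb l) (R.1 0) + rem₂ a hb l R V : L2) =ᵐ[shellMeasure] _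
  rw [e]
  set A : L2 := mulL (trace 1 V) (R.1 1) with hA
  set c : CI := (l / 2) • (dHC * trace 1 V) - hOp a hb (trace 1 V + l • dHC)
          + (l ^ 2 / 4) • (dHC * dHC) with hc
  set B : L2 := mulL c (R.1 0) with hB
  set C : L2 := mulL (trace 0 R) (radialLap V) with hC
  filter_upwards [Lp.coeFn_sub (-radialLap R - A + B) C, Lp.coeFn_add (-radialLap R - A) B,
    Lp.coeFn_sub (-radialLap R) A, Lp.coeFn_neg (radialLap R), coeFn_mulL (trace 1 V) (R.1 1),
    coeFn_mulL c (R.1 0), coeFn_mulL (trace 0 R) (radialLap V), coeFn_radialLap V,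
    coeFn_radialLap R, R.rep_ae 0, R.rep_ae 1, ae_mem_shell]
    with x h1 h2 h3 h4 h5 h6 h7 h8 h9 e1 e2 h10
  have hx := Ioo_subset_Icc_self h10
  rw [h1, Pi.sub_apply, h2, Pi.add_apply, h3, Pi.sub_apply, h4, Pi.neg_apply, h5, h6, h7, h8, h9]
  simp only [F₂fun]
  rw [hc, CI.ext_add, CI.ext_sub, CI.ext_smul, CI.ext_smul, CI.ext_mul, CI.ext_mul, ext_hOp,
    CI.ext_add, CI.ext_smul, ext_dHC hx, ext_trace 1 V hx, ext_trace 0 R hx, e1, e2, sq_abs]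
  change -_ - V.rep 1 x * R.1 1 x + _ * R.1 0 x - R.1 0 x * _ = -_ - _ * R.1 1 x + _ * R.1 0 x
  ring

/-- The third component is already linear in `u` and has no remainder. Its chosen `H¹` element is
identified through its almost everywhere values. -/
theorem F_eq (a : ℝ) {b : ℝ} (hb : 0 < b) (γ ki ke l : ℝ) (u : X) :
    F a hb γ ki ke l u = ((linX a hb γ ki ke l u).1 + rem₁ a hb ki ke l u.1.1 u.1.2.1 u.1.2.2,
      (linX a hb γ ki ke l u).2.1 + rem₂ a hb l u.1.2.1 u.1.2.2, (linX a hb γ ki ke l u).2.2.1,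
      (linX a hb γ ki ke l u).2.2.2 + rem₄ γ ki ke l u.1.1 u.1.2.1 u.1.2.2) := by
  refine Prod.ext ?_ (Prod.ext ?_ (Prod.ext ?_ ?_))
  · exact toLp_eq_of_ae (memLp_F₁fun ki ke hb l u) (coeFn_add_rem₁ a hb ki ke l u)
  · exact toLp_eq_of_ae (memLp_F₂fun hb l u) (coeFn_add_rem₂ a hb l u)
  · exact Sobolev.ext_of_ae (Lp.ext ((exists_F₃ l u).choose_spec.trans
      (linX_trd a hb γ ki ke l u).symm))
  · change F₄ γ ki ke l u = (linX a hb γ ki ke l u).2.2.2 + rem₄ γ ki ke l u.1.1 u.1.2.1 u.1.2.2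
    rw [linX_fth, rem₄, evalAt_apply, evalAt_apply, evalAt_apply, ext_trace _ _ mem_two,
      ext_trace _ _ mem_two, ext_trace _ _ mem_two]
    simp only [F₄, H_two, dH_two, smul_eq_mul, mul_one]
    ring

theorem hasFDerivAt_F (a : ℝ) {b : ℝ} (hb : 0 < b) (γ ki ke l : ℝ) :
    HasFDerivAt (F a hb γ ki ke l) (linX a hb γ ki ke l) 0 := by
  rw [funext (F_eq a hb γ ki ke l)]
  exact @hasFDerivAt_lin_add_rem a b hb γ ki ke X _ XSubmodule.normedSpace projρ projR projV l

theorem linearization_eq (a : ℝ) {b : ℝ} (hb : 0 < b) (γ ki ke l : ℝ) :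
    linearization a hb γ ki ke l = linX a hb γ ki ke l := (hasFDerivAt_F a hb γ ki ke l).fderiv

theorem differentiableAt_linX (a : ℝ) {b : ℝ} (hb : 0 < b) (γ ki ke : ℝ) {l : ℝ} (hl : 0 < l) :
    DifferentiableAt ℝ (linX a hb γ ki ke) l :=
  @differentiableAt_lin a b hb γ ki ke X _ XSubmodule.normedSpace projρ projR projV l hl

theorem differentiableAt_linearization (a : ℝ) {b : ℝ} (hb : 0 < b) (γ ki ke : ℝ) {l : ℝ}
    (hl : 0 < l) : DifferentiableAt ℝ (fun l => linearization a hb γ ki ke l) l := by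
  rw [funext (linearization_eq a hb γ ki ke)]
  exact differentiableAt_linX a hb γ ki ke hl

/-! ### Green's formula -/

/-- The integral over `(1,2)` of an `L²` function. -/
def int : L2 →L[ℝ] ℝ := (evalAt 2).comp prim

theorem int_apply (v : L2) : int v = ∫ t in (1 : ℝ)..2, v t := ext_prim v mem_two

/-- The integral over `(1,2)` of a continuous function. -/
def intC : CI →L[ℝ] ℝ := int.comp incl

theorem intC_apply (c : CI) : intC c = ∫ t in (1 : ℝ)..2, c.ext t := ext_prim_incl c mem_two

theorem int_incl (c : CI) : int (incl c) = intC c := rfl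

theorem intC_eq_integral (c : CI) {f : ℝ → ℝ} (h : ∀ x ∈ Icc (1 : ℝ) 2, c.ext x = f x) :
    intC c = ∫ t in (1 : ℝ)..2, f t := by
  rw [intC_apply]
  refine intervalIntegral.integral_congr fun x hx => ?_
  rw [uIcc_of_le (by norm_num)] at hx
  exact h x hx

/-- Green's formula: the derivative of `r² (ψ φ' - φ ψ')` is `r² (ψ Δφ - φ Δψ)`. The boundary term
at 1 vanishes, and the factor 4 is `r²` at `r = 2`. -/
theorem int_mulL_radialLap_sub (φ ψ : Sobolev 2) (hφ : φ.rep 0 1 = 0) (hψ : ψ.rep 0 1 = 0) :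
    int (mulL (sqCI * trace 0 ψ) (radialLap φ)) - int (mulL (sqCI * trace 0 φ) (radialLap ψ))
      = 4 * (ψ.rep 0 2 * φ.rep 1 2 - φ.rep 0 2 * ψ.rep 1 2) := by
  have a0 := φ.isH1_rep 0
  have a1 := φ.isH1_rep 1
  have b0 := ψ.isH1_rep 0
  have b1 := ψ.isH1_rep 1
  have hW : IsH1 fun s => s ^ 2 * (ψ.rep 0 s * φ.rep 1 s + -1 * (φ.rep 0 s * ψ.rep 1 s)) :=
    isH1_sq.mul ((b0.mul a1).add ((isH1_const (-1)).mul (a0.mul b1)))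
  have hd : deriv (fun s => s ^ 2 * (ψ.rep 0 s * φ.rep 1 s + -1 * (φ.rep 0 s * ψ.rep 1 s)))
      =ᵐ[shellMeasure] (mulL (sqCI * trace 0 ψ) (radialLap φ)
        - mulL (sqCI * trace 0 φ) (radialLap ψ) : L2) := by
    filter_upwards [Lp.coeFn_sub (mulL (sqCI * trace 0 ψ) (radialLap φ))
        (mulL (sqCI * trace 0 φ) (radialLap ψ)), coeFn_mulL (sqCI * trace 0 ψ) (radialLap φ),
      coeFn_mulL (sqCI * trace 0 φ) (radialLap ψ), coeFn_radialLap φ, coeFn_radialLap ψ,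
      radialDiv_ae a1, radialDiv_ae b1, ae_differentiableAt_of_ac a0.ac,
      ae_differentiableAt_of_ac a1.ac, ae_differentiableAt_of_ac b0.ac,
      ae_differentiableAt_of_ac b1.ac, φ.deriv_rep 0, φ.rep_ae 1, ψ.deriv_rep 0, ψ.rep_ae 1,
      ae_mem_shell] with x h1 h2 h3 h4 h5 h6 h7 d1 d2 d3 d4 e1 e2 e3 e4 h8
    have hx := Ioo_subset_Icc_self h8
    have hx0 : x ≠ 0 := by have := h8.1; positivity
    have key := (hasDerivAt_pow 2 x).mul ((d3.hasDerivAt.mul d2.hasDerivAt).add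
      ((hasDerivAt_const x (-1 : ℝ)).mul (d1.hasDerivAt.mul d4.hasDerivAt)))
    refine (HasDerivAt.deriv (f := fun s => s ^ 2 * (ψ.rep 0 s * φ.rep 1 s
      + -1 * (φ.rep 0 s * ψ.rep 1 s))) key).trans ?_
    rw [h1, Pi.sub_apply, h2, h3, h4, h5, h6, h7, CI.ext_mul, CI.ext_mul, ext_sqCI hx,
      ext_trace 0 φ hx, ext_trace 0 ψ hx]
    have e1' : deriv (φ.rep 0) x = φ.rep 1 x := e1.trans e2.symm
    have e3' : deriv (ψ.rep 0) x = ψ.rep 1 x := e3.trans e4.symm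
    rw [e1', e3']
    simp only [Pi.mul_apply, Pi.add_apply]
    field_simp
    push_cast
    ring
  rw [← map_sub, int_apply, ← intervalIntegral_congr_shell hd mem_two,
    AbsolutelyContinuousOnInterval.integral_deriv_eq_sub hW.ac, hφ, hψ]
  ring

/-! ### The electron system and the adjoint problem in `L²` -/

theorem incl_trace_zero {k : ℕ} (u : Sobolev (k + 1)) : u.1 0 = incl (trace 0 u) := by
  rw [incl_trace]; rfl

theorem eq_zero_of_ae {v : L2} (h : ∀ᵐ x ∂shellMeasure, v x = 0) : v = 0 := by
  apply Lp.ext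
  filter_upwards [h, Lp.coeFn_zero ℝ 2 shellMeasure] with x h1 h2
  rw [h1, h2, Pi.zero_apply]

theorem electron_equation_iff (a : ℝ) {b : ℝ} (hb : 0 < b) {l : ℝ} (hl : 0 < l) (φ : Sobolev 2) :
    (∀ᵐ r ∂volume.restrict (Ioo (1 : ℝ) 2),
      -radialDiv (φ.rep 1) r - g a b (l * dH r) * φ.rep 0 r = 0) ↔
    radialLap φ + mulL (gC a hb l) (φ.1 0) = 0 := by
  have key : ∀ᵐ r ∂shellMeasure, (radialLap φ + mulL (gC a hb l) (φ.1 0) : L2) r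
      = -(-radialDiv (φ.rep 1) r - g a b (l * dH r) * φ.rep 0 r) := by
    filter_upwards [Lp.coeFn_add (radialLap φ) (mulL (gC a hb l) (φ.1 0)), coeFn_radialLap φ,
      coeFn_mulL (gC a hb l) (φ.1 0), φ.rep_ae 0, ae_mem_shell] with r h1 h2 h3 h4 h5
    rw [h1, Pi.add_apply, h2, h3, ext_gC_of_nonneg a hb hl.le (Ioo_subset_Icc_self h5), h4]
    change _ + _ * φ.1 0 r = -(_ - _ * φ.1 0 r)
    ring
  rw [← ae_shellMeasure]
  refine ⟨fun h => eq_zero_of_ae ?_, fun h => ?_⟩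
  · filter_upwards [h, key] with r h1 h2
    rw [h2, h1, neg_zero]
  · filter_upwards [key, Lp.coeFn_zero ℝ 2 shellMeasure] with r h1 h2
    rw [h, h2, Pi.zero_apply] at h1
    linarith

theorem adjoint_equation_iff (a : ℝ) {b : ℝ} (hb : 0 < b) (γ : ℝ) {l : ℝ} (hl : 0 < l)
    (ψ : Sobolev 2) :
    (∀ᵐ r ∂volume.restrict (Ioo (1 : ℝ) 2),
      -radialDiv (ψ.rep 1) r - g a b (l * dH r) * ψ.rep 0 r
      - h a b (l * dH r) * Real.exp (-(l / 2) * H r) * γ * Real.exp (l / 2) * ψ.rep 0 2 = 0) ↔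
    radialLap ψ + mulL (gC a hb l) (ψ.1 0)
      + (γ * Real.exp (l / 2) * ψ.rep 0 2) • incl (hC a hb l * eC l) = 0 := by
  set k : ℝ := γ * Real.exp (l / 2) * ψ.rep 0 2 with hk
  set A : L2 := mulL (gC a hb l) (ψ.1 0) with hA
  have key : ∀ᵐ r ∂shellMeasure, (radialLap ψ + A + k • incl (hC a hb l * eC l) : L2) r
      = -(-radialDiv (ψ.rep 1) r - g a b (l * dH r) * ψ.rep 0 r
      - h a b (l * dH r) * Real.exp (-(l / 2) * H r) * γ * Real.exp (l / 2) * ψ.rep 0 2) := by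
    filter_upwards [Lp.coeFn_add (radialLap ψ + A) (k • incl (hC a hb l * eC l)),
      Lp.coeFn_add (radialLap ψ) A, coeFn_radialLap ψ, Lp.coeFn_smul k (incl (hC a hb l * eC l)),
      coeFn_incl (hC a hb l * eC l),
      coeFn_mulL (gC a hb l) (ψ.1 0), ψ.rep_ae 0, ae_mem_shell] with r h1 h2 h3 h4 h5 h6 h7 h8
    have hr := Ioo_subset_Icc_self h8
    rw [h1, Pi.add_apply, h2, Pi.add_apply, h3, h4, Pi.smul_apply, h5, h6, CI.ext_mul,
      ext_gC_of_nonneg a hb hl.le hr, ext_hC_of_nonneg a hb hl.le hr, ext_eC l hr, h7, hk,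
      smul_eq_mul]
    change _ + _ * ψ.1 0 r + _ = -(_ - _ * ψ.1 0 r - _)
    ring
  rw [← ae_shellMeasure]
  refine ⟨fun h => eq_zero_of_ae ?_, fun h => ?_⟩
  · filter_upwards [h, key] with r h1 h2
    rw [h2, h1, neg_zero]
  · filter_upwards [key, Lp.coeFn_zero ℝ 2 shellMeasure] with r h1 h2
    rw [h, h2, Pi.zero_apply] at h1
    linarith

/-- On `[1,2]`, `r² h(λ H') e^{-λH/2}` equals `2 a λ e^{-λ} · e^{-b r² / (2λ)} e^{λ/r}`, so the
nonlocal term is an integral against the same coefficient as in the ion and adjoint equations. -/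
theorem boundaryB_eq (a : ℝ) {b : ℝ} (hb : 0 < b) (γ : ℝ) {l : ℝ} (hl : 0 < l) (φ : Sobolev 2) :
    boundaryB a b γ l φ = φ.rep 1 2 + l / 4 * φ.rep 0 2
      - γ * Real.exp (l / 2) / 4 * intC (sqCI * (hC a hb l * eC l) * trace 0 φ) := by
  have e : intC (sqCI * (hC a hb l * eC l) * trace 0 φ) = ∫ r in (1 : ℝ)..2,
      (2 * a * l * Real.exp (-l)) *
        (Real.exp (-(b * r ^ 2) / (2 * l)) * Real.exp (l / r) * φ.rep 0 r) := by
    refine intC_eq_integral _ fun r hr => ?_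
    have hr0 : r ≠ 0 := by have := hr.1; positivity
    rw [CI.ext_mul, CI.ext_mul, CI.ext_mul, ext_sqCI hr, ext_hC_of_nonneg a hb hl.le hr,
      ext_eC l hr, ext_trace 0 φ hr]
    have e1 : Real.exp (-(l / 2) * H r) = Real.exp (-l) * Real.exp (l / r) := by
      rw [← Real.exp_add]; congr 1; unfold H; field_simp; ring
    have e2 : -b / (l * dH r) = -(b * r ^ 2) / (2 * l) := by unfold dH; field_simp
    rw [h, e1, e2]
    unfold dH
    field_simp
  rw [boundaryB, e, intervalIntegral.integral_const_mul]
  have e3 : Real.exp (-(l / 2)) = Real.exp (l / 2) * Real.exp (-l) := by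
    rw [← Real.exp_add]; congr 1; ring
  rw [e3]
  ring

/-! ### The solvability condition -/

section

variable (a : ℝ) {b : ℝ} (hb : 0 < b) (γ ki ke : ℝ)

/-- The functional whose kernel is the range of the linearized operator. -/
def solvability (l : ℝ) (ψ : Sobolev 2) : Y →L[ℝ] ℝ :=
  (int.comp (mulL (sqCI * trace 0 ψ))).comp
      ((ContinuousLinearMap.fst ℝ L2 (Sobolev 1 × ℝ)).comp (ContinuousLinearMap.snd ℝ L2 _))
    + (4 * ψ.rep 0 2) • (ContinuousLinearMap.snd ℝ (Sobolev 1) ℝ).comp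
      ((ContinuousLinearMap.snd ℝ L2 (Sobolev 1 × ℝ)).comp (ContinuousLinearMap.snd ℝ L2 _))
    + (γ * Real.exp (l / 2) / ke * ψ.rep 0 2) •
      (int.comp (mulL sqCI)).comp (ContinuousLinearMap.fst ℝ L2 _)

theorem solvability_apply (l : ℝ) (ψ : Sobolev 2) (f : Y) :
    solvability γ ke l ψ f = int (mulL (sqCI * trace 0 ψ) f.2.1) + 4 * ψ.rep 0 2 * f.2.2.2
      + γ * Real.exp (l / 2) / ke * ψ.rep 0 2 * int (mulL sqCI f.1) := rfl

theorem sqCI_mul_dHC : sqCI * dHC = (2 : ℝ) • 1 := by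
  ext x
  have hx : (x : ℝ) ≠ 0 := by linarith [x.2.1]
  rw [← CI.ext_coe, ← CI.ext_coe, CI.ext_mul, CI.ext_smul, CI.ext_one, ext_sqCI x.2, ext_dHC x.2, dH]
  field_simp

theorem mulL_one_left (v : L2) : mulL 1 v = v := by
  apply Lp.ext
  filter_upwards [coeFn_mulL 1 v] with x h1
  rw [h1, CI.ext_one, one_mul]

theorem mulL_smul_left (c : ℝ) (d : CI) (v : L2) : mulL (c • d) v = c • mulL d v := by
  rw [map_smul]; rfl

theorem int_comp_one (u : Sobolev 1) (h : u.rep 0 1 = 0) : int (u.1 1) = u.rep 0 2 := by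
  rw [u.rep_eq 0 mem_two, h, zero_add, int_apply]; rfl

/-- The weight turns `λ H' ρ'` into `2 λ ρ'`, which integrates to `2 λ ρ(2)`. This ties `ρ(2)` to
the nonlocal integral of `R`. -/
theorem int_linX_fst (l : ℝ) (u : X) :
    int (mulL sqCI (linX a hb γ ki ke l u).1) = 2 * l * ki * u.1.1.rep 0 2
      - ke * intC (sqCI * (hC a hb l * eC l) * trace 0 u.1.2.1) := by
  have e1 : mulL sqCI (mulL (l • dHC) (u.1.1.1 1)) = (2 * l) • u.1.1.1 1 := by
    rw [← mulL_mul, mul_smul_comm, sqCI_mul_dHC, smul_smul, mulL_smul_left, mulL_one_left, mul_comm]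
  have e0 : ∀ v w : L2, int (mulL sqCI (ki • v - ke • w))
      = ki * int (mulL sqCI v) - ke * int (mulL sqCI w) := fun v w => by
    simp only [map_sub, map_smul, smul_eq_mul]
  rw [linX_fst, e0, e1, map_smul, int_comp_one u.1.1 u.2.1, incl_trace_zero, ← mulL_mul, ← incl_mul, int_incl]
  simp only [smul_eq_mul]
  ring

/-- The functional stays at the parameter `l` while the operator is taken at `t`. The case `t = l`
shows that the functional kills the range, and differentiation in `t` at `l` tests the mixed
derivative. -/
theorem solvability_linX (l t : ℝ) (ψ : Sobolev 2) (u : X) :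
    solvability γ ke l ψ (linX a hb γ ki ke t u)
      = -int (mulL (sqCI * trace 0 ψ) (radialLap u.1.2.1))
        - intC (sqCI * trace 0 ψ * gC a hb t * trace 0 u.1.2.1)
        + 4 * ψ.rep 0 2 * (u.1.2.1.rep 1 2 + t / 4 * u.1.2.1.rep 0 2
            - γ * (ki / ke) * Real.exp (t / 2) * (t / 2) * u.1.1.rep 0 2)
        + γ * Real.exp (l / 2) / ke * ψ.rep 0 2 * (2 * t * ki * u.1.1.rep 0 2
          - ke * intC (sqCI * (hC a hb t * eC t) * trace 0 u.1.2.1)) := by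
  rw [solvability_apply, int_linX_fst, linX_fth, linX_snd, map_sub, map_neg, map_sub, map_neg,
    incl_trace_zero, ← mulL_mul, ← incl_mul, int_incl]

/-- Eliminating `ρ(2)` with `int_linX_fst` shows that, once the first component vanishes, the fourth
is exactly the boundary condition of the electron system. -/
theorem linX_fth_eq {l : ℝ} (hl : 0 < l) (hke : 0 < ke) (u : X) :
    (linX a hb γ ki ke l u).2.2.2 = boundaryB a b γ l u.1.2.1
      - γ * Real.exp (l / 2) / (4 * ke) * int (mulL sqCI (linX a hb γ ki ke l u).1) := by
  rw [linX_fth, int_linX_fst, boundaryB_eq a hb γ hl]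
  field_simp
  ring

/-- The weight `4 ψ(2)` matches the boundary term of Green's formula once `ψ'(2) = -λ ψ(2) / 4` is
inserted. The weight on the first component cancels `ρ(2)`, and the nonlocal integral it leaves
cancels the source term of the adjoint equation. -/
theorem solvability_linX_self {l : ℝ} (hl : 0 < l) (hke : 0 < ke) {ψ : Sobolev 2}
    (hψ : SolvesAdjoint a b γ l ψ) (u : X) : solvability γ ke l ψ (linX a hb γ ki ke l u) = 0 := by
  obtain ⟨h1, h2, h3⟩ := hψ
  rw [adjoint_equation_iff a hb γ hl] at h1
  have hG := int_mulL_radialLap_sub u.1.2.1 ψ u.2.2.1 h2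
  have e1 : radialLap ψ = -mulL (gC a hb l) (ψ.1 0)
      - (γ * Real.exp (l / 2) * ψ.rep 0 2) • incl (hC a hb l * eC l) := by
    rw [← sub_eq_zero, ← h1]; abel
  rw [e1, map_sub, map_neg, map_smul, map_sub, map_neg, map_smul, incl_trace_zero, ← mulL_mul,
    ← incl_mul, ← incl_mul, int_incl, int_incl] at hG
  have c1 : sqCI * trace 0 u.1.2.1 * gC a hb l * trace 0 ψ
    = sqCI * trace 0 ψ * gC a hb l * trace 0 u.1.2.1 := by ring
  have c2 : sqCI * trace 0 u.1.2.1 * (hC a hb l * eC l)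
    = sqCI * (hC a hb l * eC l) * trace 0 u.1.2.1 := by ring
  rw [c1, c2, smul_eq_mul] at hG
  rw [solvability_linX]
  have h4 : ψ.rep 1 2 = -(l / 4 * ψ.rep 0 2) := by linarith
  rw [h4] at hG
  have h5 : int (mulL (sqCI * trace 0 ψ) (radialLap u.1.2.1)) =
      4 * (ψ.rep 0 2 * u.1.2.1.rep 1 2 - u.1.2.1.rep 0 2 * -(l / 4 * ψ.rep 0 2))
      + (-intC (sqCI * trace 0 ψ * gC a hb l * trace 0 u.1.2.1) -
        γ * Real.exp (l / 2) * ψ.rep 0 2 * intC (sqCI * (hC a hb l * eC l) * trace 0 u.1.2.1)) := by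
    linarith
  rw [h5]
  field_simp
  ring

theorem intC_mul_smul (c : ℝ) (d e : CI) : intC (d * c • e) = c * intC (d * e) := by
  rw [mul_smul_comm, map_smul, smul_eq_mul]

/-- The functional `explicitF` in terms of the coefficient curves. -/
theorem explicitF_eq {l : ℝ} (hl : 0 < l) (φ ψ : Sobolev 2) :
    explicitF a b γ l φ ψ = -γ * Real.exp (l / 2) * (ψ.rep 0 2 * intC (sqCI *
        (deriv (hC a hb) l * eC l + hC a hb l * (eC l * (-(1 / 2 : ℝ) • HC))) * trace 0 φ))
      - intC (sqCI * trace 0 ψ * (deriv (hC a hb) l - (l / 2) • (dHC * dHC)) * trace 0 φ)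
      + ψ.rep 0 2 * (φ.rep 0 2 - 2 * φ.rep 1 2 - l / 2 * φ.rep 0 2) := by
  have e1 : ψ.rep 0 2 * intC (sqCI *
        (deriv (hC a hb) l * eC l + hC a hb l * (eC l * (-(1 / 2 : ℝ) • HC))) * trace 0 φ)
      = ∫ r in (1 : ℝ)..2, r ^ 2 * ψ.rep 0 2 *
        (deriv (h a b) (l * dH r) * dH r - h a b (l * dH r) * (H r / 2)) *
        Real.exp (-(l / 2) * H r) * φ.rep 0 r := by
    rw [← smul_eq_mul, ← map_smul]
    refine intC_eq_integral _ fun r hr => ?_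
    rw [CI.ext_smul, CI.ext_mul, CI.ext_mul, CI.ext_add, CI.ext_mul, CI.ext_mul, CI.ext_mul,
      CI.ext_smul, ext_sqCI hr, ext_deriv_hC a hb hl hr, ext_hC_of_nonneg a hb hl.le hr,
      ext_eC l hr, ext_HC hr, ext_trace 0 φ hr]
    ring
  have e2 : intC (sqCI * trace 0 ψ * (deriv (hC a hb) l - (l / 2) • (dHC * dHC)) * trace 0 φ)
      = ∫ r in (1 : ℝ)..2, r ^ 2 * ψ.rep 0 r * deriv (g a b) (l * dH r) * dH r * φ.rep 0 r := by
    refine intC_eq_integral _ fun r hr => ?_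
    rw [CI.ext_mul, CI.ext_mul, CI.ext_mul, ext_deriv_gC a hb hl hr, ext_sqCI hr,
      ext_trace 0 φ hr, ext_trace 0 ψ hr]
    ring
  rw [explicitF, e1, e2]

theorem explicitF_smul {l : ℝ} (hb : 0 < b) (hl : 0 < l) (c : ℝ) (φ ψ : Sobolev 2) :
    explicitF a b γ l (c • φ) ψ = c * explicitF a b γ l φ ψ := by
  rw [explicitF_eq a hb γ hl, explicitF_eq a hb γ hl, map_smul, Sobolev.rep_smul c φ 0 mem_two,
    Sobolev.rep_smul c φ 1 mem_two, intC_mul_smul, intC_mul_smul]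
  ring

theorem _root_.DifferentiableAt.hasDerivAt_clm_comp_apply {E F : Type*} [NormedAddCommGroup E]
    [NormedSpace ℝ E] [NormedAddCommGroup F] [NormedSpace ℝ F] {f : ℝ → E →L[ℝ] F} {x : ℝ}
    (hf : DifferentiableAt ℝ f x) (S : F →L[ℝ] ℝ) (u : E) :
    HasDerivAt (fun t => S (f t u)) (S (deriv f x u)) x :=
  S.hasFDerivAt.comp_hasDerivAt x
    ((ContinuousLinearMap.apply ℝ F u).hasFDerivAt.comp_hasDerivAt x hf.hasDerivAt)

end

/-! ### The mixed derivative tested against the solvability functional -/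

theorem hasDerivAt_solvability (a : ℝ) {b : ℝ} (hb : 0 < b) (γ ki ke : ℝ) {l : ℝ} (hl : 0 < l)
    (S : Y →L[ℝ] ℝ) (u : X) :
    HasDerivAt (fun t => S (linearization a hb γ ki ke t u))
      (S (mixedDerivative a hb γ ki ke l u)) l :=
  @DifferentiableAt.hasDerivAt_clm_comp_apply X Y _ XSubmodule.normedSpace _ _ _ _
    (differentiableAt_linearization a hb γ ki ke hl) S u

section

variable (a : ℝ) {b : ℝ} (hb : 0 < b) (γ ki ke : ℝ)

/-- Differentiate `solvability_linX` in `t` at `l`; the Laplacian term is constant in `t`. The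
integrals give those of `explicitF`. The derivative of `2 t k_i ρ(2)` cancels one of the two terms
coming from `e^{t/2} t / 2`, and the other becomes `-2 R'(2) - (λ/2) R(2)` by the fourth kernel
equation. -/
theorem solvability_mixedDerivative {l : ℝ} (hl : 0 < l) (hke : 0 < ke)
    (ψ : Sobolev 2) (u : X) (hu : linearization a hb γ ki ke l u = 0) :
    solvability γ ke l ψ (mixedDerivative a hb γ ki ke l u) = explicitF a b γ l u.1.2.1 ψ := by
  have h2 := hasDerivAt_solvability a hb γ ki ke hl (solvability γ ke l ψ) u
  simp only [linearization_eq, solvability_linX a hb γ ki ke l _ ψ u] at h2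
  have hg := hasDerivAt_gC a hb hl
  have hh := (differentiableAt_hC a hb hl).hasDerivAt.mul (hasDerivAt_eC l)
  have k1 := intC.hasFDerivAt.comp_hasDerivAt l
    ((hg.const_mul (sqCI * trace 0 ψ)).mul_const (trace 0 u.1.2.1))
  have k2 := intC.hasFDerivAt.comp_hasDerivAt l ((hh.const_mul sqCI).mul_const (trace 0 u.1.2.1))
  have k3 : HasDerivAt (fun t : ℝ => u.1.2.1.rep 1 2 + t / 4 * u.1.2.1.rep 0 2
      - γ * (ki / ke) * Real.exp (t / 2) * (t / 2) * u.1.1.rep 0 2)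
      (1 / 4 * u.1.2.1.rep 0 2 - γ * (ki / ke) * (Real.exp (l / 2) * (1 / 2) * (l / 2)
        + Real.exp (l / 2) * (1 / 2)) * u.1.1.rep 0 2) l := by
    have i1 := ((hasDerivAt_id l).div_const 4).mul_const (u.1.2.1.rep 0 2)
    have i2 := ((hasDerivAt_id l).div_const 2)
    have i3 := (((i2.exp.mul i2).const_mul (γ * (ki / ke))).mul_const (u.1.1.rep 0 2))
    have := (i1.const_add (u.1.2.1.rep 1 2)).sub i3
    convert! this using 1
    ext t
    simp only [Pi.sub_apply, Pi.mul_apply, id]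
    ring
  have k4 : HasDerivAt (fun t : ℝ => 2 * t * ki * u.1.1.rep 0 2) (2 * ki * u.1.1.rep 0 2) l := by
    have := (((hasDerivAt_id l).const_mul 2).mul_const ki).mul_const (u.1.1.rep 0 2)
    simpa using this
  have k5 := (((hasDerivAt_const l
    (-int (mulL (sqCI * trace 0 ψ) (radialLap u.1.2.1)))).sub k1).add
    (k3.const_mul (4 * ψ.rep 0 2))).add
    ((k4.sub (k2.const_mul ke)).const_mul (γ * Real.exp (l / 2) / ke * ψ.rep 0 2))
  rw [h2.unique k5, explicitF_eq a hb γ hl]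
  have hB := linX_fth a hb γ ki ke l u
  rw [← linearization_eq, hu] at hB
  have hB' : 0 = u.1.2.1.rep 1 2 + l / 4 * u.1.2.1.rep 0 2
      - γ * (ki / ke) * Real.exp (l / 2) * (l / 2) * u.1.1.rep 0 2 := hB
  set I1 := intC (sqCI * trace 0 ψ * (deriv (hC a hb) l - (l / 2) • (dHC * dHC))
    * trace 0 u.1.2.1)
  set I2 := intC (sqCI * (deriv (hC a hb) l * eC l + hC a hb l * (eC l * (-(1 / 2 : ℝ) • HC)))
    * trace 0 u.1.2.1)
  have hR : u.1.2.1.rep 1 2 = -(l / 4 * u.1.2.1.rep 0 2)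
      + γ * (ki / ke) * Real.exp (l / 2) * (l / 2) * u.1.1.rep 0 2 := by linarith
  rw [hR]
  field_simp
  ring

end

/-! ### Homogeneous solutions -/

theorem eq_zero_of_trace_one {u : Sobolev 2} (h0 : u.rep 0 1 = 0) (h1 : trace 1 u = 0) : u = 0 :=
  Sobolev.ext_trace (by rw [trace_zero_eq_primC h0, h1, map_zero, map_zero])

theorem trace_one_eq_smul_fundamental {u : Sobolev 2} {q : CI} (h0 : u.rep 0 1 = 0)
    (h : radialLap u + mulL q (u.1 0) = 0) : trace 1 u = u.rep 1 1 • fundamental q := by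
  refine eq_smul_fundamental ?_
  have := volterra_of_radialLap (f := 0) h0 (by rw [add_zero]; exact h)
  rwa [map_zero, sub_zero] at this

theorem eq_zero_of_initial_data {u : Sobolev 2} {q : CI} (h0 : u.rep 0 1 = 0)
    (h : radialLap u + mulL q (u.1 0) = 0) {r : ℝ} (hr : r ∈ Icc (1 : ℝ) 2)
    (z0 : u.rep 0 r = 0) (z1 : u.rep 1 r = 0) : u = 0 := by
  have h1 := volterra_of_radialLap (f := 0) h0 (by rw [add_zero]; exact h)
  rw [map_zero, sub_zero] at h1
  refine eq_zero_of_trace_one h0 (eq_zero_of_initial_zero h1 hr ?_ ?_)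
  · rw [← trace_zero_eq_primC h0, ext_trace 0 u hr, z0]
  · rw [ext_trace 1 u hr, z1]

/-- Both functions are fixed by their derivatives at 1, and the factor is the ratio of these. The
denominator is nonzero since `v ≠ 0`. -/
theorem exists_smul_of_homogeneous {u v : Sobolev 2} {q : CI} (hu0 : u.rep 0 1 = 0)
    (hu : radialLap u + mulL q (u.1 0) = 0) (hv0 : v.rep 0 1 = 0)
    (hv : radialLap v + mulL q (v.1 0) = 0) (hv1 : v ≠ 0) : ∃ c : ℝ, u = c • v := by
  have h1 := trace_one_eq_smul_fundamental hu0 hu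
  have h2 := trace_one_eq_smul_fundamental hv0 hv
  have h3 : v.rep 1 1 ≠ 0 := fun h => hv1 (eq_zero_of_trace_one hv0 (by rw [h2, h, zero_smul]))
  refine ⟨u.rep 1 1 / v.rep 1 1, Sobolev.ext_trace ?_⟩
  rw [map_smul, trace_zero_eq_primC hu0, trace_zero_eq_primC hv0, h1, h2, map_smul, map_smul,
    smul_smul, div_mul_cancel₀ _ h3]

theorem rep_eq_zero_of_trace_eq_primC {k : ℕ} {u : Sobolev (k + 1)} {y : CI}
    (h : trace 0 u = primC y) : u.rep 0 1 = 0 := by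
  rw [← ext_trace 0 u mem_one, h, ext_primC_one]

/-- Existence for the initial value problem with zero data at `r = 1`. -/
theorem exists_inhomogeneous (q : CI) (f : L2) :
    ∃ u : Sobolev 2, u.rep 0 1 = 0 ∧ radialLap u + mulL q (u.1 0) + f = 0 := by
  obtain ⟨y, hy⟩ := exists_volterra_solution q (-prim f)
  obtain ⟨u, h1, -, h3⟩ := exists_radial_solution (c := 0) (f := f) (by
    rw [hy, zero_smul, zero_sub])
  exact ⟨u, rep_eq_zero_of_trace_eq_primC h1, h3⟩

/-- Existence for the Dirichlet problem of the radial Laplacian. -/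
theorem exists_dirichlet (f : L2) :
    ∃ u : Sobolev 2, u.rep 0 1 = 0 ∧ u.rep 0 2 = 0 ∧ radialLap u = f := by
  obtain ⟨y, hy⟩ := exists_volterra_solution 0 (-prim (-f))
  -- Adding `c (1 - 1 / r)` must cancel the value at `r = 2`, where `1 - 1 / r` equals `1 / 2`.
  set c : ℝ := -(2 * (primC y).ext 2) with hc
  obtain ⟨u, h1, -, h3⟩ := exists_radial_solution (q := 0) (y := y + c • fundamental 0) (f := -f)
    (c := c) (by
      rw [map_add, map_smul, add_add_add_comm, hy, ← smul_add, fundamental_eq]; abel)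
  refine ⟨u, rep_eq_zero_of_trace_eq_primC h1, ?_, ?_⟩
  · rw [← ext_trace 0 u mem_two, h1, map_add, map_smul, fundamental_zero, CI.ext_add, CI.ext_smul,
      primC_invSq_two, hc]
    ring
  · rw [map_zero] at h3
    have h4 : radialLap u + 0 + -f = 0 := h3
    rw [add_zero] at h4
    exact add_neg_eq_zero.1 h4

/-- Uniqueness for the Dirichlet problem of the radial Laplacian. -/
theorem eq_zero_of_dirichlet {u : Sobolev 2} (h1 : u.rep 0 1 = 0) (h2 : u.rep 0 2 = 0)
    (h : radialLap u = 0) : u = 0 := by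
  have h3 := trace_one_eq_smul_fundamental (q := 0) h1 (by
    rw [map_zero]; exact (add_zero _).trans h)
  have h4 : u.rep 1 1 = 0 := by
    rw [← ext_trace 0 u mem_two, trace_zero_eq_primC h1, h3, map_smul, fundamental_zero,
      CI.ext_smul, primC_invSq_two] at h2
    linarith
  exact eq_zero_of_trace_one h1 (by rw [h3, h4, zero_smul])

theorem Sobolev.exists_extend (u : Sobolev 2) (z : Sobolev 1) (h : z.1 0 = u.1 2) :
    ∃ v : Sobolev 3, v.1 0 = u.1 0 ∧ v.1 1 = u.1 1 ∧ v.1 2 = u.1 2 := by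
  refine ⟨⟨WithLp.toLp 2 ![u.1 0, u.1 1, u.1 2, z.1 1], fun j => ?_⟩, rfl, rfl, rfl⟩
  fin_cases j
  · exact u.2 0
  · exact u.2 1
  · have := z.2 0
    change HasWeakDeriv (z.1 0) (z.1 1) at this
    rw [h] at this
    exact this

theorem Sobolev.exists_truncate (v : Sobolev 3) :
    ∃ u : Sobolev 2, v.1 0 = u.1 0 ∧ v.1 1 = u.1 1 ∧ v.1 2 = u.1 2 := by
  refine ⟨⟨WithLp.toLp 2 ![v.1 0, v.1 1, v.1 2], fun j => ?_⟩, rfl, rfl, rfl⟩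
  fin_cases j
  · exact v.2 0
  · exact v.2 1

theorem rep_eq_of_ae {k m : ℕ} {u : Sobolev (k + 1)} {v : Sobolev (m + 1)} (h : u.1 0 = v.1 0)
    {x : ℝ} (hx : x ∈ Icc (1 : ℝ) 2) : u.rep 0 x = v.rep 0 x := by
  have : trace 0 u = trace 0 v := incl_injective (by rw [← incl_trace_zero, ← incl_trace_zero, h])
  rw [← ext_trace 0 u hx, this, ext_trace 0 v hx]

/-- Existence for the Dirichlet problem in `H³`. -/
theorem exists_dirichlet_third (w : Sobolev 1) :
    ∃ V : Sobolev 3, V.rep 0 1 = 0 ∧ V.rep 0 2 = 0 ∧ radialLap V = w.1 0 := by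
  obtain ⟨u, h1, h2, h3⟩ := exists_dirichlet (w.1 0)
  -- The equation itself gives `u'' = w - 2 u' / r`, which lies in `H¹`, so the `H²` solution is in
  -- `H³`.
  have hf : IsH1 fun s => w.rep 0 s + -1 * (2 / s * u.rep 1 s) :=
    (w.isH1_rep 0).add ((isH1_const (-1)).mul (isH1_two_div.mul (u.isH1_rep 1)))
  obtain ⟨z, hz⟩ := hf.exists_sobolev
  have e : z.1 0 = u.1 2 := by
    apply Lp.ext
    filter_upwards [hz, w.rep_ae 0, u.rep_ae 1, coeFn_mulL twoDiv (u.1 1),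
      Lp.coeFn_add (u.1 2) (mulL twoDiv (u.1 1)), ae_mem_shell] with x e1 e2 e3 e4 e5 e6
    rw [e1, e2, e3]
    have e7 : (w.1 0 : ℝ → ℝ) x = u.1 2 x + 2 / x * u.1 1 x := by
      rw [← h3, radialLap, e5, Pi.add_apply, e4, ext_twoDiv (Ioo_subset_Icc_self e6)]
    change w.1 0 x + -1 * (2 / x * u.1 1 x) = u.1 2 x
    rw [e7]; ring
  obtain ⟨V, v0, v1, v2⟩ := u.exists_extend z e
  refine ⟨V, (rep_eq_of_ae v0 mem_one).trans h1, (rep_eq_of_ae v0 mem_two).trans h2, ?_⟩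
  rw [← h3, radialLap, radialLap, v1, v2]

/-- Uniqueness for the Dirichlet problem in `H³`. -/
theorem eq_zero_of_dirichlet_third {V : Sobolev 3} (h1 : V.rep 0 1 = 0) (h2 : V.rep 0 2 = 0)
    (h : radialLap V = 0) : V = 0 := by
  obtain ⟨u, v0, v1, v2⟩ := V.exists_truncate
  have : u = 0 := eq_zero_of_dirichlet ((rep_eq_of_ae v0 mem_one).symm.trans h1)
    ((rep_eq_of_ae v0 mem_two).symm.trans h2) (by
      rw [← h, radialLap, radialLap, v1, v2])
  refine Sobolev.ext_of_ae ?_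
  rw [v0, this]; rfl

/-! ### The range of the linearized operator -/

section

variable (a : ℝ) {b : ℝ} (hb : 0 < b) (γ ki ke : ℝ)

theorem mulL_sqCI_mulL_dHC (l : ℝ) (v : L2) : mulL (l • dHC) (mulL sqCI v) = (2 * l) • v := by
  rw [← mulL_mul, smul_mul_assoc, mul_comm dHC, sqCI_mul_dHC, smul_smul, mulL_smul_left,
    mulL_one_left, mul_comm]

/-- The triangular structure: for prescribed `R`, the first component determines `ρ'`, then the
third is a Dirichlet problem for `V`. No condition on `R` beyond `R(1) = 0` arises. -/
theorem exists_linX_first_third {l : ℝ} (hl : 0 < l) (hki : 0 < ki) (R : Sobolev 2)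
    (hR : R.rep 0 1 = 0) (f₁ : L2) (f₃ : Sobolev 1) :
    ∃ u : X, u.1.2.1 = R ∧ (linX a hb γ ki ke l u).1 = f₁ ∧
      (linX a hb γ ki ke l u).2.2.1 = f₃ := by
  set d : L2 := f₁ + ke • mulL (hC a hb l * eC l) (R.1 0) with hd
  -- This solves `k_i λ H' ρ' = d` with `ρ(1) = 0`, where division by `H'` is multiplication by `r²
  -- / 2`.
  set ρ : Sobolev 1 := ofDeriv (0, (2 * l * ki)⁻¹ • mulL sqCI d) with hρ
  have hρ1 : ρ.rep 0 1 = 0 := by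
    rw [← ext_trace 0 ρ mem_one, hρ, trace_ofDeriv, zero_smul, zero_add, ext_prim_one]
  have hw : IsH1 fun s => f₃.rep 0 s + (ρ.rep 0 s + -1 * (Real.exp (-(l / 2) * H s) * R.rep 0 s)) :=
    (f₃.isH1_rep 0).add ((ρ.isH1_rep 0).add
      ((isH1_const (-1)).mul ((isH1_exp l).mul (R.isH1_rep 0))))
  obtain ⟨w, hw⟩ := hw.exists_sobolev
  obtain ⟨V, hV1, hV2, hV⟩ := exists_dirichlet_third w
  refine ⟨⟨(ρ, R, V), hρ1, hR, hV1, hV2⟩, rfl, ?_, ?_⟩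
  · rw [linX_fst]
    change ki • mulL (l • dHC) (ρ.1 1) - ke • mulL (hC a hb l * eC l) (R.1 0) = f₁
    have h1 : ρ.1 1 = (2 * l * ki)⁻¹ • mulL sqCI d := rfl
    have h2 : ki * (2 * l * ki)⁻¹ * (2 * l) = 1 := by field_simp
    rw [h1, map_smul, mulL_sqCI_mulL_dHC, smul_smul, smul_smul, h2, one_smul, hd]
    abel
  · refine Sobolev.ext_of_ae (Lp.ext ((linX_trd a hb γ ki ke l _).trans ?_))
    filter_upwards [coeFn_radialLap V, hw, f₃.rep_ae 0] with x h1 h2 h3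
    simp only [F₃fun]
    rw [← h1, hV, h2, h3]
    change f₃.1 0 x + _ - _ + _ = f₃.1 0 x
    ring

/-- If `ψ(2) = 0`, the source term disappears and the boundary condition gives `ψ'(2) = 0`. Zero
Cauchy data at 2 then force `ψ = 0`. -/
theorem adjoint_rep_two_ne_zero {l : ℝ} (hl : 0 < l) {ψ : Sobolev 2} (h0 : ψ ≠ 0)
    (hb : 0 < b) (hψ : SolvesAdjoint a b γ l ψ) : ψ.rep 0 2 ≠ 0 := by
  intro h
  obtain ⟨h1, h2, h3⟩ := hψ
  rw [adjoint_equation_iff a hb γ hl, h, mul_zero, zero_smul, add_zero] at h1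
  exact h0 (eq_zero_of_initial_data h2 h1 mem_two h (by rw [h] at h3; linarith))

/-- For the converse, the first three components are solved with `R` from an initial value problem
at 1. The functional vanishes both on `f` and on the image found, so their fourth components differ
by a number annihilated by `4 ψ(2) ≠ 0`. -/
theorem mem_range_linX_iff {l : ℝ} (hl : 0 < l) (hki : 0 < ki) (hke : 0 < ke) {ψ : Sobolev 2}
    (h0 : ψ ≠ 0) (hψ : SolvesAdjoint a b γ l ψ) (f : Y) :
    f ∈ Set.range (linX a hb γ ki ke l) ↔ solvability γ ke l ψ f = 0 := by
  refine ⟨?_, fun hf => ?_⟩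
  · rintro ⟨u, rfl⟩
    exact solvability_linX_self a hb γ ki ke hl hke hψ u
  · obtain ⟨R, hR0, hR⟩ := exists_inhomogeneous (gC a hb l) f.2.1
    obtain ⟨u, rfl, h1, h3⟩ := exists_linX_first_third a hb γ ki ke hl hki R hR0 f.1 f.2.2.1
    have h2 : (linX a hb γ ki ke l u).2.1 = f.2.1 := by
      rw [linX_snd, ← sub_eq_zero, ← neg_eq_zero, ← hR]; abel
    have h4 := solvability_linX_self a hb γ ki ke hl hke hψ u
    rw [← hf, solvability_apply, solvability_apply, h1, h2] at h4
    have h5 : 4 * ψ.rep 0 2 ≠ 0 := mul_ne_zero (by norm_num) (adjoint_rep_two_ne_zero a γ hl h0 hb hψ)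
    have h6 : (linX a hb γ ki ke l u).2.2.2 = f.2.2.2 := mul_left_cancel₀ h5 (by linarith)
    exact ⟨u, Prod.ext h1 (Prod.ext h2 (Prod.ext h3 h6))⟩

theorem transversal_iff {l : ℝ} (hl : 0 < l) (hki : 0 < ki) (hke : 0 < ke) {ψ : Sobolev 2}
    (h0 : ψ ≠ 0) (hψ : SolvesAdjoint a b γ l ψ) (u : X)
    (hu : linearization a hb γ ki ke l u = 0) :
    Transversal a hb γ ki ke l u ↔ explicitF a b γ l u.1.2.1 ψ ≠ 0 := by
  rw [Transversal, linearization_eq, mem_range_linX_iff a hb γ ki ke hl hki hke h0 hψ,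
    solvability_mixedDerivative a hb γ ki ke hl hke ψ u hu]

/-- If `R = 0`, the first equation gives `ρ' = 0`, hence `ρ = 0`. Then `V` is harmonic with zero
boundary values and vanishes too. -/
theorem electron_ne_zero_of_kernel {l : ℝ} (hl : 0 < l) (hki : 0 < ki) {u : X} (h0 : u ≠ 0)
    (hu : linX a hb γ ki ke l u = 0) : u.1.2.1 ≠ 0 := by
  intro hR
  apply h0
  have h1 : (linX a hb γ ki ke l u).1 = 0 := by rw [hu]; rfl
  have h3 : (linX a hb γ ki ke l u).2.2.1 = 0 := by rw [hu]; rfl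
  have hR0 : u.1.2.1.1 0 = 0 := by rw [hR]; rfl
  have hρ1 : u.1.1.1 1 = 0 := by
    rw [linX_fst, hR0, map_zero, smul_zero, sub_zero] at h1
    have h2 := (smul_eq_zero.1 h1).resolve_left hki.ne'
    have h4 : mulL sqCI (mulL (l • dHC) (u.1.1.1 1)) = (2 * l) • u.1.1.1 1 := by
      rw [← mulL_mul, mul_smul_comm, sqCI_mul_dHC, smul_smul, mulL_smul_left, mulL_one_left,
        mul_comm]
    rw [h2, map_zero] at h4
    exact (smul_eq_zero.1 h4.symm).resolve_left (by positivity)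
  have hρ : u.1.1 = 0 := by
    rw [u.1.1.eq_ofDeriv, u.2.1, hρ1]; exact map_zero ofDeriv
  have hρ0 : u.1.1.1 0 = 0 := by rw [hρ]; rfl
  have hV : u.1.2.2 = 0 := by
    refine eq_zero_of_dirichlet_third u.2.2.2.1 u.2.2.2.2 (eq_zero_of_ae ?_)
    have h5 := linX_trd a hb γ ki ke l u
    rw [h3] at h5
    filter_upwards [h5, coeFn_radialLap u.1.2.2, u.1.1.rep_ae 0, u.1.2.1.rep_ae 0,
      Lp.coeFn_zero ℝ 2 shellMeasure] with x e1 e2 e3 e4 e5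
    have e6 : (0 : L2) x = F₃fun l u x := e1
    have e3' : u.1.1.rep 0 x = 0 := by rw [e3]; change u.1.1.1 0 x = 0; rw [hρ0, e5]; rfl
    have e4' : u.1.2.1.rep 0 x = 0 := by rw [e4]; change u.1.2.1.1 0 x = 0; rw [hR0, e5]; rfl
    simp only [F₃fun] at e6
    rw [e5, ← e2, e3', e4', Pi.zero_apply] at e6
    linarith
  exact Subtype.ext (Prod.ext hρ (Prod.ext hR hV))

theorem kernel_electron_equation {l : ℝ} {u : X} (hu : linX a hb γ ki ke l u = 0) :
    radialLap u.1.2.1 + mulL (gC a hb l) (u.1.2.1.1 0) = 0 := by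
  have h2 : (linX a hb γ ki ke l u).2.1 = 0 := by rw [hu]; rfl
  rw [linX_snd] at h2
  rw [← neg_eq_zero, ← h2]; abel

theorem electron_ne_zero {l : ℝ} {φ : Sobolev 2} (hφ : SolvesElectronSystem a b γ l φ) :
    φ ≠ 0 := by
  rintro rfl
  have h1 := hφ.2.2.1 (3 / 2) (by norm_num)
  rw [Sobolev.rep_zero 0 (by norm_num : (3 / 2 : ℝ) ∈ Icc (1 : ℝ) 2)] at h1
  exact lt_irrefl _ h1

/-- The electron component of the kernel is one-dimensional. -/
theorem exists_smul_electron {l : ℝ} (hl : 0 < l) (hki : 0 < ki) {u : X} (h0 : u ≠ 0)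
    (hu : linX a hb γ ki ke l u = 0) {φ : Sobolev 2} (hφ : SolvesElectronSystem a b γ l φ) :
    ∃ c : ℝ, c ≠ 0 ∧ u.1.2.1 = c • φ := by
  obtain ⟨c, hc⟩ := exists_smul_of_homogeneous u.2.2.1 (kernel_electron_equation a hb γ ki ke hu)
    hφ.2.1 ((electron_equation_iff a hb hl φ).1 hφ.1) (electron_ne_zero a γ hφ)
  refine ⟨c, ?_, hc⟩
  rintro rfl
  exact electron_ne_zero_of_kernel a hb γ ki ke hl hki h0 hu (by rw [hc, zero_smul])

/-- Complete `φ` to a triple by solving the first and third equations with zero right-hand side. The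
second is the electron equation and the fourth reduces to `boundaryB = 0`. -/
theorem exists_kernel {l : ℝ} (hl : 0 < l) (hki : 0 < ki) (hke : 0 < ke) {φ : Sobolev 2}
    (hφ : SolvesElectronSystem a b γ l φ) :
    ∃ u : X, u ≠ 0 ∧ linX a hb γ ki ke l u = 0 ∧ SolvesElectronSystem a b γ l u.1.2.1 := by
  obtain ⟨u, rfl, h1, h3⟩ := exists_linX_first_third a hb γ ki ke hl hki φ hφ.2.1 0 0
  refine ⟨u, ?_, Prod.ext h1 (Prod.ext ?_ (Prod.ext h3 ?_)), hφ⟩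
  · rintro rfl
    exact electron_ne_zero a γ hφ rfl
  · change (linX a hb γ ki ke l u).2.1 = 0
    rw [linX_snd, ← neg_eq_zero, ← (electron_equation_iff a hb hl u.1.2.1).1 hφ.1]
    abel
  · change (linX a hb γ ki ke l u).2.2.2 = 0
    rw [linX_fth_eq a hb γ ki ke hl hke, h1, hφ.2.2.2, map_zero, map_zero]
    ring

/-- Try `ψ = c φ + s p`, where `p(1) = 0` and `p` solves the equation with the source in which
`ψ(2)` is replaced by 1. The source requires `s = ψ(2)` and the condition at 2 requires `c β + s δ =
0`. Green's formula and `boundaryB = 0` make this homogeneous system singular. -/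
theorem exists_adjoint (hb : 0 < b) {l : ℝ} (hl : 0 < l) {φ : Sobolev 2}
    (hφ : SolvesElectronSystem a b γ l φ) : ∃ ψ : Sobolev 2, ψ ≠ 0 ∧ SolvesAdjoint a b γ l ψ := by
  set m : CI := hC a hb l * eC l with hm
  obtain ⟨p, hp0, hp⟩ := exists_inhomogeneous (gC a hb l) ((γ * Real.exp (l / 2)) • incl m)
  have hφe := (electron_equation_iff a hb hl φ).1 hφ.1
  have hB := hφ.2.2.2
  rw [boundaryB_eq a hb γ hl, ← hm] at hB
  have hG := int_mulL_radialLap_sub φ p hφ.2.1 hp0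
  have e1 : radialLap φ = -mulL (gC a hb l) (φ.1 0) := eq_neg_of_add_eq_zero_left hφe
  have e2 : radialLap p = -mulL (gC a hb l) (p.1 0) - (γ * Real.exp (l / 2)) • incl m := by
    rw [← sub_eq_zero, ← hp]; abel
  rw [e1, e2, map_sub, map_neg, map_neg, map_smul, map_sub, map_neg, map_neg, map_smul,
    incl_trace_zero φ, incl_trace_zero p, ← mulL_mul, ← mulL_mul, ← incl_mul, ← incl_mul,
    ← incl_mul, int_incl, int_incl, int_incl, smul_eq_mul] at hG
  have c1 : sqCI * trace 0 φ * gC a hb l * trace 0 p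
    = sqCI * trace 0 p * gC a hb l * trace 0 φ := by ring
  have c2 : sqCI * trace 0 φ * m = sqCI * m * trace 0 φ := by ring
  rw [c1, c2] at hG
  set β : ℝ := φ.rep 1 2 + l / 4 * φ.rep 0 2 with hβ
  set δ : ℝ := p.rep 1 2 + l / 4 * p.rep 0 2 with hδ
  -- Vanishing of the determinant of the system for `(c, s)`.
  have hdet : φ.rep 0 2 * δ = (p.rep 0 2 - 1) * β := by
    have : γ * Real.exp (l / 2) * intC (sqCI * m * trace 0 φ) = 4 * β := by linarith
    have h4 : β = p.rep 0 2 * φ.rep 1 2 - φ.rep 0 2 * p.rep 1 2 := by linarith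
    linear_combination (-p.rep 0 2) * hβ + φ.rep 0 2 * hδ + h4
  -- A nonzero kernel vector of the singular matrix: orthogonal to the first row if that row is
  -- nonzero, otherwise to the second row, and arbitrary if both vanish.
  obtain ⟨c, s, hcs, h1, h2⟩ : ∃ c s : ℝ, ¬(c = 0 ∧ s = 0) ∧
      c * φ.rep 0 2 + s * (p.rep 0 2 - 1) = 0 ∧ c * β + s * δ = 0 := by
    by_cases h : φ.rep 0 2 = 0 ∧ p.rep 0 2 - 1 = 0
    · by_cases h' : δ = 0 ∧ β = 0
      · exact ⟨1, 0, by norm_num, by rw [h.1]; ring, by rw [h'.2]; ring⟩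
      · exact ⟨δ, -β, fun hh => h' ⟨hh.1, neg_eq_zero.1 hh.2⟩, by rw [h.1, h.2]; ring, by ring⟩
    · exact ⟨-(p.rep 0 2 - 1), φ.rep 0 2, fun hh => h ⟨hh.2, neg_eq_zero.1 hh.1⟩, by ring, by
        linarith⟩
  have r0 : ∀ x ∈ Icc (1 : ℝ) 2, (c • φ + s • p).rep 0 x = c * φ.rep 0 x + s * p.rep 0 x :=
    fun x hx => by
      rw [Sobolev.rep_add _ _ _ hx, Pi.add_apply, Sobolev.rep_smul _ _ _ hx,
        Sobolev.rep_smul _ _ _ hx]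
  have r1 : (c • φ + s • p).rep 1 2 = c * φ.rep 1 2 + s * p.rep 1 2 := by
    rw [Sobolev.rep_add _ _ _ mem_two, Pi.add_apply, Sobolev.rep_smul _ _ _ mem_two,
        Sobolev.rep_smul _ _ _ mem_two]
  have r2 : (c • φ + s • p).rep 0 2 = s := by rw [r0 2 mem_two]; linarith
  refine ⟨c • φ + s • p, fun h => ?_, (adjoint_equation_iff a hb γ hl _).2 ?_, ?_, ?_⟩
  · have hs : s = 0 := by rw [← r2, h]; exact Sobolev.rep_zero 0 mem_two
    rw [hs, zero_smul, add_zero] at h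
    exact hcs ⟨(smul_eq_zero.1 h).resolve_right (electron_ne_zero a γ hφ), hs⟩
  · have e3 : ∀ v : Sobolev 2, radialLap v = radialLapL 0 v := fun _ => rfl
    have e4 : ∀ v : Sobolev 2, v.1 0 = comp 0 v := fun _ => rfl
    rw [r2, e3, e4, map_add, map_add, map_add, map_smul, map_smul, map_smul, map_smul, map_smul,
      map_smul, ← hm]
    rw [e3, e4] at hp hφe
    have : (γ * Real.exp (l / 2) * s) • incl m = s • ((γ * Real.exp (l / 2)) • incl m) := by
      rw [smul_smul, mul_comm]
    rw [this]
    calc _ = c • (radialLapL 0 φ + mulL (gC a hb l) (comp 0 φ)) + s • (radialLapL 0 p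
          + mulL (gC a hb l) (comp 0 p) + (γ * Real.exp (l / 2)) • incl m) := by module
      _ = 0 := by rw [hp, hφe, smul_zero, smul_zero, add_zero]
  · rw [r0 1 mem_one, hφ.2.1, hp0]; ring
  · rw [r1, r0 2 mem_two]
    linear_combination h2 - c * hβ - s * hδ

end

/-! ### The sparking voltage -/

section

variable (a : ℝ) {b : ℝ} (hb : 0 < b) (γ : ℝ)

/-- The solution of the electron equation with `φ(1) = 0` and `φ'(1) = 1`. -/
def shoot (l : ℝ) : CI := primC (fundamental (gC a hb l))

/-- The boundary expression of the electron system for the solution with `φ'(1) = 1`. -/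
def shootB (l : ℝ) : ℝ :=
  (fundamental (gC a hb l)).ext 2 + l / 4 * (shoot a hb l).ext 2
    - γ * Real.exp (l / 2) / 4 * intC (sqCI * (hC a hb l * eC l) * shoot a hb l)

theorem continuous_shoot : Continuous (shoot a hb) :=
  primC.continuous.comp (continuous_fundamental.comp (continuous_gC a hb))

theorem continuous_shootB : Continuous (shootB a hb γ) := by
  have h1 := continuous_shoot a hb
  have h2 : Continuous fun l => (fundamental (gC a hb l)).ext 2 :=
    (evalAt 2).continuous.comp (continuous_fundamental.comp (continuous_gC a hb))
  have h3 : Continuous fun l => (shoot a hb l).ext 2 := (evalAt 2).continuous.comp h1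
  have h4 : Continuous fun l => intC (sqCI * (hC a hb l * eC l) * shoot a hb l) :=
    intC.continuous.comp ((continuous_const.mul ((continuous_hC a hb).mul continuous_eC)).mul h1)
  unfold shootB
  fun_prop

/-- At `λ = 0` all coefficients vanish, the solution is harmonic with `φ' = r⁻²`, and only `φ'(2) =
1 / 4` survives. Hence the infimum cannot be 0. -/
theorem shootB_zero : shootB a hb γ 0 = 1 / 4 := by
  have h1 : hC a hb 0 = 0 := by
    ext x
    rw [← CI.ext_coe, ← CI.ext_coe, ext_hC a hb 0 x.2, CI.ext_zero]
    simp [h]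
  have h2 : gC a hb 0 = 0 := by rw [gC, h1]; simp
  rw [shootB, h2, h1, fundamental_zero, ext_invSq mem_two]
  simp
  norm_num

theorem shootB_smul {l : ℝ} (hl : 0 < l) {φ : Sobolev 2} (h0 : φ.rep 0 1 = 0)
    (hφ : radialLap φ + mulL (gC a hb l) (φ.1 0) = 0) :
    boundaryB a b γ l φ = φ.rep 1 1 * shootB a hb γ l := by
  have h1 := trace_one_eq_smul_fundamental h0 hφ
  have h2 := trace_zero_eq_primC h0
  rw [boundaryB_eq a hb γ hl, ← ext_trace 0 φ mem_two, ← ext_trace 1 φ mem_two, h2, h1, map_smul,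
    intC_mul_smul, CI.ext_smul, CI.ext_smul, shootB, shoot]
  ring

theorem exists_shoot (l : ℝ) : ∃ φ : Sobolev 2, φ ≠ 0 ∧ φ.rep 0 1 = 0 ∧
    radialLap φ + mulL (gC a hb l) (φ.1 0) = 0 ∧ φ.rep 1 1 = 1 ∧ trace 0 φ = shoot a hb l := by
  obtain ⟨φ, h1, h2, h3⟩ := exists_radial_solution (q := gC a hb l) (f := 0) (c := 1)
    (y := fundamental (gC a hb l)) (by rw [fundamental_eq, map_zero, sub_zero, one_smul])
  have h4 : φ.rep 1 1 = 1 := by rw [← ext_trace 1 φ mem_one, h2, fundamental_one]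
  refine ⟨φ, ?_, rep_eq_zero_of_trace_eq_primC h1, by rwa [add_zero] at h3, h4, h1⟩
  rintro rfl
  rw [Sobolev.rep_zero 1 mem_one] at h4
  exact zero_ne_one h4

theorem hasDerivAt_primC_trace_one (φ : Sobolev 2) {r : ℝ} (hr : r ∈ Ioo (1 : ℝ) 2) :
    HasDerivAt (primC (trace 1 φ)).ext (φ.rep 1 r) r := by
  rw [← ext_trace 1 φ (Ioo_subset_Icc_self hr)]
  exact hasDerivAt_primC _ hr

/-- A nonnegative nonzero solution is positive. -/
theorem pos_of_nonneg {φ : Sobolev 2} {q : CI} (h0 : φ.rep 0 1 = 0)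
    (hφ : radialLap φ + mulL q (φ.1 0) = 0) (hne : φ ≠ 0)
    (hpos : ∀ x ∈ Icc (1 : ℝ) 2, 0 ≤ φ.rep 0 x) {r : ℝ} (hr : r ∈ Ioo (1 : ℝ) 2) :
    0 < φ.rep 0 r := by
  refine (hpos r (Ioo_subset_Icc_self hr)).lt_of_ne fun hz => hne ?_
  have e : ∀ x ∈ Icc (1 : ℝ) 2, (primC (trace 1 φ)).ext x = φ.rep 0 x := fun x hx => by
    rw [← trace_zero_eq_primC h0, ext_trace 0 φ hx]
  -- An interior zero of a nonnegative function is a minimum, so the derivative vanishes there as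
  -- well and uniqueness for Cauchy data applies.
  have hmin : IsLocalMin (primC (trace 1 φ)).ext r := by
    filter_upwards [Ioo_mem_nhds hr.1 hr.2] with t ht
    rw [e r (Ioo_subset_Icc_self hr), ← hz, e t (Ioo_subset_Icc_self ht)]
    exact hpos t (Ioo_subset_Icc_self ht)
  exact eq_zero_of_initial_data h0 hφ (Ioo_subset_Icc_self hr) hz.symm
    (hmin.hasDerivAt_eq_zero (hasDerivAt_primC_trace_one φ hr))

/-- The solution is `φ'(1)` times the shooting solution, which is nonnegative just to the right of 1
because its derivative at 1 is 1. So `φ'(1) ≤ 0` would contradict positivity of `φ`. -/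
theorem rep_one_one_pos {φ : Sobolev 2} {q : CI} (h0 : φ.rep 0 1 = 0)
    (hφ : radialLap φ + mulL q (φ.1 0) = 0) (hpos : ∀ x ∈ Ioo (1 : ℝ) 2, 0 < φ.rep 0 x) :
    0 < φ.rep 1 1 := by
  by_contra! hneg
  have h1 := trace_one_eq_smul_fundamental h0 hφ
  have hev : ∀ᶠ t in nhds (1 : ℝ), 0 < (fundamental q).ext t := by
    refine (fundamental q).continuous_ext.continuousAt.eventually_const_lt ?_
    rw [fundamental_one]; exact one_pos
  obtain ⟨ε, hε, hball⟩ := Metric.eventually_nhds_iff.1 hev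
  set x : ℝ := 1 + min (ε / 2) (1 / 2) with hx
  have m1 : min (ε / 2) (1 / 2) ≤ ε / 2 := min_le_left _ _
  have m2 : min (ε / 2) (1 / 2) ≤ (1 / 2 : ℝ) := min_le_right _ _
  have m0 : 0 < min (ε / 2) (1 / 2 : ℝ) := lt_min (by positivity) (by norm_num)
  have hxI : x ∈ Ioo (1 : ℝ) 2 := ⟨by linarith, by linarith⟩
  have h2 := hpos x hxI
  rw [← ext_trace 0 φ (Ioo_subset_Icc_self hxI), trace_zero_eq_primC h0, h1, map_smul, CI.ext_smul,
    ext_primC _ (Ioo_subset_Icc_self hxI)] at h2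
  have h3 : 0 ≤ ∫ t in (1 : ℝ)..x, (fundamental q).ext t := by
    refine intervalIntegral.integral_nonneg hxI.1.le fun t ht => (hball ?_).le
    rw [Real.dist_eq, abs_of_nonneg (by linarith [ht.1])]
    linarith [ht.2]
  nlinarith

/-- Closed conditions that hold at every voltage for which the electron system is solvable. -/
theorem shoot_of_solves {l : ℝ} (hl : 0 < l) {φ : Sobolev 2}
    (hφ : SolvesElectronSystem a b γ l φ) : shootB a hb γ l = 0 ∧ 0 ≤ shoot a hb l := by
  have he := (electron_equation_iff a hb hl φ).1 hφ.1
  have hc := rep_one_one_pos hφ.2.1 he hφ.2.2.1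
  have hB := hφ.2.2.2
  rw [shootB_smul a hb γ hl hφ.2.1 he] at hB
  refine ⟨(mul_eq_zero.1 hB).resolve_left hc.ne', ?_⟩
  have h1 := trace_zero_eq_primC hφ.2.1
  rw [trace_one_eq_smul_fundamental hφ.2.1 he, map_smul] at h1
  have h2 : ∀ x ∈ Icc (1 : ℝ) 2, 0 ≤ (trace 0 φ).ext x := by
    have := closure_minimal (s := Ioo (1 : ℝ) 2) (t := {x | 0 ≤ (trace 0 φ).ext x})
      (fun x hx => by
        have := (hφ.2.2.1 x hx).le
        rwa [← ext_trace 0 φ (Ioo_subset_Icc_self hx)] at this)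
      (isClosed_le continuous_const (trace 0 φ).continuous_ext)
    rwa [closure_Ioo (by norm_num)] at this
  intro x
  have h3 := h2 x x.2
  rw [h1, CI.ext_smul, CI.ext_coe] at h3
  exact nonneg_of_mul_nonneg_right h3 hc

/-- The strict positivity lost in passing to closed conditions is recovered by `pos_of_nonneg`. -/
theorem solves_of_shoot {l : ℝ} (hl : 0 < l) (h1 : shootB a hb γ l = 0)
    (h2 : 0 ≤ shoot a hb l) : ∃ φ : Sobolev 2, SolvesElectronSystem a b γ l φ := by
  obtain ⟨φ, hne, h0, he, -, ht⟩ := exists_shoot a hb l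
  refine ⟨φ, (electron_equation_iff a hb hl φ).2 he, h0, fun r hr => ?_, ?_⟩
  · refine pos_of_nonneg h0 he hne (fun x hx => ?_) hr
    rw [← ext_trace 0 φ hx, ht, CI.ext_of_mem _ hx]
    exact h2 ⟨x, hx⟩
  · rw [shootB_smul a hb γ hl h0 he, h1, mul_zero]

/-- The sparking voltage is positive, and the electron system is solvable there. -/
theorem sparkingVoltage_spec (hb : 0 < b) (hS : (a, b, γ) ∈ sparkingSet) :
    0 < sparkingVoltage a b γ ∧
      ∃ φ : Sobolev 2, SolvesElectronSystem a b γ (sparkingVoltage a b γ) φ := by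
  set S : Set ℝ := {l | 0 < l ∧ ∃ φ : Sobolev 2, SolvesElectronSystem a b γ l φ} with hSdef
  obtain ⟨l₀, hl₀, φ₀, hφ₀⟩ := hS
  have hmem : sparkingVoltage a b γ ∈ closure S :=
    csInf_mem_closure ⟨l₀, hl₀, φ₀, hφ₀⟩ ⟨0, fun l hl => hl.1.le⟩
  -- The set is taken with `0 ≤ l`, since the shooting data are continuous up to `l = 0`. The
  -- infimum then satisfies the same conditions, and positivity is settled afterwards.
  have hclosed : IsClosed {l | (0 ≤ l ∧ shootB a hb γ l = 0) ∧ 0 ≤ shoot a hb l} :=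
    ((isClosed_le continuous_const continuous_id).inter
      (isClosed_eq (continuous_shootB a hb γ) continuous_const)).inter
      (by
        change IsClosed {l | ∀ x, 0 ≤ shoot a hb l x}
        rw [ofPred_forall]
        exact isClosed_iInter fun x => isClosed_le continuous_const
          ((ContinuousMap.evalCLM ℝ x).continuous.comp (continuous_shoot a hb)))
  obtain ⟨⟨h0, h1⟩, h2⟩ := closure_minimal (fun l hl => by
    obtain ⟨hl0, φ, hφ⟩ := hl
    obtain ⟨h3, h4⟩ := shoot_of_solves a hb γ hl0 hφ
    exact ⟨⟨hl0.le, h3⟩, h4⟩) hclosed hmem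
  have hpos : 0 < sparkingVoltage a b γ := by
    refine h0.lt_of_ne fun h => ?_
    rw [← h, shootB_zero] at h1
    norm_num at h1
  exact ⟨hpos, solves_of_shoot a hb γ hpos h1 h2⟩

end

end

end GasDischarge

/-! ### Conclusion of the proof -/

open GasDischarge in
theorem proposition3p4 (a b γ ki ke : ℝ) (ha : 0 < a) (hb : 0 < b) (hγ : 0 < γ)
    (hki : 0 < ki) (hke : 0 < ke) (hS : (a, b, γ) ∈ sparkingSet) (lam : ℝ)
    (hlam : lam = sparkingVoltage a b γ) :
    0 < lam ∧
    (∀ l : ℝ, 0 < l → DifferentiableAt ℝ (F a hb γ ki ke l) 0) ∧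
    DifferentiableAt ℝ (fun l : ℝ => linearization a hb γ ki ke l) lam ∧
    (∃ u : X, u ≠ 0 ∧ linearization a hb γ ki ke lam u = 0 ∧
      SolvesElectronSystem a b γ lam u.1.2.1) ∧
    (∃ ψ : Sobolev 2, ψ ≠ 0 ∧ SolvesAdjoint a b γ lam ψ) ∧
    ∀ u : X, u ≠ 0 → linearization a hb γ ki ke lam u = 0 →
      ∀ ψ : Sobolev 2, ψ ≠ 0 → SolvesAdjoint a b γ lam ψ →
        (Transversal a hb γ ki ke lam u ↔ explicitF a b γ lam u.1.2.1 ψ ≠ 0) ∧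
        ∀ φ : Sobolev 2, SolvesElectronSystem a b γ lam φ →
          (Transversal a hb γ ki ke lam u ↔ explicitF a b γ lam φ ψ ≠ 0) := by
  obtain ⟨hpos, φ₀, hφ₀⟩ := sparkingVoltage_spec a γ hb hS
  rw [← hlam] at hpos hφ₀
  refine ⟨hpos, fun l _ => (hasFDerivAt_F a hb γ ki ke l).differentiableAt,
    differentiableAt_linearization a hb γ ki ke hpos, ?_, exists_adjoint a γ hb hpos hφ₀, ?_⟩
  · rw [linearization_eq]
    exact exists_kernel a hb γ ki ke hpos hki hke hφ₀
  · intro u hu0 hu ψ hψ0 hψ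
    have h1 := transversal_iff a hb γ ki ke hpos hki hke hψ0 hψ u hu
    refine ⟨h1, fun φ hφ => ?_⟩
    rw [linearization_eq] at hu
    obtain ⟨c, hc, hcu⟩ := exists_smul_electron a hb γ ki ke hpos hki hu0 hu hφ
    -- The kernel component is `c φ` with `c ≠ 0`, so the two values of `explicitF` vanish together.
    rw [h1, hcu, explicitF_smul a γ hb hpos, mul_ne_zero_iff]
    exact and_iff_right hc
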